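/- **Setting.** Let $\beta>0$. Write $x\sim y$ for nearest neighbours in $\mathbb Z^2$. For a finite $\Lambda\subset\mathbb Z^2$ with external boundary $\partial\Lambda=\{y\notin\Lambda:\exists x\in\Lambda,\ x\sim y\}$ and $\phi\in\mathbb Z^\Lambda$ put $$\mathcal H_\Lambda(\phi)=\tfrac12\sum_{x,y\in\Lambda,\,x\sim y}|\phi(x)-\phi(y)|+\sum_{x\in\Lambda,\,y\in\partial\Lambda,\,x\sim y}|\phi(x)|,$$ $$\mathcal Z_{\Lambda,\beta}=\sum_{\phi\in\mathbb Z^\Lambda}e^{-\beta\mathcal H_\Lambda(\phi)},\qquad \mathcal Z^{h}_{\Lambda,\beta}=\sum_{\phi\in(\mathbb Z_+)^\Lambda}e^{-\beta\mathcal H_\Lambda(\phi)+h\,|\phi^{-1}\{0\}|}\quad(h\in\mathbb R),$$ where $\mathbb Z_+=\{0,1,2,\dots\}$. With $\Lambda_N=\{1,\dots,N\}^2$ let $$f(\beta)=\lim_{N\to\infty}\frac1{N^2}\log\mathcal Z_{\Lambda_N,\beta},\qquad f(\beta,h)=\lim_{N\to\infty}\frac1{N^2}\log\mathcal Z^{h}_{\Lambda_N,\beta},\qquad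 h_w(\beta)=\sup\{h\in\mathbb R: f(\beta,h)=f(\beta)\},$$ $$\bar f(\beta,u)=f\Big(\beta,\log\frac{e^{4\beta}}{e^{4\beta}-1}+u\Big)-f(\beta).$$ **Contours.** Two distinct edges of the dual lattice $(\mathbb Z^2)^*=(\mathbb Z+\tfrac12)^2$ that meet at $x^*$ are *linked* if they lie on the same side of the line through $x^*$ making an angle $\pi/4$ with the horizontal. A *geometric contour* is a set $\tilde\gamma$ of dual edges that can be enumerated as a cyclic sequence $(e_1,\dots,e_n)$ of $n\ge3$ distinct edges such that (indices modulo $n$) $e_i$ and $e_{i+1}$ share an end point for every $i$, and whenever $i\ne j$ and $e_i,e_{i+1},e_j,e_{j+1}$ meet at a common end point, $e_i,e_{i+1}$ are linked and $e_j,e_{j+1}$ are linked. A *contour* $\gamma$ is a geometric contour $\tilde\gamma$ together with a sign $\pm$; its length is $|\tilde\gamma|=n$, and its interior $\bar\gamma\subset\mathbb Z^2$ is the set of sites that it encloses, i.e. the sites from which the horizontal ray to the right crosses $\tilde\gamma$ an odd number of times. **Proposition.** Let $\beta>0$ be such that $$\sum_{\gamma:\ \mathbf 0\in\bar\gamma}e^{-\beta|\tilde\gamma|}<\infty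 .$$ Then all the quantities above are well defined (the series $\mathcal Z_{\Lambda_N,\beta}$ and $\mathcal Z^h_{\Lambda_N,\beta}$ converge, the limits $f(\beta)$ and $f(\beta,h)$ exist in $\mathbb R$ for all $h\in\mathbb R$, and the set defining $h_w(\beta)$ is non-empty and bounded above), $h_w(\beta)=\inf\{h\in\mathbb R: f(\beta,h)>f(\beta)\}$ (the set on the right being non-empty and bounded below), and $$h_w(\beta)=\log\left(\frac{e^{4\beta}}{e^{4\beta}-1}\right).$$ Moreover there is a constant $c_\beta>0$ such that, for all $u\in(0,1]$, $$\bar f(\beta,u)\ \ge\ c_\beta\,u^3 .$$ -/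

import Mathlib

open Filter Topology

noncomputable section

namespace SOS

/-! The square lattice `ℤ²`, the solid-on-solid model on its finite subsets, the wetting problem. -/

/-- Sites of the square lattice. -/
abbrev Site : Type := ℤ × ℤ

/-- Nearest neighbours: sites at `ℓ¹`-distance one. -/
def Nbr (x y : Site) : Prop := |x.1 - y.1| + |x.2 - y.2| = 1

instance (x y : Site) : Decidable (Nbr x y) := by
  unfold Nbr
  infer_instance

/-- The four nearest neighbours of a site. -/
def nbrs (x : Site) : Finset Site :=
  {(x.1 + 1, x.2), (x.1 - 1, x.2), (x.1, x.2 + 1), (x.1, x.2 - 1)}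

/-- The external boundary `∂Λ`: sites outside `Λ` that have a neighbour in `Λ`. -/
def extBoundary (Λ : Finset Site) : Finset Site := Λ.biUnion nbrs \ Λ

theorem mem_nbrs {x y : Site} : y ∈ nbrs x ↔ Nbr x y := by
  obtain ⟨a, b⟩ := x
  obtain ⟨c, d⟩ := y
  simp only [nbrs, Nbr, Finset.mem_insert, Finset.mem_singleton, Prod.mk.injEq]
  rcases abs_cases (a - c) with h | h <;> rcases abs_cases (b - d) with h' | h' <;> omega

theorem mem_extBoundary {Λ : Finset Site} {y : Site} :
    y ∈ extBoundary Λ ↔ y ∉ Λ ∧ ∃ x ∈ Λ, Nbr x y := by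
  simp only [extBoundary, Finset.mem_sdiff, Finset.mem_biUnion, mem_nbrs]
  exact and_comm

/-- The SOS Hamiltonian on `Λ` with boundary condition `n`. -/
def hamiltonian (Λ : Finset Site) (n : ℤ) (φ : Λ → ℤ) : ℝ :=
  (1 / 2) * (∑ x : Λ, ∑ y : Λ, if Nbr x y then |(φ x : ℝ) - φ y| else 0)
    + ∑ x : Λ, ∑ y ∈ extBoundary Λ, if Nbr x y then |(φ x : ℝ) - n| else 0

/-- Boltzmann weight of an (unconstrained) interface, zero boundary condition. -/
def weight (β : ℝ) (Λ : Finset Site) (φ : Λ → ℤ) : ℝ :=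
  Real.exp (-β * hamiltonian Λ 0 φ)

/-- Boltzmann weight of a nonnegative interface, zero boundary condition, with reward `h` for
each contact with height `0`. -/
def wettingWeight (β h : ℝ) (Λ : Finset Site) (φ : Λ → ℕ) : ℝ :=
  Real.exp (-β * hamiltonian Λ 0 (fun x => (φ x : ℤ))
    + h * ((Finset.univ.filter fun x : Λ => φ x = 0).card : ℝ))

/-- The partition function `𝒵_{Λ,β}`. -/
def partitionFn (β : ℝ) (Λ : Finset Site) : ℝ := ∑' φ : Λ → ℤ, weight β Λ φ

/-- The partition function `𝒵^h_{Λ,β}` of the wetting problem. -/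
def wettingPartitionFn (β h : ℝ) (Λ : Finset Site) : ℝ := ∑' φ : Λ → ℕ, wettingWeight β h Λ φ

/-- The box `Λ_N = ⟦1, N⟧²`. -/
def box (N : ℕ) : Finset Site := Finset.Icc 1 (N : ℤ) ×ˢ Finset.Icc 1 (N : ℤ)

/-- The free energy `f(β)` of the SOS model. -/
def freeEnergy (β : ℝ) : ℝ :=
  limUnder atTop fun N : ℕ => (1 / (N : ℝ) ^ 2) * Real.log (partitionFn β (box N))

/-- The free energy `f(β, h)` of the wetting problem. -/
def wettingFreeEnergy (β h : ℝ) : ℝ :=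
  limUnder atTop fun N : ℕ => (1 / (N : ℝ) ^ 2) * Real.log (wettingPartitionFn β h (box N))

/-- The critical value `h_w(β)`. -/
def criticalPoint (β : ℝ) : ℝ := sSup {h : ℝ | wettingFreeEnergy β h = freeEnergy β}

/-- The excess free energy `f̄(β, u)`. -/
def excessFreeEnergy (β u : ℝ) : ℝ :=
  wettingFreeEnergy β (Real.log (Real.exp (4 * β) / (Real.exp (4 * β) - 1)) + u) - freeEnergy β

/-! Contours. A site `(a, b)` of the dual lattice `(ℤ²)*` is the point `(a + 1/2, b + 1/2)`, so
that the dual lattice is again indexed by `ℤ × ℤ`, with the same adjacency. -/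

/-- Unordered pairs of adjacent dual sites, that is, dual edges. -/
def IsDualEdge (e : Sym2 Site) : Prop := ∃ v w : Site, Nbr v w ∧ e = s(v, w)

/-- Two distinct dual edges `e`, `f` meeting at the dual site `v` are linked (at `v`) if they lie
on the same side of the line through `v` that makes an angle `π/4` with the horizontal. -/
def Linked (v : Site) (e f : Sym2 Site) : Prop :=
  ∃ w z : Site, w ≠ z ∧ e = s(v, w) ∧ f = s(v, z) ∧
    0 < ((w.1 - v.1) - (w.2 - v.2)) * ((z.1 - v.1) - (z.2 - v.2))

/-- Contour sequences, of cyclically indexed distinct dual edges; `finRotate n i` is the cyclic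
successor of `i`. One or two edges never form a closed loop, whence the bound on `n`. -/
structure IsContourSeq {n : ℕ} (e : Fin n → Sym2 Site) : Prop where
  three_le : 3 ≤ n
  isDualEdge : ∀ i, IsDualEdge (e i)
  injective : Function.Injective e
  meet : ∀ i, ∃ v, v ∈ e i ∧ v ∈ e (finRotate n i)
  linked : ∀ i j v, i ≠ j → v ∈ e i → v ∈ e (finRotate n i) → v ∈ e j → v ∈ e (finRotate n j) →
    Linked v (e i) (e (finRotate n i)) ∧ Linked v (e j) (e (finRotate n j))

/-- A (signed) contour: a geometric contour, which is the edge set of a contour sequence, with a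
sign. -/
structure Contour where
  edges : Finset (Sym2 Site)
  exists_seq : ∃ (n : ℕ) (e : Fin n → Sym2 Site), IsContourSeq e ∧ Set.range e = ↑edges
  sign : ℤˣ

/-- The length `|γ̃|` of a contour. -/
def Contour.length (γ : Contour) : ℕ := γ.edges.card

/-- The interior `γ̄`: the sites enclosed by the contour. The contour, with its corners rounded at
the dual sites that it visits twice (as the linking rule prescribes), is a simple closed curve; it
encloses exactly the sites from which the horizontal ray to the right crosses it an odd number of
times. The ray from `x` crosses the vertical dual edges `{(a, x.2 - 1), (a, x.2)}`, `a ≥ x.1`. -/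
def Contour.interior (γ : Contour) : Set Site :=
  {x | Odd (Set.ncard {e | e ∈ γ.edges ∧ ∃ a : ℤ, x.1 ≤ a ∧ e = s((a, x.2 - 1), (a, x.2))})}

/-- The summability condition: the sum of `e^{-β|γ̃|}` over the contours that enclose the origin
is finite. -/
def ContourSummable (β : ℝ) : Prop :=
  Summable fun γ : {γ : Contour // ((0, 0) : Site) ∈ γ.interior} =>
    Real.exp (-β * (γ.1.length : ℝ))

end SOS

end

/-! Write h* for `wettingPoint β` and E for the gradient energy. Since e^{h*} = 1/(1 - e^{-4β}) =
Σ_{j≥0} e^{-4βj}, a contact rewarded by h* is a sum over the depth j of a downward spike that pays 4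
per unit of depth, whatever its neighbours do. So the wetting partition function at h* + u is a sum
over all ζ : Λ → ℤ of exp(-β(E(ζ⁺) + 4 Σ ζ⁻) + u #{ζ ≤ 0}) (`tsum_mul_prod_wettingSite`).

Upper bound. E(ζ) ≤ E(ζ⁺) + 4 Σ ζ⁻, so at u = 0 the sum is at most the SOS partition function, and
f(β, h*) ≤ f(β) (`genPartition_wettingPoint_le`).

Lower bound. Substitute ζ = n - ξ. Up to a boundary factor e^{-4βnN}, the weight becomes at least
the SOS weight of ξ times exp(u #{ξ ≥ n} - β R), where R is the excess above n shared by
neighbouring sites: two spikes cost less than 4 per unit each only if they touch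
(`le_genPartition_wettingSite`). Jensen's inequality reduces the problem to first moments
(`exists_freeEnergy_add_le`). A single spike gives P(ξ(x) ≥ n) ≥ e^{-4βn}/2, while the mean of R is
at most C e^{-6βn} per site, because a contour around two sites has length at least 6. With e^{-2βn}
of order u, the gain u e^{-4βn}/2 beats the loss and is of order u³. For u ≤ 0, letting n → ∞ gives
f(β, h) ≥ f(β). Hence f(β, h) = f(β) exactly for h ≤ h*, which gives all the claims about the
critical point.

The summability hypothesis enters only through the upper tail bounds. Every site where φ ≥ 1 is
enclosed by a contour made of coherently oriented boundary edges of {φ ≥ 1} (`exists_irreducible`);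
lowering φ by one inside it lowers the energy by exactly its length. Iterating at x and y encodes φ
injectively by a height function that is nonpositive at x and y, together with multiplicities of
contours (`exists_decomposition`). The weights factor, and the multiplicities sum to a product of
geometric series, bounded uniformly in the box (`tailWeight_le`, `prod_tilted_le`). A contour is
represented by the set D it encloses, and its edges by the boundary darts of D. -/

noncomputable section

namespace SOS

open scoped ENNReal

/-! ### Boundary darts of a finite set of sites -/

/-- The boundary darts of `D`: pairs of neighbours `(p, q)` with `p ∈ D` and `q ∉ D`. The dart
stands for the dual edge that separates `p` from `q`, oriented so that `p` is on its left. -/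
def darts (D : Finset Site) : Finset (Site × Site) :=
  (D ×ˢ extBoundary D).filter fun e => Nbr e.1 e.2

theorem mem_darts {D : Finset Site} {e : Site × Site} :
    e ∈ darts D ↔ Nbr e.1 e.2 ∧ e.1 ∈ D ∧ e.2 ∉ D := by
  simp only [darts, Finset.mem_filter, Finset.mem_product, mem_extBoundary]
  constructor
  · rintro ⟨⟨h1, h2, _⟩, h3⟩
    exact ⟨h3, h1, h2⟩
  · rintro ⟨h3, h1, h2⟩
    exact ⟨⟨h1, h2, _, h1, h3⟩, h3⟩

theorem Nbr.symm {x y : Site} (h : Nbr x y) : Nbr y x := by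
  unfold Nbr at *
  rw [abs_sub_comm y.1, abs_sub_comm y.2]
  exact h

theorem nbr_comm {x y : Site} : Nbr x y ↔ Nbr y x := ⟨Nbr.symm, Nbr.symm⟩

theorem nbr_iff {x y : Site} : Nbr x y ↔
    y = (x.1 + 1, x.2) ∨ y = (x.1 - 1, x.2) ∨ y = (x.1, x.2 + 1) ∨ y = (x.1, x.2 - 1) := by
  rw [← mem_nbrs]
  simp [nbrs]

theorem Nbr.ne {x y : Site} (h : Nbr x y) : x ≠ y := by
  rintro rfl
  simp [Nbr] at h

/-- The four positions around the dual site `(i, j)` of a dart that points to it. -/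
theorem Nbr.exists_head {p q : Site} (h : Nbr p q) : ∃ i j : ℤ,
    (p, q) = ((i, j), (i + 1, j)) ∨ (p, q) = ((i + 1, j), (i + 1, j + 1)) ∨
    (p, q) = ((i + 1, j + 1), (i, j + 1)) ∨ (p, q) = ((i, j + 1), (i, j)) := by
  obtain ⟨a, b⟩ := p
  rcases nbr_iff.1 h with rfl | rfl | rfl | rfl
  · exact ⟨a, b, Or.inl rfl⟩
  · exact ⟨a - 1, b - 1, by simp⟩
  · exact ⟨a - 1, b, by simp⟩
  · exact ⟨a, b - 1, by simp⟩

/-- The direction in which a dart points. -/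
def dir (e : Site × Site) : Site := (e.1.2 - e.2.2, e.2.1 - e.1.1)

/-- The dual site to which a dart points. -/
def head (e : Site × Site) : Site :=
  (min e.1.1 e.2.1 + min 0 (dir e).1, min e.1.2 e.2.2 + min 0 (dir e).2)

/-- The dual site from which a dart points. -/
def tail (e : Site × Site) : Site :=
  (min e.1.1 e.2.1 + min 0 (-(dir e).1), min e.1.2 e.2.2 + min 0 (-(dir e).2))

/-- The dual edge of a dart. -/
def dualEdge (e : Site × Site) : Sym2 Site := s(tail e, head e)

section values
variable (i j : ℤ)

@[simp] theorem dir_north : dir ((i, j), (i + 1, j)) = (0, 1) := by simp [dir]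
@[simp] theorem dir_west : dir ((i + 1, j), (i + 1, j + 1)) = (-1, 0) := by simp [dir]
@[simp] theorem dir_south : dir ((i + 1, j + 1), (i, j + 1)) = (0, -1) := by simp [dir]
@[simp] theorem dir_east : dir ((i, j + 1), (i, j)) = (1, 0) := by simp [dir]
@[simp] theorem head_north : head ((i, j), (i + 1, j)) = (i, j) := by simp [head]
@[simp] theorem head_west : head ((i + 1, j), (i + 1, j + 1)) = (i, j) := by simp [head]
@[simp] theorem head_south : head ((i + 1, j + 1), (i, j + 1)) = (i, j) := by simp [head]
@[simp] theorem head_east : head ((i, j + 1), (i, j)) = (i, j) := by simp [head]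
@[simp] theorem tail_north : tail ((i, j), (i + 1, j)) = (i, j - 1) := by
  simp [tail]; ring
@[simp] theorem tail_west : tail ((i + 1, j), (i + 1, j + 1)) = (i + 1, j) := by simp [tail]
@[simp] theorem tail_south : tail ((i + 1, j + 1), (i, j + 1)) = (i, j + 1) := by simp [tail]
@[simp] theorem tail_east : tail ((i, j + 1), (i, j)) = (i - 1, j) := by
  simp [tail]; ring

end values

/-- The successor of a boundary dart of `D`: the boundary of `D` is followed with `D` on the left;
at a dual site where four boundary edges meet, linked edges follow each other. -/
def nextDart (D : Finset Site) (e : Site × Site) : Site × Site :=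
  if e.1 + dir e ∈ D then
    if e.2 + dir e ∈ D then (e.2 + dir e, e.2) else (e.1 + dir e, e.2 + dir e)
  -- In the saddle case `D` occupies two diagonal sites around the dual site. The side of the π/4
  -- line containing the south edge also contains the east one, so a vertical dart must turn right
  -- and a horizontal one left.
  else if e.2 + dir e ∈ D ∧ (dir e).1 = 0 then (e.2 + dir e, e.2) else (e.1, e.1 + dir e)

/-- The predecessor of a boundary dart. -/
def prevDart (D : Finset Site) (e : Site × Site) : Site × Site :=
  if e.1 - dir e ∈ D then
    if e.2 - dir e ∈ D then (e.2 - dir e, e.2) else (e.1 - dir e, e.2 - dir e)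
  else if e.2 - dir e ∈ D ∧ (dir e).2 = 0 then (e.2 - dir e, e.2) else (e.1, e.1 - dir e)

theorem nextDart_mem {D : Finset Site} {e : Site × Site} (he : e ∈ darts D) :
    nextDart D e ∈ darts D := by
  obtain ⟨p, q⟩ := e
  obtain ⟨hn, hp, hq⟩ := mem_darts.1 he
  rw [mem_darts]
  obtain ⟨i, j, h | h | h | h⟩ := Nbr.exists_head hn <;> cases h <;> simp only at hp hq <;>
    simp only [nextDart, dir_north, dir_west, dir_south, dir_east] <;> split_ifs <;>
    simp_all [Nbr]

theorem tail_nextDart {D : Finset Site} {e : Site × Site} (he : e ∈ darts D) :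
    tail (nextDart D e) = head e := by
  obtain ⟨p, q⟩ := e
  obtain ⟨hn, hp, hq⟩ := mem_darts.1 he
  obtain ⟨i, j, h | h | h | h⟩ := Nbr.exists_head hn <;> cases h <;> simp only at hp hq <;>
    simp only [nextDart, dir_north, dir_west, dir_south, dir_east] <;> split_ifs <;>
    simp [tail, dir]

/-- Makes the successor map injective on a finite set, hence a permutation whose orbits are closed
loops. -/
theorem prevDart_nextDart {D : Finset Site} {e : Site × Site} (he : e ∈ darts D) :
    prevDart D (nextDart D e) = e := by
  obtain ⟨p, q⟩ := e
  obtain ⟨hn, hp, hq⟩ := mem_darts.1 he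
  obtain ⟨i, j, h | h | h | h⟩ := Nbr.exists_head hn <;> cases h <;> simp only at hp hq <;>
    simp only [nextDart, dir_north, dir_west, dir_south, dir_east] <;> split_ifs <;>
    simp_all [prevDart, dir]

theorem head_mem_dualEdge (e : Site × Site) : head e ∈ dualEdge e := Sym2.mem_mk_right _ _

theorem tail_mem_dualEdge (e : Site × Site) : tail e ∈ dualEdge e := Sym2.mem_mk_left _ _

theorem isDualEdge_dualEdge {D : Finset Site} {e : Site × Site} (he : e ∈ darts D) :
    IsDualEdge (dualEdge e) := by
  obtain ⟨p, q⟩ := e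
  obtain ⟨hn, hp, hq⟩ := mem_darts.1 he
  refine ⟨_, _, ?_, rfl⟩
  obtain ⟨i, j, h | h | h | h⟩ := Nbr.exists_head hn <;> cases h <;> simp [Nbr]

/-- A dual edge has only two orientations, and the reversed dart would have its left site outside
`D`. -/
theorem dualEdge_injOn (D : Finset Site) : Set.InjOn dualEdge (darts D : Set (Site × Site)) := by
  rintro ⟨p, q⟩ he ⟨p', q'⟩ he' h
  obtain ⟨hn, hp, hq⟩ := mem_darts.1 he
  obtain ⟨hn', hp', hq'⟩ := mem_darts.1 he'
  obtain ⟨i, j, h1 | h1 | h1 | h1⟩ := Nbr.exists_head hn <;>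
  obtain ⟨k, l, h2 | h2 | h2 | h2⟩ := Nbr.exists_head hn' <;> cases h1 <;> cases h2 <;>
  simp only [dualEdge, head_north, head_west, head_south, head_east, tail_north, tail_west,
    tail_south, tail_east, Sym2.eq_iff, Prod.mk.injEq] at h <;>
  simp only at hp hq hp' hq' <;>
  first
  | (exfalso; omega)
  | (obtain ⟨rfl, rfl⟩ : k = i ∧ l = j := by omega
     rfl)
  | (exfalso
     first
     | (obtain ⟨rfl, rfl⟩ : k = i ∧ l = j + 1 := by omega
        exact hq (by simpa using hp'))
     | (obtain ⟨rfl, rfl⟩ : k = i ∧ l = j - 1 := by omega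
        exact hq (by simpa using hp'))
     | (obtain ⟨rfl, rfl⟩ : k = i + 1 ∧ l = j := by omega
        exact hq (by simpa using hp'))
     | (obtain ⟨rfl, rfl⟩ : k = i - 1 ∧ l = j := by omega
        exact hq (by simpa using hp')))

/-- Two boundary darts can point to the same dual site only at a saddle, and there the successor
follows the linking rule by construction. -/
theorem linked_of_head_eq {D : Finset Site} {e f : Site × Site} (he : e ∈ darts D)
    (hf : f ∈ darts D) (hne : e ≠ f) (h : head e = head f) :
    Linked (head e) (dualEdge e) (dualEdge (nextDart D e)) := by
  obtain ⟨p, q⟩ := e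
  obtain ⟨p', q'⟩ := f
  obtain ⟨hn, hp, hq⟩ := mem_darts.1 he
  obtain ⟨hn', hp', hq'⟩ := mem_darts.1 hf
  refine ⟨tail (p, q), head (nextDart D (p, q)), ?_, Sym2.eq_swap, ?_, ?_⟩
  rotate_left
  · rw [dualEdge, tail_nextDart he]
  all_goals
    obtain ⟨i, j, h1 | h1 | h1 | h1⟩ := Nbr.exists_head hn <;>
    obtain ⟨k, l, h2 | h2 | h2 | h2⟩ := Nbr.exists_head hn' <;> cases h1 <;> cases h2 <;>
    simp only [head_north, head_west, head_south, head_east, Prod.mk.injEq] at h <;>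
    obtain ⟨rfl, rfl⟩ := h <;> simp_all [nextDart, head, dir]

/-! ### Discrete Poincaré lemma modulo two -/

/-- A finitely supported closed one-form on `ℤ²` with values in `ZMod 2` is the differential of a
finitely supported function. -/
theorem exists_primitive_zmod_two (c₁ c₂ : ℤ → ℤ → ZMod 2) (L : ℤ)
    (h₁ : ∀ x y, c₁ x y ≠ 0 → |x| < L ∧ |y| < L) (h₂ : ∀ x y, c₂ x y ≠ 0 → |x| < L ∧ |y| < L)
    (hc : ∀ x y, c₁ x y + c₁ x (y + 1) = c₂ x y + c₂ (x + 1) y) :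
    ∃ I : ℤ → ℤ → ZMod 2, (∀ x y, I x y + I (x + 1) y = c₁ x y) ∧
      (∀ x y, I x y + I x (y + 1) = c₂ x y) ∧ ∀ x y, I x y ≠ 0 → |x| < L ∧ |y| < L := by
  have two : ∀ a : ZMod 2, a + a = 0 := by decide
  -- The parity of the crossings of the horizontal ray to the right.
  let I : ℤ → ℤ → ZMod 2 := fun x y => ∑ i ∈ Finset.range (L - x).toNat, c₁ (x + i) y
  have hI0 : ∀ x y, L ≤ x → I x y = 0 := by
    intro x y hx
    simp [I, Int.toNat_of_nonpos (show L - x ≤ 0 by omega)]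
  have hstep : ∀ x y, I x y = c₁ x y + I (x + 1) y := by
    intro x y
    rcases lt_or_ge x L with hx | hx
    · have : (L - x).toNat = (L - (x + 1)).toNat + 1 := by omega
      simp only [I]
      rw [this, Finset.sum_range_succ', add_comm]
      congr 1
      · simp
      · refine Finset.sum_congr rfl fun i _ => ?_
        push_cast
        congr 1
        ring
    · rw [hI0 x y hx, hI0 (x + 1) y (by omega)]
      by_contra hne
      have := (h₁ x y (by simpa using Ne.symm hne)).1
      have := le_abs_self x
      omega
  have hvert : ∀ n : ℕ, ∀ x y, (L - x).toNat = n → I x y + I x (y + 1) = c₂ x y := by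
    intro n
    induction n with
    | zero =>
      intro x y hn
      have hx : L ≤ x := by omega
      rw [hI0 x y hx, hI0 x (y + 1) hx]
      by_contra hne
      have := (h₂ x y (by simpa using Ne.symm hne)).1
      have := le_abs_self x
      omega
    | succ n ih =>
      intro x y hn
      have := ih (x + 1) y (by omega)
      rw [hstep x y, hstep x (y + 1)]
      calc c₁ x y + I (x + 1) y + (c₁ x (y + 1) + I (x + 1) (y + 1))
          = (c₁ x y + c₁ x (y + 1)) + (I (x + 1) y + I (x + 1) (y + 1)) := by ring
        _ = c₂ x y + (c₂ (x + 1) y + c₂ (x + 1) y) := by rw [this, hc]; ring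
        _ = c₂ x y := by rw [two, add_zero]
  have hrow : ∀ x y, L ≤ |y| → I x y = 0 := by
    intro x y hy
    refine Finset.sum_eq_zero fun i _ => ?_
    by_contra hne
    have := (h₁ _ _ hne).2
    omega
  -- Left of the support `c₂` vanishes, so `I` is constant along columns there; it is zero high up,
  -- hence everywhere on the column.
  have hleft : ∀ n : ℕ, ∀ x y, x ≤ -L → (L - y).toNat = n → I x y = 0 := by
    intro n
    induction n with
    | zero =>
      intro x y _ hn
      exact hrow x y (by have := le_abs_self y; omega)
    | succ n ih =>
      intro x y hx hn
      have h0 : c₂ x y = 0 := by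
        by_contra hne
        have := (h₂ x y hne).1
        have := neg_le_abs x
        omega
      have := hvert _ x y rfl
      rw [ih x (y + 1) hx (by omega), h0, add_zero] at this
      exact this
  refine ⟨I, fun x y => ?_, fun x y => hvert _ x y rfl, fun x y hne => ⟨?_, ?_⟩⟩
  · rw [hstep x y, add_assoc, two, add_zero]
  · rw [abs_lt]
    constructor
    · by_contra h
      exact hne (hleft _ x y (by omega) rfl)
    · by_contra h
      exact hne (hI0 x y (by omega))
  · by_contra h
    exact hne (hrow x y (by omega))

theorem exists_bound (S : Finset Site) : ∃ L : ℤ, ∀ p ∈ S, |p.1| < L ∧ |p.2| < L := by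
  refine ⟨∑ p ∈ S, (|p.1| + |p.2|) + 1, fun p hp => ?_⟩
  have := Finset.single_le_sum (f := fun p : Site => |p.1| + |p.2|)
    (fun _ _ => by positivity) hp
  have h1 := abs_nonneg p.1
  have h2 := abs_nonneg p.2
  constructor <;> omega

/-- A set of boundary darts of `D` that is invariant under the successor map is the boundary, up
to orientation, of a finite set of sites. -/
theorem exists_interior {D : Finset Site} {C : Finset (Site × Site)} (hCD : C ⊆ darts D)
    (hC : ∀ e ∈ darts D, (nextDart D e ∈ C ↔ e ∈ C)) : ∃ I : Finset Site, ∀ p q, Nbr p q →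
      ((p ∈ I ↔ q ∈ I) ↔ ¬((p, q) ∈ C ∨ (q, p) ∈ C)) := by
  classical
  let c : Site → Site → ZMod 2 := fun p q => if (p, q) ∈ C ∨ (q, p) ∈ C then 1 else 0
  obtain ⟨L, hL⟩ := exists_bound (C.image Prod.fst ∪ C.image Prod.snd)
  have hcL : ∀ p q, c p q ≠ 0 → |p.1| < L ∧ |p.2| < L := by
    intro p q h
    apply hL
    rw [Finset.mem_union, Finset.mem_image, Finset.mem_image]
    by_contra hno
    push Not at hno
    refine h (if_neg ?_)
    rintro (h | h)
    · exact hno.1 _ h rfl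
    · exact hno.2 _ h rfl
  have hnot : ∀ p q, p ∉ D → (p, q) ∉ C := fun p q hp h => hp (mem_darts.1 (hCD h)).2.1
  have hnot' : ∀ p q, q ∈ D → (p, q) ∉ C := fun p q hp h => (mem_darts.1 (hCD h)).2.2 hp
  have two : ∀ a : ZMod 2, a + a = 0 := by decide
  -- Closedness says that an even number of edges of `C` meets each dual site: the successor pairs
  -- each arriving dart of `C` with a departing one.
  have hclosed : ∀ x y : ℤ, c (x, y) (x + 1, y) + c (x, y + 1) (x + 1, y + 1) =
      c (x, y) (x, y + 1) + c (x + 1, y) (x + 1, y + 1) := by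
    intro x y
    have hN : (x, y) ∈ D → (x + 1, y) ∉ D → ((nextDart D ((x, y), (x + 1, y))) ∈ C ↔
        ((x, y), (x + 1, y)) ∈ C) := fun h1 h2 => hC _ (mem_darts.2 ⟨by simp [Nbr], h1, h2⟩)
    have hW : (x + 1, y) ∈ D → (x + 1, y + 1) ∉ D →
        ((nextDart D ((x + 1, y), (x + 1, y + 1))) ∈ C ↔ ((x + 1, y), (x + 1, y + 1)) ∈ C) :=
      fun h1 h2 => hC _ (mem_darts.2 ⟨by simp [Nbr], h1, h2⟩)
    have hS : (x + 1, y + 1) ∈ D → (x, y + 1) ∉ D →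
        ((nextDart D ((x + 1, y + 1), (x, y + 1))) ∈ C ↔ ((x + 1, y + 1), (x, y + 1)) ∈ C) :=
      fun h1 h2 => hC _ (mem_darts.2 ⟨by simp [Nbr], h1, h2⟩)
    have hE : (x, y + 1) ∈ D → (x, y) ∉ D → ((nextDart D ((x, y + 1), (x, y))) ∈ C ↔
        ((x, y + 1), (x, y)) ∈ C) := fun h1 h2 => hC _ (mem_darts.2 ⟨by simp [Nbr], h1, h2⟩)
    simp only [nextDart, dir_north, dir_west, dir_south, dir_east] at hN hW hS hE
    by_cases ha : (x, y) ∈ D <;> by_cases hb : (x + 1, y) ∈ D <;>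
    by_cases hd : (x, y + 1) ∈ D <;> by_cases he : (x + 1, y + 1) ∈ D <;>
    simp [ha, hb, hd, he] at hN hW hS hE <;>
    simp [c, ha, hb, hd, he, hnot, hnot', hN, hW, hS, hE, add_comm, two]
  obtain ⟨I, hI1, hI2, hI3⟩ := exists_primitive_zmod_two
    (fun x y => c (x, y) (x + 1, y)) (fun x y => c (x, y) (x, y + 1)) L
    (fun x y h => hcL _ _ h) (fun x y h => hcL _ _ h) hclosed
  have hfin : {p : Site | I p.1 p.2 ≠ 0}.Finite := by
    refine (Finset.finite_toSet (Finset.Icc (-L) L ×ˢ Finset.Icc (-L) L)).subset fun p hp => ?_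
    obtain ⟨h1, h2⟩ := hI3 _ _ hp
    rw [abs_lt] at h1 h2
    simp only [Finset.coe_product, Finset.coe_Icc, Set.mem_prod, Set.mem_Icc]
    omega
  have hmem : ∀ p, p ∈ hfin.toFinset ↔ I p.1 p.2 = 1 := by
    intro p
    rw [Set.Finite.mem_toFinset, Set.mem_ofPred_eq]
    generalize I p.1 p.2 = a
    revert a
    decide
  have key : ∀ a b : ZMod 2, ∀ P : Prop, [Decidable P] → a + b = (if P then 1 else 0) →
      ((a = 1 ↔ b = 1) ↔ ¬P) := by
    intro a b P _ h
    split_ifs at h with hP <;> simp only [hP] <;> revert a b <;> decide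
  have hcc : ∀ p q, c p q = c q p := fun p q => if_congr or_comm rfl rfl
  refine ⟨hfin.toFinset, fun p q hpq => ?_⟩
  rw [hmem, hmem]
  apply key
  change _ = c p q
  obtain ⟨x, y⟩ := p
  rcases nbr_iff.1 hpq with rfl | rfl | rfl | rfl
  · exact hI1 x y
  · have := hI1 (x - 1) y
    simp only [sub_add_cancel] at this
    rw [add_comm, hcc]
    exact this
  · exact hI2 x y
  · have := hI2 x (y - 1)
    simp only [sub_add_cancel] at this
    rw [add_comm, hcc]
    exact this

/-! ### Number of boundary darts -/

/-- A half-line cannot stay forever in a finite set, so it leaves `D` across some boundary dart. -/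
theorem exists_last {D : Finset Site} {p d : Site} (hp : p ∈ D) (hd : d ≠ 0) :
    ∃ k : ℕ, p + k • d ∈ D ∧ p + (k + 1) • d ∉ D := by
  by_contra! h
  have hall : ∀ k : ℕ, p + k • d ∈ D := by
    intro k
    induction k with
    | zero => simpa using hp
    | succ k ih => exact h k ih
  refine not_injective_infinite_finite (fun k : ℕ => (⟨p + k • d, hall k⟩ : D)) ?_
  intro k l hkl
  simp only [Subtype.mk.injEq, add_right_inj] at hkl
  rcases eq_or_ne d.1 0 with h1 | h1
  · have h2 : d.2 ≠ 0 := fun h2 => hd (Prod.ext h1 h2)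
    have := congrArg Prod.snd hkl
    simpa [h2] using this
  · have := congrArg Prod.fst hkl
    simpa [h1] using this

theorem card_image_le_card_darts {D : Finset Site} {d : Site} (hd : Nbr 0 d) (π : Site → ℤ)
    (hπ : ∀ (p : Site) (k : ℕ), π (p + k • d) = π p) :
    (D.image π).card ≤ ((darts D).filter fun e => e.2 - e.1 = d).card := by
  classical
  refine le_trans (Finset.card_le_card fun c hc => ?_)
    (Finset.card_image_le (f := fun e : Site × Site => π e.1))
  obtain ⟨p, hp, rfl⟩ := Finset.mem_image.1 hc
  obtain ⟨k, hk, hk'⟩ := exists_last hp hd.ne.symm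
  refine Finset.mem_image.2 ⟨(p + k • d, p + (k + 1) • d), ?_, hπ p k⟩
  rw [Finset.mem_filter, mem_darts]
  refine ⟨⟨?_, hk, hk'⟩, ?_⟩
  · simp only [Nbr, succ_nsmul] at hd ⊢
    simpa using hd
  · rw [succ_nsmul]
    simp

/-- The boundary of `D` has at least two darts in every row and in every column that `D` meets. -/
theorem two_mul_le_card_darts (D : Finset Site) :
    2 * ((D.image Prod.fst).card + (D.image Prod.snd).card) ≤ (darts D).card := by
  classical
  have hmaps : ∀ e ∈ darts D, e.2 - e.1 ∈ nbrs 0 := by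
    intro e he
    have := (mem_darts.1 he).1
    rw [mem_nbrs]
    simp only [Nbr] at this ⊢
    rw [abs_sub_comm e.1.1, abs_sub_comm e.1.2] at this
    simpa [abs_sub_comm] using this
  rw [Finset.card_eq_sum_card_fiberwise hmaps]
  have h1 := card_image_le_card_darts (D := D) (d := (1, 0)) (by simp [Nbr]) Prod.snd (by simp)
  have h2 := card_image_le_card_darts (D := D) (d := (-1, 0)) (by simp [Nbr]) Prod.snd (by simp)
  have h3 := card_image_le_card_darts (D := D) (d := (0, 1)) (by simp [Nbr]) Prod.fst (by simp)
  have h4 := card_image_le_card_darts (D := D) (d := (0, -1)) (by simp [Nbr]) Prod.fst (by simp)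
  have : nbrs 0 = {(1, 0), (-1, 0), (0, 1), (0, -1)} := by simp [nbrs]
  rw [this, Finset.sum_insert (by simp), Finset.sum_insert (by simp),
    Finset.sum_insert (by simp), Finset.sum_singleton]
  omega

theorem four_le_card_darts {D : Finset Site} {x : Site} (hx : x ∈ D) : 4 ≤ (darts D).card := by
  have h := two_mul_le_card_darts D
  have h1 : 0 < (D.image Prod.fst).card := Finset.card_pos.2 ⟨_, Finset.mem_image_of_mem _ hx⟩
  have h2 : 0 < (D.image Prod.snd).card := Finset.card_pos.2 ⟨_, Finset.mem_image_of_mem _ hx⟩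
  omega

theorem card_le_card_image_mul (D : Finset Site) :
    D.card ≤ (D.image Prod.fst).card * (D.image Prod.snd).card := by
  rw [← Finset.card_product]
  refine Finset.card_le_card fun p hp => ?_
  exact Finset.mem_product.2 ⟨Finset.mem_image_of_mem _ hp, Finset.mem_image_of_mem _ hp⟩

/-- A set with projections of sizes a and b has at most ab sites and at least 2(a + b) boundary
darts; ab ≥ 2 forces a + b ≥ 3. In the next lemma ab ≥ 3 forces a + b ≥ 4. These are the gaps 4 < 6
< 8 on which the pair estimate rests. -/
theorem six_le_card_darts {D : Finset Site} {x y : Site} (hx : x ∈ D) (hy : y ∈ D) (hxy : x ≠ y) :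
    6 ≤ (darts D).card := by
  have h := two_mul_le_card_darts D
  have h2 : 2 ≤ D.card := Finset.one_lt_card.2 ⟨x, hx, y, hy, hxy⟩
  have h3 := h2.trans (card_le_card_image_mul D)
  generalize (D.image Prod.fst).card = a at *
  generalize (D.image Prod.snd).card = b at *
  by_contra hlt
  have ha : a ≤ 2 := by omega
  have hb : b ≤ 2 := by omega
  interval_cases a <;> interval_cases b <;> omega

theorem eight_le_card_darts {D : Finset Site} {x y : Site} (hx : x ∈ D) (hy : y ∈ D)
    (hxy : x ≠ y) (hD : D ≠ {x, y}) : 8 ≤ (darts D).card := by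
  have h := two_mul_le_card_darts D
  have h2 : 3 ≤ D.card := by
    have hss : ({x, y} : Finset Site) ⊂ D := by
      refine Finset.ssubset_iff_subset_ne.2 ⟨?_, hD.symm⟩
      intro z hz
      rcases Finset.mem_insert.1 hz with rfl | hz
      · exact hx
      · rwa [Finset.mem_singleton.1 hz]
    have := Finset.card_lt_card hss
    rw [Finset.card_pair hxy] at this
    omega
  have h3 := h2.trans (card_le_card_image_mul D)
  generalize (D.image Prod.fst).card = a at *
  generalize (D.image Prod.snd).card = b at *
  by_contra hlt
  have ha : a ≤ 3 := by omega
  have hb : b ≤ 3 := by omega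
  interval_cases a <;> interval_cases b <;> omega

/-! ### Irreducible sets -/

/-- The dual edges that separate `D` from its complement form a geometric contour. -/
def Irreducible (D : Finset Site) : Prop :=
  ∃ (n : ℕ) (e : Fin n → Sym2 Site),
    IsContourSeq e ∧ Set.range e = ((darts D).image dualEdge : Finset (Sym2 Site))

theorem nextDart_injOn (D : Finset Site) : Set.InjOn (nextDart D) (darts D : Set (Site × Site)) :=
  fun _ he _ hf h => by rw [← prevDart_nextDart he, ← prevDart_nextDart hf, h]

/-- The successor map on the boundary darts of `D`. -/
def succDart (D : Finset Site) (e : darts D) : darts D := ⟨nextDart D e, nextDart_mem e.2⟩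

theorem succDart_injective (D : Finset Site) : Function.Injective (succDart D) := by
  intro e f h
  exact Subtype.ext (nextDart_injOn D e.2 f.2 (congrArg Subtype.val h))

/-- When the successor map has a single orbit, its iterates enumerate the boundary edges cyclically,
without repetition over one minimal period. -/
theorem irreducible_of_orbit {D : Finset Site} (e₀ : darts D) (h4 : 4 ≤ (darts D).card)
    (h : ∀ e : darts D, ∃ k : ℕ, (succDart D)^[k] e₀ = e) : Irreducible D := by
  classical
  have hper := (succDart_injective D).mem_periodicPts e₀
  set n := Function.minimalPeriod (succDart D) e₀ with hn
  have hnpos : 0 < n := Function.minimalPeriod_pos_of_mem_periodicPts hper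
  let f : Fin n → darts D := fun i => (succDart D)^[i] e₀
  have hfinj : Function.Injective f := by
    intro i j hij
    exact Fin.ext (Function.iterate_injOn_Iio_minimalPeriod i.2 j.2 hij)
  have hfsurj : Function.Surjective f := by
    intro e
    obtain ⟨k, hk⟩ := h e
    refine ⟨⟨k % n, Nat.mod_lt _ hnpos⟩, ?_⟩
    simp only [f]
    rw [hn, Function.iterate_mod_minimalPeriod_eq, hk]
  have hcard : n = (darts D).card := by
    have := Fintype.card_of_bijective ⟨hfinj, hfsurj⟩
    simpa using this
  have hrot : ∀ i, f (finRotate n i) = succDart D (f i) := by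
    obtain ⟨m, hm⟩ : ∃ m, n = m + 1 := ⟨n - 1, by omega⟩
    intro i
    have hs : succDart D (f i) = (succDart D)^[i + 1] e₀ :=
      (Function.iterate_succ_apply' _ _ _).symm
    rw [hs]
    simp only [f]
    have : ((finRotate n i : Fin n) : ℕ) = (i + 1) % n := by
      clear_value n
      subst hm
      rw [finRotate_apply, Fin.val_add_one]
      split_ifs with hi
      · simp [hi]
      · rw [Nat.mod_eq_of_lt]
        have := Fin.val_lt_last hi
        omega
    rw [this]
    exact Function.iterate_mod_minimalPeriod_eq
  have hmeet : ∀ i, head (f i) ∈ dualEdge (f (finRotate n i)) := by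
    intro i
    rw [hrot, ← tail_nextDart (f i).2]
    exact tail_mem_dualEdge _
  have hedgeinj : Function.Injective fun i => dualEdge (f i) := fun i j hij =>
    hfinj (Subtype.ext (dualEdge_injOn D (f i).2 (f j).2 hij))
  have hrotne : ∀ i, finRotate n i ≠ i := by
    obtain ⟨m, hm⟩ : ∃ m, n = m + 2 := ⟨n - 2, by omega⟩
    clear_value n
    subst hm
    intro i
    rw [finRotate_apply]
    simp
  -- Another common vertex would give consecutive edges both end points in common, so they would
  -- coincide.
  have hv : ∀ i v, v ∈ dualEdge (f i) → v ∈ dualEdge (f (finRotate n i)) → v = head (f i) := by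
    intro i v h1 h2
    by_contra hne
    have e1 := (Sym2.mem_and_mem_iff hne).1 ⟨h1, head_mem_dualEdge _⟩
    have e2 := (Sym2.mem_and_mem_iff hne).1 ⟨h2, hmeet i⟩
    exact hrotne i (hedgeinj (e2.trans e1.symm))
  refine ⟨n, fun i => dualEdge (f i), ⟨by omega, fun i => isDualEdge_dualEdge (f i).2, hedgeinj,
    fun i => ⟨_, head_mem_dualEdge _, hmeet i⟩, ?_⟩, ?_⟩
  · intro i j v hij h1 h2 h3 h4
    have hi := hv i v h1 h2
    have hj := hv j v h3 h4
    have hne : (f i : Site × Site) ≠ f j := fun h => hij (hfinj (Subtype.ext h))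
    rw [hrot, hrot]
    constructor
    · rw [hi]
      exact linked_of_head_eq (f i).2 (f j).2 hne (hi.symm.trans hj)
    · rw [hj]
      exact linked_of_head_eq (f j).2 (f i).2 hne.symm (hj.symm.trans hi)
  · ext s
    simp only [Set.mem_range, Finset.coe_image, Set.mem_image, Finset.mem_coe]
    constructor
    · rintro ⟨i, rfl⟩
      exact ⟨_, (f i).2, rfl⟩
    · rintro ⟨e, he, rfl⟩
      obtain ⟨i, hi⟩ := hfsurj ⟨e, he⟩
      exact ⟨i, by rw [hi]⟩

/-- A set with a boundary dart outside the orbit of another one can be replaced by a set with a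
strictly smaller boundary. -/
theorem exists_smaller {D : Finset Site} {x : Site} (hx : x ∈ D) (e₀ : darts D)
    (h : ¬∀ e : darts D, ∃ k : ℕ, (succDart D)^[k] e₀ = e) :
    ∃ E : Finset Site, x ∈ E ∧ darts E ⊂ darts D := by
  classical
  let orb : Set (darts D) := {e | ∃ k : ℕ, (succDart D)^[k] e₀ = e}
  have horb : ∀ e, succDart D e ∈ orb ↔ e ∈ orb := by
    intro e
    constructor
    · rintro ⟨k, hk⟩
      rcases k with _ | k
      -- If the successor is `e₀` itself, the dart is reached at the end of the previous turn of the
      -- cycle.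
      · obtain ⟨n, hn, hper⟩ := (succDart_injective D).mem_periodicPts e₀
        refine ⟨n - 1, succDart_injective D ?_⟩
        rw [← Function.iterate_succ_apply' (succDart D), Nat.succ_eq_add_one, Nat.sub_add_cancel hn]
        exact hper.trans hk
      · rw [Function.iterate_succ_apply'] at hk
        exact ⟨k, succDart_injective D hk⟩
    · rintro ⟨k, hk⟩
      exact ⟨k + 1, by rw [Function.iterate_succ_apply', hk]⟩
  let C : Finset (Site × Site) := (darts D).filter fun e => ∃ h : e ∈ darts D, ⟨e, h⟩ ∈ orb
  have hCmem : ∀ (e : Site × Site) (he : e ∈ darts D), e ∈ C ↔ ⟨e, he⟩ ∈ orb := by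
    intro e he
    simp only [C, Finset.mem_filter]
    exact ⟨fun h => h.2.2, fun h => ⟨he, he, h⟩⟩
  have hCD : C ⊆ darts D := Finset.filter_subset _ _
  have hC : ∀ e ∈ darts D, (nextDart D e ∈ C ↔ e ∈ C) := by
    intro e he
    rw [hCmem e he, hCmem _ (nextDart_mem he)]
    exact horb ⟨e, he⟩
  have h0C : (e₀ : Site × Site) ∈ C := (hCmem _ e₀.2).2 ⟨0, rfl⟩
  have hCne : ∃ e ∈ darts D, e ∉ C := by
    push Not at h
    obtain ⟨e, he⟩ := h
    exact ⟨e, e.2, fun hc => let ⟨k, hk⟩ := (hCmem _ e.2).1 hc; he k hk⟩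
  obtain ⟨I, hI⟩ := exists_interior hCD hC
  have hI' : ∀ e ∈ darts D, ((e.1 ∈ I ↔ e.2 ∈ I) ↔ e ∉ C) := by
    intro e he
    obtain ⟨hn, hp, hq⟩ := mem_darts.1 he
    rw [hI _ _ hn]
    have : (e.2, e.1) ∉ C := fun hc => hq (mem_darts.1 (hCD hc)).2.1
    simp [this]
  -- the orientation is constant along the orbit
  have hstep : ∀ e ∈ C, ((nextDart D e).1 ∈ I ↔ e.1 ∈ I) := by
    intro e he
    have heD := hCD he
    have hne := mt (hI' e heD).1 (not_not.2 he)
    have hne' := mt (hI' _ (nextDart_mem heD)).1 (not_not.2 ((hC e heD).2 he))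
    obtain ⟨hn, hp, hq⟩ := mem_darts.1 heD
    unfold nextDart at hne' ⊢
    split_ifs at hne' ⊢ with h1 h2 h3
    · simp only at hne' ⊢
      tauto
    · simp only
      -- When the boundary runs straight, both left sites are in `D`, so no dart of `C` separates
      -- them.
      have hnn : Nbr (e.1 + dir e) e.1 := by
        obtain ⟨p, q⟩ := e
        obtain ⟨i, j, h | h | h | h⟩ := Nbr.exists_head hn <;> cases h <;> simp [Nbr]
      rw [hI _ _ hnn]
      rintro (hc | hc)
      · exact (mem_darts.1 (hCD hc)).2.2 hp
      · exact (mem_darts.1 (hCD hc)).2.2 h1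
    · simp only at hne' ⊢
      tauto
    · rfl
  have hconst : ∀ e ∈ C, (e.1 ∈ I ↔ (e₀ : Site × Site).1 ∈ I) := by
    have : ∀ k : ℕ, (((succDart D)^[k] e₀ : Site × Site).1 ∈ I ↔ (e₀ : Site × Site).1 ∈ I) := by
      intro k
      induction k with
      | zero => rfl
      | succ k ih =>
        rw [Function.iterate_succ_apply', ← ih]
        exact hstep _ ((hCmem _ (Subtype.prop _)).2 ⟨k, rfl⟩)
    intro e he
    obtain ⟨k, hk⟩ := (hCmem e (hCD he)).1 he
    have := this k
    rwa [hk] at this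
  -- boundary pairs of `I` are darts of `C`, all with the same orientation
  have hbd : ∀ p q, Nbr p q → p ∈ I → q ∉ I → (p, q) ∈ C ∨ (q, p) ∈ C := by
    intro p q hn hp hq
    by_contra hno
    exact hq (((hI p q hn).2 hno).1 hp)
  -- If `I` lies on the `D` side of the loop, the loop is an outer boundary, and either `I` or `D \
  -- I` keeps `x`. Otherwise the loop surrounds a hole, which is filled. In each case only darts of
  -- `D` with their original orientation remain, and some are lost.
  by_cases hor : (e₀ : Site × Site).1 ∈ I
  · have hIC : ∀ p q, Nbr p q → p ∈ I → q ∉ I → (p, q) ∈ C := by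
      intro p q hn hp hq
      refine (hbd p q hn hp hq).resolve_right fun hc => hq ?_
      exact (hconst _ hc).2 hor
    by_cases hxI : x ∈ I
    · refine ⟨I, hxI, Finset.ssubset_iff_subset_ne.2 ⟨?_, ?_⟩⟩
      · intro e he
        obtain ⟨hn, hp, hq⟩ := mem_darts.1 he
        exact hCD (hIC _ _ hn hp hq)
      · intro heq
        obtain ⟨e, he, heC⟩ := hCne
        rw [← heq] at he
        obtain ⟨hn, hp, hq⟩ := mem_darts.1 he
        exact heC (hIC _ _ hn hp hq)
    · refine ⟨D \ I, Finset.mem_sdiff.2 ⟨hx, hxI⟩, Finset.ssubset_iff_subset_ne.2 ⟨?_, ?_⟩⟩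
      · intro e he
        obtain ⟨hn, hp, hq⟩ := mem_darts.1 he
        rw [Finset.mem_sdiff] at hp hq
        refine mem_darts.2 ⟨hn, hp.1, fun hqD => ?_⟩
        have hqI : e.2 ∈ I := by
          by_contra hqI
          exact hq ⟨hqD, hqI⟩
        exact (mem_darts.1 (hCD (hIC _ _ hn.symm hqI hp.2))).2.2 hp.1
      · intro heq
        have := mem_darts.1 (heq.ge e₀.2)
        exact (Finset.mem_sdiff.1 this.2.1).2 hor
  · have hIC : ∀ p q, Nbr p q → p ∈ I → q ∉ I → (q, p) ∈ C := by
      intro p q hn hp hq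
      exact (hbd p q hn hp hq).resolve_left fun hc => hor ((hconst _ hc).1 hp)
    refine ⟨D ∪ I, Finset.mem_union_left _ hx, Finset.ssubset_iff_subset_ne.2 ⟨?_, ?_⟩⟩
    · intro e he
      obtain ⟨hn, hp, hq⟩ := mem_darts.1 he
      rw [Finset.mem_union] at hp hq
      push Not at hq
      refine mem_darts.2 ⟨hn, ?_, hq.1⟩
      by_contra hpD
      have hpI := hp.resolve_left hpD
      exact hq.1 (mem_darts.1 (hCD (hIC _ _ hn hpI hq.2))).2.1
    · intro heq
      have h1 := (mem_darts.1 (heq.ge e₀.2)).2.2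
      rw [Finset.mem_union] at h1
      push Not at h1
      exact (hI' _ e₀.2).1 (iff_of_false hor h1.2) h0C

/-- Every site of a finite set is enclosed by a contour made of outward boundary edges. -/
theorem exists_irreducible {A : Finset Site} {x : Site} (hx : x ∈ A) :
    ∃ D : Finset Site, x ∈ D ∧ darts D ⊆ darts A ∧ Irreducible D := by
  induction hn : (darts A).card using Nat.strong_induction_on generalizing A with
  | _ n ih =>
    have h4 := four_le_card_darts hx
    obtain ⟨e₀, he₀⟩ : (darts A).Nonempty := Finset.card_pos.1 (by omega)
    by_cases h : ∀ e : darts A, ∃ k : ℕ, (succDart A)^[k] ⟨e₀, he₀⟩ = e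
    · exact ⟨A, hx, subset_rfl, irreducible_of_orbit _ h4 h⟩
    · obtain ⟨E, hxE, hE⟩ := exists_smaller hx _ h
      obtain ⟨D, h1, h2, h3⟩ := ih _ (hn ▸ Finset.card_lt_card hE) hxE rfl
      exact ⟨D, h1, h2.trans hE.1, h3⟩

/-! ### Irreducible sets and contours -/

/-- `P` fails far to the right, and its truth value flips at each change met on the way back to `x`.
-/
theorem odd_ncard_changes (P : ℤ → Prop) (R : ℤ) (hR : ∀ a, R ≤ a → ¬P a) (x : ℤ) :
    Odd (Set.ncard {a | x ≤ a ∧ ¬(P a ↔ P (a + 1))}) ↔ P x := by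
  have hfin : ∀ x, {a | x ≤ a ∧ ¬(P a ↔ P (a + 1))}.Finite := by
    intro x
    refine (Set.finite_Ico x R).subset fun a ha => ⟨ha.1, ?_⟩
    by_contra h
    exact ha.2 (iff_of_false (hR _ (by omega)) (hR _ (by omega)))
  induction hn : (R - x).toNat generalizing x with
  | zero =>
    have : {a | x ≤ a ∧ ¬(P a ↔ P (a + 1))} = ∅ := by
      refine Set.eq_empty_of_forall_notMem fun a ha => ha.2 ?_
      have := ha.1
      exact iff_of_false (hR _ (by omega)) (hR _ (by omega))
    rw [this, Set.ncard_empty]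
    exact iff_of_false (by simp) (hR _ (by omega))
  | succ n ih =>
    have hx : (R - (x + 1)).toNat = n := by omega
    have hx1 : Odd (Set.ncard {a | x + 1 ≤ a ∧ ¬(P a ↔ P (a + 1))}) ↔ P (x + 1) := ih (x + 1) hx
    by_cases h : P x ↔ P (x + 1)
    · rw [h, ← hx1]
      have : {a | x ≤ a ∧ ¬(P a ↔ P (a + 1))} = {a | x + 1 ≤ a ∧ ¬(P a ↔ P (a + 1))} := by
        ext a
        refine and_congr_left fun ha => ⟨fun hxa => ?_, fun hxa => by omega⟩
        rcases hxa.lt_or_eq with h' | rfl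
        · omega
        · exact absurd h ha
      rw [this]
    · have : {a | x ≤ a ∧ ¬(P a ↔ P (a + 1))} =
          insert x {a | x + 1 ≤ a ∧ ¬(P a ↔ P (a + 1))} := by
        ext a
        rw [Set.mem_insert_iff]
        constructor
        · rintro ⟨h1, h2⟩
          rcases h1.lt_or_eq with h' | h'
          · exact Or.inr ⟨by omega, h2⟩
          · exact Or.inl h'.symm
        · rintro (rfl | ⟨h1, h2⟩)
          · exact ⟨le_rfl, h⟩
          · exact ⟨by omega, h2⟩
      rw [this, Set.ncard_insert_of_notMem (fun h' => by have := h'.1; omega) (hfin _),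
        Nat.odd_add_one, hx1]
      tauto

theorem vertical_mem_dualEdges {D : Finset Site} {a b : ℤ} :
    s((a, b - 1), (a, b)) ∈ (darts D).image dualEdge ↔ ¬((a, b) ∈ D ↔ (a + 1, b) ∈ D) := by
  rw [Finset.mem_image]
  constructor
  · rintro ⟨⟨p, q⟩, he, h⟩
    obtain ⟨hn, hp, hq⟩ := mem_darts.1 he
    obtain ⟨i, j, h1 | h1 | h1 | h1⟩ := Nbr.exists_head hn <;> cases h1 <;>
    simp only [dualEdge, head_north, head_west, head_south, head_east, tail_north, tail_west,
      tail_south, tail_east, Sym2.eq_iff, Prod.mk.injEq] at h <;> simp only at hp hq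
    · obtain ⟨rfl, rfl⟩ : i = a ∧ j = b := by omega
      tauto
    · omega
    · obtain ⟨rfl, rfl⟩ : i = a ∧ b = j + 1 := by omega
      tauto
    · omega
  · intro h
    by_cases h1 : (a, b) ∈ D
    · refine ⟨((a, b), (a + 1, b)), mem_darts.2 ⟨by simp [Nbr], h1, by tauto⟩, ?_⟩
      simp [dualEdge]
    · obtain ⟨c, rfl⟩ : ∃ c, b = c + 1 := ⟨b - 1, by ring⟩
      refine ⟨((a + 1, c + 1), (a, c + 1)), mem_darts.2 ⟨by simp [Nbr], by tauto, h1⟩, ?_⟩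
      simp [dualEdge, Sym2.eq_swap]

/-- The contour that surrounds an irreducible set. -/
def Irreducible.contour {D : Finset Site} (hD : Irreducible D) : Contour where
  edges := (darts D).image dualEdge
  exists_seq := hD
  sign := 1

/-- The vertical dual edges crossed by the ray are the places where membership in `D` changes along
the row; their parity is that of the starting point. -/
theorem Irreducible.contour_interior {D : Finset Site} (hD : Irreducible D) :
    hD.contour.interior = D := by
  ext x
  obtain ⟨R, hR⟩ := exists_bound D
  have hset : {e | e ∈ hD.contour.edges ∧ ∃ a : ℤ, x.1 ≤ a ∧ e = s((a, x.2 - 1), (a, x.2))} =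
      (fun a : ℤ => s((a, x.2 - 1), (a, x.2))) ''
        {a | x.1 ≤ a ∧ ¬((a, x.2) ∈ D ↔ (a + 1, x.2) ∈ D)} := by
    ext e
    constructor
    · rintro ⟨h1, a, h2, rfl⟩
      exact ⟨a, ⟨h2, vertical_mem_dualEdges.1 h1⟩, rfl⟩
    · rintro ⟨a, ⟨h1, h2⟩, rfl⟩
      exact ⟨vertical_mem_dualEdges.2 h2, a, h1, rfl⟩
  have hinj : Function.Injective fun a : ℤ => s((a, x.2 - 1), (a, x.2)) := by
    intro a b h
    simp only [Sym2.eq_iff, Prod.mk.injEq] at h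
    omega
  rw [Contour.interior, Set.mem_ofPred_eq, hset, Set.ncard_image_of_injective _ hinj]
  exact odd_ncard_changes (fun a => (a, x.2) ∈ D) R
    (fun a ha h => absurd (hR _ h).1 (by have := le_abs_self a; simp only; omega)) x.1

theorem Irreducible.contour_length {D : Finset Site} (hD : Irreducible D) :
    hD.contour.length = (darts D).card :=
  Finset.card_image_of_injOn (dualEdge_injOn D)

/-! Translations -/

theorem tail_add (e : Site × Site) (v : Site) : tail (e.1 + v, e.2 + v) = tail e + v := by
  simp only [tail, dir, Prod.fst_add, Prod.snd_add, min_add_add_right]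
  ext <;> simp only [add_sub_add_right_eq_sub, Prod.fst_add, Prod.snd_add] <;> ring

theorem head_add (e : Site × Site) (v : Site) : head (e.1 + v, e.2 + v) = head e + v := by
  simp only [head, dir, Prod.fst_add, Prod.snd_add, min_add_add_right]
  ext <;> simp only [add_sub_add_right_eq_sub, Prod.fst_add, Prod.snd_add] <;> ring

/-- Translation of a set of sites. -/
def translate (v : Site) (D : Finset Site) : Finset Site := D.map (Equiv.addRight v).toEmbedding

theorem mem_translate {v x : Site} {D : Finset Site} : x ∈ translate v D ↔ x - v ∈ D := by
  simp [translate, sub_eq_add_neg]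

theorem nbr_add_right {x y : Site} (v : Site) : Nbr (x + v) (y + v) ↔ Nbr x y := by
  simp [Nbr]

theorem darts_translate (v : Site) (D : Finset Site) :
    darts (translate v D) = (darts D).map
      ((Equiv.addRight v).prodCongr (Equiv.addRight v)).toEmbedding := by
  ext ⟨p, q⟩
  rw [Finset.mem_map_equiv, mem_darts, mem_darts]
  simp only [mem_translate, Equiv.prodCongr_symm, Equiv.prodCongr_apply, Prod.map_apply,
    Equiv.addRight_symm, Equiv.coe_addRight, ← sub_eq_add_neg]
  rw [← nbr_add_right (x := p - v) v, sub_add_cancel, sub_add_cancel]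

theorem card_darts_translate (v : Site) (D : Finset Site) :
    (darts (translate v D)).card = (darts D).card := by
  rw [darts_translate, Finset.card_map]

theorem mem_sym2_map_add {v x : Site} {e : Sym2 Site} :
    x ∈ Sym2.map (· + v) e ↔ x - v ∈ e := by
  rw [Sym2.mem_map]
  constructor
  · rintro ⟨a, ha, rfl⟩
    simpa using ha
  · exact fun h => ⟨_, h, by simp⟩

theorem Linked.add {x v : Site} {e f : Sym2 Site} (h : Linked (x - v) e f) :
    Linked x (Sym2.map (· + v) e) (Sym2.map (· + v) f) := by
  obtain ⟨w, z, h1, rfl, rfl, h2⟩ := h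
  refine ⟨w + v, z + v, by simpa using h1, by simp, by simp, ?_⟩
  simp only [Prod.fst_sub, Prod.snd_sub, Prod.fst_add, Prod.snd_add] at h2 ⊢
  ring_nf at h2 ⊢
  exact h2

theorem IsContourSeq.add {n : ℕ} {e : Fin n → Sym2 Site} (he : IsContourSeq e) (v : Site) :
    IsContourSeq fun i => Sym2.map (· + v) (e i) where
  three_le := he.three_le
  isDualEdge i := by
    obtain ⟨a, b, hab, h⟩ := he.isDualEdge i
    exact ⟨a + v, b + v, (nbr_add_right v).2 hab, by simp [h]⟩
  injective := (Sym2.map.injective (add_left_injective v)).comp he.injective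
  meet i := by
    obtain ⟨a, h1, h2⟩ := he.meet i
    exact ⟨a + v, by simpa [mem_sym2_map_add] using h1, by simpa [mem_sym2_map_add] using h2⟩
  linked i j x hij h1 h2 h3 h4 := by
    rw [mem_sym2_map_add] at h1 h2 h3 h4
    obtain ⟨h5, h6⟩ := he.linked i j _ hij h1 h2 h3 h4
    exact ⟨h5.add, h6.add⟩

theorem Irreducible.translate {D : Finset Site} (hD : Irreducible D) (v : Site) :
    Irreducible (translate v D) := by
  obtain ⟨n, e, he, hr⟩ := hD
  refine ⟨n, _, he.add v, ?_⟩
  have : Set.range (fun i => Sym2.map (· + v) (e i)) = Sym2.map (· + v) '' Set.range e :=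
    Set.range_comp _ _
  rw [this, hr, darts_translate]
  simp only [Finset.coe_image, Finset.coe_map, Set.image_image]
  refine Set.image_congr fun f _ => ?_
  have : ((Equiv.addRight v).prodCongr (Equiv.addRight v)).toEmbedding f = (f.1 + v, f.2 + v) := rfl
  rw [this, dualEdge, dualEdge, tail_add, head_add, Sym2.map_mk]

theorem translate_injective (v : Site) : Function.Injective (SOS.translate v) :=
  Finset.map_injective _

/-- Under the summability condition, the weights of the irreducible sets that contain a given site
are summable, uniformly in the site. -/
theorem ContourSummable.exists_bound {β : ℝ} (h : ContourSummable β) : ∃ K : ℝ,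
    ∀ (x : Site) (F : Finset (Finset Site)), (∀ D ∈ F, Irreducible D ∧ x ∈ D) →
      ∑ D ∈ F, Real.exp (-β * ((darts D).card : ℝ)) ≤ K := by
  classical
  refine ⟨∑' γ : {γ : Contour // ((0, 0) : Site) ∈ γ.interior},
    Real.exp (-β * (γ.1.length : ℝ)), fun x F hF => ?_⟩
  let toC : F → {γ : Contour // ((0, 0) : Site) ∈ γ.interior} := fun D =>
    ⟨((hF D D.2).1.translate (-x)).contour, by
      rw [Irreducible.contour_interior, Finset.mem_coe, mem_translate]
      have : ((0, 0) : Site) - -x = x := by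
        rw [sub_neg_eq_add]
        exact zero_add x
      rw [this]
      exact (hF D D.2).2⟩
  have hinj : Function.Injective toC := by
    intro D E hDE
    have h1 := congrArg (fun γ => γ.1.interior) hDE
    simp only [toC, Irreducible.contour_interior, Finset.coe_inj] at h1
    exact Subtype.ext (translate_injective _ h1)
  rw [← Finset.sum_coe_sort]
  have h2 := h.sum_le_tsum (Finset.univ.map ⟨toC, hinj⟩) fun _ _ => (Real.exp_pos _).le
  rw [Finset.sum_map] at h2
  refine le_trans (le_of_eq (Finset.sum_congr rfl fun D _ => ?_)) h2
  change _ = Real.exp (-β * (((hF D D.2).1.translate (-x)).contour.length : ℝ))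
  rw [Irreducible.contour_length, card_darts_translate]

/-! ### The gradient energy of a finitely supported height function -/

/-- The absolute gradient on ordered pairs of neighbours. -/
def grad (ψ : Site → ℤ) (e : Site × Site) : ℝ :=
  if Nbr e.1 e.2 then |(ψ e.1 : ℝ) - ψ e.2| else 0

/-- The energy of a height function on `ℤ²`. -/
def energy (ψ : Site → ℤ) : ℝ := 1 / 2 * ∑' e, grad ψ e

theorem grad_nonneg (ψ : Site → ℤ) (e : Site × Site) : 0 ≤ grad ψ e := by
  unfold grad
  split_ifs <;> positivity

theorem grad_swap (ψ : Site → ℤ) (e : Site × Site) : grad ψ e.swap = grad ψ e := by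
  simp only [grad, Prod.fst_swap, Prod.snd_swap, nbr_comm (x := e.2), abs_sub_comm (ψ e.2 : ℝ)]

theorem grad_eq_zero {ψ : Site → ℤ} {Λ : Finset Site} (hψ : ∀ p ∉ Λ, ψ p = 0) {e : Site × Site}
    (he : e ∉ (Λ ∪ extBoundary Λ) ×ˢ (Λ ∪ extBoundary Λ)) : grad ψ e = 0 := by
  by_contra hne
  have hn : Nbr e.1 e.2 := by
    by_contra h
    exact hne (if_neg h)
  refine he ?_
  simp only [Finset.mem_product, Finset.mem_union, mem_extBoundary]
  by_cases h1 : e.1 ∈ Λ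
  · refine ⟨Or.inl h1, ?_⟩
    by_cases h2 : e.2 ∈ Λ
    · exact Or.inl h2
    · exact Or.inr ⟨h2, _, h1, hn⟩
  · by_cases h2 : e.2 ∈ Λ
    · exact ⟨Or.inr ⟨h1, _, h2, hn.symm⟩, Or.inl h2⟩
    · exact absurd (by simp [grad, hψ _ h1, hψ _ h2]) hne

theorem tsum_grad {ψ : Site → ℤ} {Λ : Finset Site} (hψ : ∀ p ∉ Λ, ψ p = 0) :
    ∑' e, grad ψ e = ∑ e ∈ (Λ ∪ extBoundary Λ) ×ˢ (Λ ∪ extBoundary Λ), grad ψ e :=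
  tsum_eq_sum fun _ he => grad_eq_zero hψ he

theorem summable_grad {ψ : Site → ℤ} {Λ : Finset Site} (hψ : ∀ p ∉ Λ, ψ p = 0) :
    Summable (grad ψ) :=
  summable_of_ne_finset_zero fun _ he => grad_eq_zero hψ he

theorem energy_zero : energy (fun _ => 0) = 0 := by simp [energy, grad]

theorem energy_neg (ψ : Site → ℤ) : energy (fun p => -ψ p) = energy ψ := by
  simp only [energy, grad, Int.cast_neg, ← neg_sub', abs_neg]

theorem energy_comp_add (ψ : Site → ℤ) (v : Site) : energy (fun p => ψ (p + v)) = energy ψ := by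
  unfold energy
  congr 1
  rw [← Equiv.tsum_eq ((Equiv.addRight v).prodCongr (Equiv.addRight v)) (grad ψ)]
  refine tsum_congr fun e => ?_
  simp [grad, nbr_add_right]

theorem energy_le_add {ψ ψ₁ ψ₂ : Site → ℤ} {Λ : Finset Site} (h₁ : ∀ p ∉ Λ, ψ₁ p = 0)
    (h₂ : ∀ p ∉ Λ, ψ₂ p = 0) (h : ∀ p, ψ p = ψ₁ p + ψ₂ p) :
    energy ψ ≤ energy ψ₁ + energy ψ₂ := by
  have h0 : ∀ p ∉ Λ, ψ p = 0 := fun p hp => by rw [h, h₁ p hp, h₂ p hp, add_zero]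
  unfold energy
  rw [← mul_add, ← (summable_grad h₁).tsum_add (summable_grad h₂)]
  refine mul_le_mul_of_nonneg_left ?_ (by norm_num)
  refine (summable_grad h0).tsum_le_tsum (fun e => ?_) ((summable_grad h₁).add (summable_grad h₂))
  unfold grad
  split_ifs
  · rw [h, h]
    push_cast
    rw [add_sub_add_comm]
    exact abs_add_le _ _
  · simp

/-- For a superposition whose two gradients never have opposite signs, the triangle inequality is an
equality on each edge. -/
theorem energy_eq_add {ψ ψ₁ ψ₂ : Site → ℤ} {Λ : Finset Site} (h₁ : ∀ p ∉ Λ, ψ₁ p = 0)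
    (h₂ : ∀ p ∉ Λ, ψ₂ p = 0)
    (h : ∀ p q, Nbr p q → |ψ p - ψ q| = |ψ₁ p - ψ₁ q| + |ψ₂ p - ψ₂ q|) :
    energy ψ = energy ψ₁ + energy ψ₂ := by
  unfold energy
  rw [← mul_add, ← (summable_grad h₁).tsum_add (summable_grad h₂)]
  congr 1
  refine tsum_congr fun e => ?_
  unfold grad
  split_ifs with hn
  · exact_mod_cast h _ _ hn
  · simp

theorem sum_nbrs_const {c : ℝ} (x : Site) : ∑ _y ∈ nbrs x, c = 4 * c := by
  have : (nbrs x).card = 4 := by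
    unfold nbrs
    rw [Finset.card_insert_of_notMem, Finset.card_insert_of_notMem, Finset.card_insert_of_notMem,
      Finset.card_singleton] <;> simp <;> omega
  rw [Finset.sum_const, this, nsmul_eq_mul]
  norm_num

theorem sum_ite_nbr_le {S : Finset Site} {x : Site} {c : ℝ} (hc : 0 ≤ c) :
    ∑ y ∈ S, (if Nbr x y then c else 0) ≤ 4 * c := by
  rw [← Finset.sum_filter, ← sum_nbrs_const x]
  refine Finset.sum_le_sum_of_subset_of_nonneg (fun y hy => ?_) fun _ _ _ => hc
  exact mem_nbrs.2 (Finset.mem_filter.1 hy).2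

theorem energy_le {ψ : Site → ℤ} {Λ : Finset Site} (hψ : ∀ p ∉ Λ, ψ p = 0) :
    energy ψ ≤ 4 * ∑ p ∈ Λ, |(ψ p : ℝ)| := by
  classical
  set T := Λ ∪ extBoundary Λ
  have hT : ∑ p ∈ T, |(ψ p : ℝ)| = ∑ p ∈ Λ, |(ψ p : ℝ)| := by
    refine (Finset.sum_subset Finset.subset_union_left fun p _ hp => ?_).symm
    simp [hψ p hp]
  have h1 : ∀ e : Site × Site, grad ψ e ≤ (if Nbr e.1 e.2 then |(ψ e.1 : ℝ)| else 0) +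
      (if Nbr e.2 e.1 then |(ψ e.2 : ℝ)| else 0) := by
    intro e
    by_cases hn : Nbr e.1 e.2
    · rw [grad, if_pos hn, if_pos hn, if_pos hn.symm]
      exact abs_sub _ _
    · rw [grad, if_neg hn, if_neg hn, if_neg (mt Nbr.symm hn), add_zero]
  have h2 : ∑ x ∈ T, ∑ y ∈ T, (if Nbr x y then |(ψ x : ℝ)| else 0) ≤
      4 * ∑ p ∈ Λ, |(ψ p : ℝ)| := by
    rw [← hT, Finset.mul_sum]
    exact Finset.sum_le_sum fun x _ => sum_ite_nbr_le (abs_nonneg _)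
  have h3 : ∑' e, grad ψ e ≤ 2 * (4 * ∑ p ∈ Λ, |(ψ p : ℝ)|) := by
    rw [tsum_grad hψ]
    refine (Finset.sum_le_sum fun e _ => h1 e).trans ?_
    rw [Finset.sum_add_distrib, Finset.sum_product, Finset.sum_product, two_mul]
    refine add_le_add h2 ?_
    rw [Finset.sum_comm]
    exact h2
  unfold energy
  linarith

/-- Keeps only the horizontal edges that start in `Λ`. These gradients already determine a height
function that vanishes off `Λ`, which makes the partition functions finite. -/
theorem sum_le_energy {ψ : Site → ℤ} {Λ : Finset Site} (hψ : ∀ p ∉ Λ, ψ p = 0) :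
    ∑ p ∈ Λ, |(ψ p : ℝ) - ψ (p + (1, 0))| ≤ energy ψ := by
  classical
  let f : Site → Site × Site := fun p => (p, p + (1, 0))
  let g : Site → Site × Site := fun p => (p + (1, 0), p)
  have hf : Set.InjOn f Λ := fun p _ q _ h => congrArg Prod.fst h
  have hg : Set.InjOn g Λ := fun p _ q _ h => congrArg Prod.snd h
  have hdisj : Disjoint (Λ.image f) (Λ.image g) := by
    rw [Finset.disjoint_left]
    intro e h1 h2
    obtain ⟨p, _, rfl⟩ := Finset.mem_image.1 h1
    obtain ⟨q, _, h⟩ := Finset.mem_image.1 h2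
    have h3 := congrArg (fun e : Site × Site => e.1.1) h
    have h4 := congrArg (fun e : Site × Site => e.2.1) h
    simp [f, g] at h3 h4
    omega
  have h := (summable_grad hψ).sum_le_tsum (Λ.image f ∪ Λ.image g) fun e _ => grad_nonneg ψ e
  rw [Finset.sum_union hdisj, Finset.sum_image hf, Finset.sum_image hg] at h
  have h1 : ∀ p, grad ψ (f p) = |(ψ p : ℝ) - ψ (p + (1, 0))| := fun p => by
    simp [f, grad, Nbr]
  have h2 : ∀ p, grad ψ (g p) = |(ψ p : ℝ) - ψ (p + (1, 0))| := fun p => by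
    rw [← h1, ← grad_swap]
    rfl
  simp only [h1, h2] at h
  unfold energy
  linarith

theorem energy_indicator (D : Finset Site) [DecidablePred (· ∈ D)] :
    energy (fun p => if p ∈ D then 1 else 0) = (darts D).card := by
  classical
  set ψ : Site → ℤ := fun p => if p ∈ D then 1 else 0
  have hdisj : Disjoint (darts D) ((darts D).map (Equiv.prodComm Site Site).toEmbedding) := by
    rw [Finset.disjoint_left]
    intro e h1 h2
    rw [Finset.mem_map_equiv] at h2
    exact (mem_darts.1 h2).2.2 (mem_darts.1 h1).2.1
  have h : ∀ e ∉ darts D ∪ (darts D).map (Equiv.prodComm Site Site).toEmbedding,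
      grad ψ e = 0 := by
    intro e he
    rw [Finset.mem_union, Finset.mem_map_equiv, mem_darts, mem_darts] at he
    simp only [Equiv.prodComm_symm, Equiv.prodComm_apply, Prod.fst_swap, Prod.snd_swap] at he
    rw [nbr_comm (x := e.2)] at he
    by_cases h1 : e.1 ∈ D <;> by_cases h2 : e.2 ∈ D <;> simp_all [grad, ψ]
  have h1 : ∀ e ∈ darts D, grad ψ e = 1 := by
    intro e he
    obtain ⟨hn, hp, hq⟩ := mem_darts.1 he
    simp [grad, ψ, hn, hp, hq]
  unfold energy
  rw [tsum_eq_sum h, Finset.sum_union hdisj, Finset.sum_map, Finset.sum_congr rfl h1]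
  have h2 : ∑ e ∈ darts D, grad ψ ((Equiv.prodComm Site Site).toEmbedding e) =
      ∑ e ∈ darts D, (1 : ℝ) :=
    Finset.sum_congr rfl fun e he => (grad_swap ψ e).trans (h1 e he)
  rw [h2]
  simp
  ring

/-! Height functions on a finite set -/

/-- The extension by zero. -/
def extend (Λ : Finset Site) (φ : Λ → ℤ) (p : Site) : ℤ := if h : p ∈ Λ then φ ⟨p, h⟩ else 0

theorem extend_coe {Λ : Finset Site} (φ : Λ → ℤ) (x : Λ) : extend Λ φ x = φ x := by
  simp [extend]

theorem extend_of_notMem {Λ : Finset Site} (φ : Λ → ℤ) : ∀ p ∉ Λ, extend Λ φ p = 0 :=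
  fun _ hp => dif_neg hp

theorem extend_restrict {Λ : Finset Site} {ψ : Site → ℤ} (hψ : ∀ p ∉ Λ, ψ p = 0) :
    extend Λ (fun x => ψ x) = ψ := by
  funext p
  by_cases hp : p ∈ Λ
  · simp [extend, hp]
  · simp [extend, hp, hψ p hp]

theorem hamiltonian_eq_energy (Λ : Finset Site) (φ : Λ → ℤ) :
    hamiltonian Λ 0 φ = energy (extend Λ φ) := by
  classical
  set ψ := extend Λ φ with hψdef
  have hψ : ∀ p ∉ Λ, ψ p = 0 := extend_of_notMem φ
  have hdisj : Disjoint Λ (extBoundary Λ) := by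
    rw [Finset.disjoint_left]
    exact fun p h1 h2 => (mem_extBoundary.1 h2).1 h1
  have h1 : (∑ x : Λ, ∑ y : Λ, if Nbr x y then |(φ x : ℝ) - φ y| else 0) =
      ∑ x ∈ Λ, ∑ y ∈ Λ, grad ψ (x, y) := by
    rw [← Finset.sum_coe_sort Λ]
    refine Finset.sum_congr rfl fun x _ => ?_
    rw [← Finset.sum_coe_sort Λ]
    refine Finset.sum_congr rfl fun y _ => ?_
    simp only [grad, hψdef, extend_coe]
  have h2 : (∑ x : Λ, ∑ y ∈ extBoundary Λ, if Nbr x y then |(φ x : ℝ) - (0 : ℤ)| else 0) =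
      ∑ x ∈ Λ, ∑ y ∈ extBoundary Λ, grad ψ (x, y) := by
    rw [← Finset.sum_coe_sort Λ]
    refine Finset.sum_congr rfl fun x _ => Finset.sum_congr rfl fun y hy => ?_
    simp only [grad, hψ y (mem_extBoundary.1 hy).1]
    simp only [hψdef, extend_coe]
  have h3 : ∑ x ∈ extBoundary Λ, ∑ y ∈ Λ, grad ψ (x, y) =
      ∑ x ∈ Λ, ∑ y ∈ extBoundary Λ, grad ψ (x, y) := by
    rw [Finset.sum_comm]
    exact Finset.sum_congr rfl fun x _ => Finset.sum_congr rfl fun y _ => grad_swap ψ (x, y)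
  have h4 : ∑ x ∈ extBoundary Λ, ∑ y ∈ extBoundary Λ, grad ψ (x, y) = 0 := by
    refine Finset.sum_eq_zero fun x hx => Finset.sum_eq_zero fun y hy => ?_
    simp [grad, hψ x (mem_extBoundary.1 hx).1, hψ y (mem_extBoundary.1 hy).1]
  rw [hamiltonian, h1, h2, energy, tsum_grad hψ, Finset.sum_product, Finset.sum_union hdisj]
  simp only [Finset.sum_union hdisj, Finset.sum_add_distrib]
  rw [h3, h4]
  ring

/-! Energy of truncations -/

/-- Capping a height function at level `n` and recording the excess as independent spikes
overcounts the energy exactly by the common excess of neighbours. -/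
theorem energy_min_add {ψ : Site → ℤ} {Λ : Finset Site} (hψ : ∀ p ∉ Λ, ψ p = 0) {n : ℤ}
    (hn : 0 ≤ n) :
    energy (fun p => min (ψ p) n) + 4 * ∑ p ∈ Λ, ((max (ψ p - n) 0 : ℤ) : ℝ) =
      energy ψ + ∑ x ∈ Λ, ∑ y ∈ Λ,
        if Nbr x y then ((min (max (ψ x - n) 0) (max (ψ y - n) 0) : ℤ) : ℝ) else 0 := by
  classical
  set T := Λ ∪ extBoundary Λ with hT
  let a : Site → ℝ := fun p => ((max (ψ p - n) 0 : ℤ) : ℝ)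
  have ha : ∀ p ∉ Λ, a p = 0 := fun p hp => by simp [a, hψ p hp, hn]
  have hmin : ∀ p ∉ Λ, min (ψ p) n = 0 := fun p hp => by simp [hψ p hp, hn]
  have hsum : ∑ p ∈ Λ, 4 * a p = ∑ x ∈ Λ, ∑ y ∈ T, if Nbr x y then a x else 0 := by
    refine Finset.sum_congr rfl fun x hx => ?_
    rw [← Finset.sum_filter, ← sum_nbrs_const x]
    refine Finset.sum_congr ?_ fun _ _ => rfl
    ext y
    rw [mem_nbrs, Finset.mem_filter, hT, Finset.mem_union, mem_extBoundary]
    constructor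
    · refine fun h => ⟨?_, h⟩
      by_cases hy : y ∈ Λ
      · exact Or.inl hy
      · exact Or.inr ⟨hy, x, hx, h⟩
    · exact fun h => h.2
  have hsum' : ∑ x ∈ T, ∑ y ∈ T, (if Nbr x y then a x else 0) = 4 * ∑ p ∈ Λ, a p := by
    rw [Finset.mul_sum, hsum]
    refine (Finset.sum_subset Finset.subset_union_left fun x _ hx => ?_).symm
    simp [ha x hx]
  have hsum'' : ∑ x ∈ T, ∑ y ∈ T, (if Nbr x y then a y else 0) = 4 * ∑ p ∈ Λ, a p := by
    rw [← hsum', Finset.sum_comm]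
    simp only [nbr_comm]
  have hY : ∑ x ∈ T, ∑ y ∈ T, (if Nbr x y then min (a x) (a y) else 0) =
      ∑ x ∈ Λ, ∑ y ∈ Λ, if Nbr x y then min (a x) (a y) else 0 := by
    have ha0 : ∀ p, 0 ≤ a p := fun p => by simp [a]
    symm
    refine (Finset.sum_congr rfl fun x _ => ?_).trans
      (Finset.sum_subset Finset.subset_union_left fun x _ hx => ?_)
    · refine Finset.sum_subset Finset.subset_union_left fun y _ hy => ?_
      simp [ha y hy, ha0]
    · simp [ha x hx, ha0]
  have hcast : ∀ x y, ((min (max (ψ x - n) 0) (max (ψ y - n) 0) : ℤ) : ℝ) = min (a x) (a y) :=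
    fun x y => by simp only [a, Int.cast_min]
  simp only [hcast]
  rw [← hY]
  change energy _ + 4 * ∑ p ∈ Λ, a p = _
  have hpt : ∀ x y, 1 / 2 * grad (fun p => min (ψ p) n) (x, y) +
      (1 / 2 * (if Nbr x y then a x else 0) + 1 / 2 * (if Nbr x y then a y else 0)) =
      1 / 2 * grad ψ (x, y) + (if Nbr x y then min (a x) (a y) else 0) := by
    intro x y
    unfold grad
    split_ifs
    -- Both min(s, n) and (s - n)⁺ are nondecreasing in s and they sum to s, so |s - t| splits into
    -- their variations a priori; for a, b ≥ 0 moreover a + b = |a - b| + 2 min(a, b).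
    · have : ∀ s t : ℤ, |min s n - min t n| + (max (s - n) 0 + max (t - n) 0) =
          |s - t| + 2 * min (max (s - n) 0) (max (t - n) 0) := by
        intro s t
        rcases le_total s n with h1 | h1 <;> rcases le_total t n with h2 | h2
        · simp [h1, h2]
        · rw [min_eq_left h1, min_eq_right h2, max_eq_right (by omega : s - n ≤ 0),
            max_eq_left (by omega : 0 ≤ t - n), min_eq_left (by omega), abs_of_nonpos (by omega),
            abs_of_nonpos (by omega)]
          ring
        · rw [min_eq_right h1, min_eq_left h2, max_eq_left (by omega : 0 ≤ s - n),
            max_eq_right (by omega : t - n ≤ 0), min_eq_right (by omega),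
            abs_of_nonneg (by omega), abs_of_nonneg (by omega)]
          ring
        · rw [min_eq_right h1, min_eq_right h2, max_eq_left (by omega : 0 ≤ s - n),
            max_eq_left (by omega : 0 ≤ t - n)]
          rcases le_total s t with h3 | h3
          · rw [min_eq_left (by omega), abs_of_nonpos (by omega : s - t ≤ 0)]
            simp
            ring
          · rw [min_eq_right (by omega), abs_of_nonneg (by omega : 0 ≤ s - t)]
            simp
            ring
      have h := this (ψ x) (ψ y)
      have h' : |((min (ψ x) n : ℤ) : ℝ) - ((min (ψ y) n : ℤ) : ℝ)| + (a x + a y) =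
          |(ψ x : ℝ) - ψ y| + 2 * min (a x) (a y) := by
        rw [← hcast]
        simp only [a]
        exact_mod_cast h
      linarith
    · simp
  have h := Finset.sum_congr (rfl : T = T) fun x _ =>
    Finset.sum_congr (rfl : T = T) fun y _ => hpt x y
  simp only [Finset.sum_add_distrib, ← Finset.mul_sum] at h
  rw [hsum', hsum''] at h
  unfold energy
  rw [tsum_grad hψ, tsum_grad hmin, Finset.sum_product, Finset.sum_product]
  linarith

/-! Boxes -/

theorem mem_box {N : ℕ} {p : Site} :
    p ∈ box N ↔ (1 ≤ p.1 ∧ p.1 ≤ N) ∧ 1 ≤ p.2 ∧ p.2 ≤ N := by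
  simp [box]

theorem card_box (N : ℕ) : (box N).card = N ^ 2 := by
  simp [box, sq]

theorem card_darts_box_le (N : ℕ) : (darts (box N)).card ≤ 4 * N := by
  classical
  let I := Finset.Icc 1 (N : ℤ)
  have hI : I.card = N := by simp [I]
  have hsub : darts (box N) ⊆
      ((I.image fun k => (((N : ℤ), k), ((N : ℤ) + 1, k))) ∪
        I.image fun k => ((1, k), (0, k))) ∪
      ((I.image fun k => ((k, (N : ℤ)), (k, (N : ℤ) + 1))) ∪
        I.image fun k => ((k, 1), (k, 0))) := by
    rintro ⟨⟨a, b⟩, q⟩ he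
    obtain ⟨hn, hp, hq⟩ := mem_darts.1 he
    rw [mem_box] at hp hq
    simp only [Finset.mem_union, Finset.mem_image, I, Finset.mem_Icc]
    rcases nbr_iff.1 hn with h | h | h | h <;> simp only at h <;> subst h <;> simp only at hp hq
    · exact Or.inl (Or.inl ⟨b, hp.2, by simp; omega⟩)
    · exact Or.inl (Or.inr ⟨b, hp.2, by simp; omega⟩)
    · exact Or.inr (Or.inl ⟨a, hp.1, by simp; omega⟩)
    · exact Or.inr (Or.inr ⟨a, hp.1, by simp; omega⟩)
  refine (Finset.card_le_card hsub).trans ?_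
  have h := fun f : ℤ → Site × Site => (Finset.card_image_le (s := I) (f := f)).trans_eq hI
  refine (Finset.card_union_le _ _).trans ?_
  refine (add_le_add ((Finset.card_union_le _ _).trans (add_le_add (h _) (h _)))
    ((Finset.card_union_le _ _).trans (add_le_add (h _) (h _)))).trans ?_
  omega

/-- From a site of `D` outside the box, walk away from the box: the last site of `D` on the way
gives a dart of `D` that cannot be one of `A`. -/
theorem subset_box_of_darts_subset {D A : Finset Site} {N : ℕ} (hA : A ⊆ box N)
    (h : darts D ⊆ darts A) : D ⊆ box N := by
  intro p hp
  by_contra hpb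
  have key : ∀ d : Site, Nbr 0 d → (∀ k : ℕ, p + k • d ∉ box N) → False := by
    intro d hd hk
    obtain ⟨k, h1, h2⟩ := exists_last hp hd.ne.symm
    have : (p + k • d, p + (k + 1) • d) ∈ darts D := by
      refine mem_darts.2 ⟨?_, h1, h2⟩
      simp only [Nbr, succ_nsmul] at hd ⊢
      simpa using hd
    exact hk k (hA (mem_darts.1 (h this)).2.1)
  rw [mem_box] at hpb
  have : p.1 < 1 ∨ (N : ℤ) < p.1 ∨ p.2 < 1 ∨ (N : ℤ) < p.2 := by omega
  rcases this with h' | h' | h' | h'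
  · refine key (-1, 0) (by simp [Nbr]) fun k hk => ?_
    have := (mem_box.1 hk).1.1
    simp at this
    omega
  · refine key (1, 0) (by simp [Nbr]) fun k hk => ?_
    have := (mem_box.1 hk).1.2
    simp at this
    omega
  · refine key (0, -1) (by simp [Nbr]) fun k hk => ?_
    have := (mem_box.1 hk).2.1
    simp at this
    omega
  · refine key (0, 1) (by simp [Nbr]) fun k hk => ?_
    have := (mem_box.1 hk).2.2
    simp at this
    omega

/-! ### Partition functions with a single-site weight -/

/-- Distributivity of a finite product over infinite sums, by induction on the index type; values in
`ℝ≥0∞` spare all summability conditions. -/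
theorem tsum_pi_prod {κ : Type*} (ι : Type*) [Fintype ι] (f : ι → κ → ℝ≥0∞) :
    ∑' m : ι → κ, ∏ i, f i (m i) = ∏ i, ∑' k, f i k := by
  classical
  refine Fintype.induction_empty_option (P := fun ι _ => ∀ f : ι → κ → ℝ≥0∞,
    ∑' m : ι → κ, ∏ i, f i (m i) = ∏ i, ∑' k, f i k) ?_ ?_ ?_ ι f
  · intro α β _ e ih f
    let _ := Fintype.ofEquiv β e.symm
    have h := ih fun i => f (e i)
    rw [← Equiv.prod_comp e fun i => ∑' k, f i k, ← h,
      ← (Equiv.arrowCongr e (Equiv.refl κ)).tsum_eq]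
    refine tsum_congr fun m => ?_
    rw [← Equiv.prod_comp e]
    simp
  · intro f
    simp
  · intro α _ ih f
    rw [← (Equiv.piOptionEquivProd (β := fun _ : Option α => κ)).symm.tsum_eq,
      ENNReal.tsum_prod', Fintype.prod_option, ← ih fun i => f (some i), ← ENNReal.tsum_mul_right]
    refine tsum_congr fun k => ?_
    rw [← ENNReal.tsum_mul_left]
    refine tsum_congr fun m => ?_
    rw [Fintype.prod_option]
    rfl

/-- The Boltzmann weight of a height function on `ℤ²`. -/
def gibbs (β : ℝ) (ψ : Site → ℤ) : ℝ≥0∞ := ENNReal.ofReal (Real.exp (-β * energy ψ))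

/-- The partition function on `Λ` with zero boundary condition and single-site weight `g`. -/
def genPartition (β : ℝ) (g : ℤ → ℝ≥0∞) (Λ : Finset Site) : ℝ≥0∞ :=
  ∑' φ : Λ → ℤ, gibbs β (extend Λ φ) * ∏ x, g (φ x)

theorem gibbs_mul (β : ℝ) (ψ₁ ψ₂ : Site → ℤ) :
    gibbs β ψ₁ * gibbs β ψ₂ = ENNReal.ofReal (Real.exp (-β * (energy ψ₁ + energy ψ₂))) := by
  rw [gibbs, gibbs, ← ENNReal.ofReal_mul (Real.exp_pos _).le, ← Real.exp_add, mul_add]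

theorem gibbs_zero (β : ℝ) : gibbs β (fun _ => 0) = 1 := by simp [gibbs, energy_zero]

theorem prod_coe_extend (g : ℤ → ℝ≥0∞) {Λ : Finset Site} (φ : Λ → ℤ) :
    ∏ x, g (φ x) = ∏ p ∈ Λ, g (extend Λ φ p) := by
  rw [← Finset.prod_coe_sort Λ]
  exact Finset.prod_congr rfl fun x _ => by rw [extend_coe]

theorem summable_exp_abs {β : ℝ} (hβ : 0 < β) :
    Summable fun k : ℤ => Real.exp (-β * |(k : ℝ)|) := by
  have h : Summable fun n : ℕ => Real.exp (-β * n) := by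
    have := summable_geometric_of_lt_one (Real.exp_pos (-β)).le
      (Real.exp_lt_one_iff.2 (by linarith : -β < 0))
    refine this.congr fun n => ?_
    rw [← Real.exp_nat_mul, mul_comm]
  refine Summable.of_nat_of_neg ?_ ?_ <;> simpa using h

theorem tsum_exp_abs_ne_top {β : ℝ} (hβ : 0 < β) :
    ∑' k : ℤ, ENNReal.ofReal (Real.exp (-β * |(k : ℝ)|)) ≠ ∞ := by
  rw [← ENNReal.ofReal_tsum_of_nonneg (fun _ => (Real.exp_pos _).le) (summable_exp_abs hβ)]
  exact ENNReal.ofReal_ne_top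

/-- Heights are recovered row by row from the right, where they vanish. -/
theorem horizontal_diff_injective (Λ : Finset Site) :
    Function.Injective fun (φ : Λ → ℤ) (x : Λ) =>
      extend Λ φ x - extend Λ φ ((x : Site) + (1, 0)) := by
  intro φ φ' h
  obtain ⟨L, hL⟩ := exists_bound Λ
  have key : ∀ n : ℕ, ∀ p : Site, (L - p.1).toNat = n → extend Λ φ p = extend Λ φ' p := by
    intro n
    induction n with
    | zero =>
      intro p hn
      have hp : p ∉ Λ := by
        intro hp
        have := (hL p hp).1
        have := le_abs_self p.1
        omega
      rw [extend_of_notMem _ _ hp, extend_of_notMem _ _ hp]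
    | succ n ih =>
      intro p hn
      by_cases hp : p ∈ Λ
      · have h1 := congrFun h ⟨p, hp⟩
        have h2 := ih (p + (1, 0)) (by simp; omega)
        simp only at h1
        omega
      · rw [extend_of_notMem _ _ hp, extend_of_notMem _ _ hp]
  funext x
  have := key _ x rfl
  rwa [extend_coe, extend_coe] at this

/-- The energy dominates the sum of the absolute horizontal differences, and these may be summed as
if they were independent. -/
theorem genPartition_le {β : ℝ} (hβ : 0 < β) {g : ℤ → ℝ≥0∞} {K : ℝ≥0∞} (hg : ∀ k, g k ≤ K)
    (Λ : Finset Site) : genPartition β g Λ ≤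
      (K * ∑' k : ℤ, ENNReal.ofReal (Real.exp (-β * |(k : ℝ)|))) ^ Λ.card := by
  have h1 : ∀ φ : Λ → ℤ, gibbs β (extend Λ φ) * ∏ x, g (φ x) ≤ ∏ x : Λ, (K *
      ENNReal.ofReal (Real.exp (-β *
        |((extend Λ φ x - extend Λ φ ((x : Site) + (1, 0)) : ℤ) : ℝ)|))) := by
    intro φ
    rw [Finset.prod_mul_distrib, mul_comm]
    refine mul_le_mul' (Finset.prod_le_prod' fun x _ => hg _) ?_
    rw [← ENNReal.ofReal_prod_of_nonneg fun _ _ => (Real.exp_pos _).le, ← Real.exp_sum]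
    refine ENNReal.ofReal_le_ofReal (Real.exp_le_exp.2 ?_)
    rw [← Finset.mul_sum]
    have h := sum_le_energy (extend_of_notMem φ)
    rw [← Finset.sum_coe_sort] at h
    push_cast
    nlinarith
  refine (ENNReal.tsum_le_tsum h1).trans ?_
  refine (ENNReal.tsum_comp_le_tsum_of_injective (horizontal_diff_injective Λ) fun m : Λ → ℤ =>
    ∏ x : Λ, (K * ENNReal.ofReal (Real.exp (-β * |(m x : ℝ)|)))).trans ?_
  rw [tsum_pi_prod Λ fun _ (k : ℤ) => K * ENNReal.ofReal (Real.exp (-β * |(k : ℝ)|)),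
    Finset.prod_const, ENNReal.tsum_mul_left]
  simp

theorem genPartition_ne_top {β : ℝ} (hβ : 0 < β) {g : ℤ → ℝ≥0∞} {K : ℝ≥0∞} (hK : K ≠ ∞)
    (hg : ∀ k, g k ≤ K) (Λ : Finset Site) : genPartition β g Λ ≠ ∞ :=
  ne_top_of_le_ne_top (ENNReal.pow_ne_top (ENNReal.mul_ne_top hK (tsum_exp_abs_ne_top hβ)))
    (genPartition_le hβ hg Λ)

/-- The contribution of the flat interface. -/
theorem pow_le_genPartition (β : ℝ) (g : ℤ → ℝ≥0∞) (Λ : Finset Site) :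
    g 0 ^ Λ.card ≤ genPartition β g Λ := by
  refine le_trans ?_ (ENNReal.le_tsum (fun _ => 0))
  have : extend Λ (fun _ => 0) = fun _ => 0 := by
    funext p
    simp [extend]
  rw [this, gibbs_zero]
  simp

/-- Glue two configurations extended by zero: by the triangle inequality the energy of the sum is at
most the sum of the energies. -/
theorem genPartition_mul_le {β : ℝ} (hβ : 0 < β) (g : ℤ → ℝ≥0∞) {Λ₁ Λ₂ : Finset Site}
    (h : Disjoint Λ₁ Λ₂) :
    genPartition β g Λ₁ * genPartition β g Λ₂ ≤ genPartition β g (Λ₁ ∪ Λ₂) := by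
  unfold genPartition
  rw [← ENNReal.tsum_mul_right]
  simp_rw [← ENNReal.tsum_mul_left]
  rw [← ENNReal.tsum_prod (f := fun (φ₁ : Λ₁ → ℤ) (φ₂ : Λ₂ → ℤ) =>
    gibbs β (extend Λ₁ φ₁) * (∏ x, g (φ₁ x)) * (gibbs β (extend Λ₂ φ₂) * ∏ x, g (φ₂ x)))]
  let F : (Λ₁ → ℤ) × (Λ₂ → ℤ) → (↥(Λ₁ ∪ Λ₂) → ℤ) := fun φ x =>
    extend Λ₁ φ.1 x + extend Λ₂ φ.2 x
  have h12 : ∀ p ∈ Λ₁, p ∉ Λ₂ := fun p h1 h2 => Finset.disjoint_left.1 h h1 h2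
  have hext : ∀ φ, extend (Λ₁ ∪ Λ₂) (F φ) = fun p => extend Λ₁ φ.1 p + extend Λ₂ φ.2 p := by
    intro φ
    refine extend_restrict (ψ := fun p => extend Λ₁ φ.1 p + extend Λ₂ φ.2 p) fun p hp => ?_
    rw [Finset.mem_union] at hp
    push Not at hp
    simp only [extend_of_notMem _ _ hp.1, extend_of_notMem _ _ hp.2, add_zero]
  have hinj : Function.Injective F := by
    intro φ φ' hF
    have hF' : ∀ p, extend Λ₁ φ.1 p + extend Λ₂ φ.2 p =
        extend Λ₁ φ'.1 p + extend Λ₂ φ'.2 p := by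
      intro p
      have := congrArg (fun χ => extend (Λ₁ ∪ Λ₂) χ p) hF
      simpa [hext] using this
    refine Prod.ext (funext fun x => ?_) (funext fun x => ?_)
    · have := hF' x
      rwa [extend_of_notMem _ _ (h12 x x.2), extend_of_notMem _ _ (h12 x x.2), add_zero, add_zero,
        extend_coe, extend_coe] at this
    · have := hF' x
      have hx : (x : Site) ∉ Λ₁ := fun hx => h12 x hx x.2
      rwa [extend_of_notMem _ _ hx, extend_of_notMem _ _ hx, zero_add, zero_add,
        extend_coe, extend_coe] at this
  refine le_trans (ENNReal.tsum_le_tsum fun φ => ?_)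
    (ENNReal.tsum_comp_le_tsum_of_injective hinj _)
  rw [mul_mul_mul_comm]
  refine mul_le_mul' ?_ ?_
  · rw [gibbs_mul]
    refine ENNReal.ofReal_le_ofReal (Real.exp_le_exp.2 ?_)
    have := energy_le_add (ψ := extend (Λ₁ ∪ Λ₂) (F φ)) (Λ := Λ₁ ∪ Λ₂)
      (fun p hp => extend_of_notMem φ.1 p fun h' => hp (Finset.mem_union_left _ h'))
      (fun p hp => extend_of_notMem φ.2 p fun h' => hp (Finset.mem_union_right _ h'))
      (fun p => congrFun (hext φ) p)
    nlinarith
  · rw [prod_coe_extend, prod_coe_extend, prod_coe_extend, Finset.prod_union h, hext]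
    refine le_of_eq (congrArg₂ _ (Finset.prod_congr rfl fun p hp => ?_)
      (Finset.prod_congr rfl fun p hp => ?_))
    · simp only [extend_of_notMem φ.2 p (h12 p hp), add_zero]
    · simp only [extend_of_notMem φ.1 p fun hp' => h12 p hp' hp, zero_add]

theorem genPartition_le_translate (β : ℝ) (g : ℤ → ℝ≥0∞) (Λ : Finset Site) (v : Site) :
    genPartition β g Λ ≤ genPartition β g (translate v Λ) := by
  let F : (Λ → ℤ) → (↥(translate v Λ) → ℤ) := fun φ x => extend Λ φ (x - v)
  have hext : ∀ φ, extend (translate v Λ) (F φ) = fun p => extend Λ φ (p - v) := by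
    intro φ
    refine extend_restrict (ψ := fun p => extend Λ φ (p - v)) fun p hp => ?_
    exact extend_of_notMem _ _ fun h => hp (mem_translate.2 h)
  have hinj : Function.Injective F := by
    intro φ φ' h
    funext x
    have := congrArg (fun χ => extend (translate v Λ) χ (x + v)) h
    simp only [hext, add_sub_cancel_right, extend_coe] at this
    exact this
  refine le_trans (ENNReal.tsum_le_tsum fun φ => ?_)
    (ENNReal.tsum_comp_le_tsum_of_injective hinj _)
  rw [prod_coe_extend, prod_coe_extend, hext]
  refine le_of_eq (congrArg₂ _ ?_ ?_)
  · unfold gibbs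
    have := energy_comp_add (extend Λ φ) (-v)
    simp only [← sub_eq_add_neg] at this
    rw [this]
  · rw [translate, Finset.prod_map]
    refine Finset.prod_congr rfl fun p _ => ?_
    simp

theorem prod_genPartition_le {β : ℝ} (hβ : 0 < β) (g : ℤ → ℝ≥0∞) {ι : Type*} (s : Finset ι)
    (Λ : ι → Finset Site) (h : (s : Set ι).PairwiseDisjoint Λ) :
    ∏ i ∈ s, genPartition β g (Λ i) ≤ genPartition β g (s.biUnion Λ) := by
  classical
  induction s using Finset.induction_on with
  | empty =>
    have := pow_le_genPartition β g ∅
    simpa using this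
  | insert a s ha ih =>
    rw [Finset.prod_insert ha, Finset.biUnion_insert]
    rw [Finset.coe_insert] at h
    refine le_trans (mul_le_mul' le_rfl (ih (h.subset (Set.subset_insert _ _))))
      (genPartition_mul_le hβ g ?_)
    rw [Finset.disjoint_biUnion_right]
    intro i hi
    exact h (Set.mem_insert _ _) (Set.mem_insert_of_mem _ hi) (by rintro rfl; exact ha hi)

/-- Tile with k² translates of the small box and leave the uncovered sites at height 0. -/
theorem genPartition_box_le {β : ℝ} (hβ : 0 < β) (g : ℤ → ℝ≥0∞) {k m N : ℕ} (h : k * m ≤ N) :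
    genPartition β g (box m) ^ (k ^ 2) * g 0 ^ (N ^ 2 - (k * m) ^ 2) ≤
      genPartition β g (box N) := by
  classical
  let s := Finset.range k ×ˢ Finset.range k
  let T : ℕ × ℕ → Finset Site := fun i => translate ((i.1 * m : ℕ), (i.2 * m : ℕ)) (box m)
  have hT : ∀ i p, p ∈ T i ↔ ((i.1 * m : ℕ) < p.1 ∧ p.1 ≤ ((i.1 + 1) * m : ℕ)) ∧
      ((i.2 * m : ℕ) < p.2 ∧ p.2 ≤ ((i.2 + 1) * m : ℕ)) := by
    intro i p
    simp only [T, mem_translate, mem_box, Prod.fst_sub, Prod.snd_sub]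
    rw [add_mul, add_mul, one_mul]
    push_cast
    omega
  have key : ∀ (a b : ℕ) (x : ℤ), (a * m : ℕ) < x → x ≤ ((b + 1) * m : ℕ) → a ≤ b := by
    intro a b x h1 h2
    by_contra hlt
    have : (b + 1) * m ≤ a * m := Nat.mul_le_mul_right m (by omega)
    omega
  have hdisj : (s : Set (ℕ × ℕ)).PairwiseDisjoint T := by
    intro i _ j _ hij
    rw [Function.onFun, Finset.disjoint_left]
    intro p h1 h2
    rw [hT] at h1 h2
    refine hij (Prod.ext ?_ ?_)
    · exact le_antisymm (key _ _ _ h1.1.1 h2.1.2) (key _ _ _ h2.1.1 h1.1.2)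
    · exact le_antisymm (key _ _ _ h1.2.1 h2.2.2) (key _ _ _ h2.2.1 h1.2.2)
  have hsub : s.biUnion T ⊆ box N := by
    intro p hp
    obtain ⟨i, hi, hp⟩ := Finset.mem_biUnion.1 hp
    rw [hT] at hp
    rw [Finset.mem_product, Finset.mem_range, Finset.mem_range] at hi
    have h1 : (i.1 + 1) * m ≤ k * m := Nat.mul_le_mul_right m hi.1
    have h2 : (i.2 + 1) * m ≤ k * m := Nat.mul_le_mul_right m hi.2
    rw [mem_box]
    omega
  have hcard : (s.biUnion T).card = (k * m) ^ 2 := by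
    rw [Finset.card_biUnion fun i hi j hj hij => hdisj hi hj hij]
    simp [T, translate, card_box, s]
    ring
  rw [← Finset.union_sdiff_of_subset hsub]
  refine le_trans (mul_le_mul' ?_ ?_) (genPartition_mul_le hβ g Finset.disjoint_sdiff)
  · refine le_trans ?_ (prod_genPartition_le hβ g s T hdisj)
    have : k ^ 2 = s.card := by simp [s, sq]
    rw [this, ← Finset.prod_const]
    exact Finset.prod_le_prod' fun i _ => genPartition_le_translate β g _ _
  · refine le_trans (le_of_eq ?_) (pow_le_genPartition β g _)
    rw [Finset.card_sdiff_of_subset hsub, hcard, card_box]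

/-! ### Existence of the free energies -/

/-- A two-dimensional version of Fekete's lemma. -/
theorem exists_tendsto_div_sq {b : ℕ → ℝ} {C : ℝ} (h0 : ∀ N, 0 ≤ b N)
    (hC : ∀ N : ℕ, b N ≤ C * (N : ℝ) ^ 2)
    (hs : ∀ k m N : ℕ, k * m ≤ N → (k : ℝ) ^ 2 * b m ≤ b N) :
    ∃ L, Tendsto (fun N : ℕ => b N / (N : ℝ) ^ 2) atTop (𝓝 L) := by
  have hbdd : BddAbove (Set.range fun N : ℕ => b (N + 1) / ((N + 1 : ℕ) : ℝ) ^ 2) := by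
    refine ⟨C, ?_⟩
    rintro _ ⟨N, rfl⟩
    rw [div_le_iff₀ (by positivity)]
    exact hC _
  refine ⟨⨆ N : ℕ, b (N + 1) / ((N + 1 : ℕ) : ℝ) ^ 2, tendsto_order.2 ⟨fun a ha => ?_,
    fun a ha => ?_⟩⟩
  · obtain ⟨n, hn⟩ := exists_lt_of_lt_ciSup ha
    set m := n + 1
    have hm : (0 : ℝ) < m := by positivity
    have hlim : Tendsto (fun N : ℕ => (1 - (m : ℝ) / N) ^ 2 * (b m / (m : ℝ) ^ 2)) atTop
        (𝓝 ((1 - 0) ^ 2 * (b m / (m : ℝ) ^ 2))) :=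
      ((tendsto_const_nhds.sub (tendsto_const_div_atTop_nhds_zero_nat (m : ℝ))).pow 2).mul_const _
    rw [sub_zero, one_pow, one_mul] at hlim
    filter_upwards [hlim.eventually (lt_mem_nhds hn), eventually_ge_atTop m] with N hN hmN
    refine hN.trans_le ?_
    have hNpos : (0 : ℝ) < N := hm.trans_le (by exact_mod_cast hmN)
    have hk := hs (N / m) m N (Nat.div_mul_le_self N m)
    -- Rounding `N` down to a multiple of `m` costs a factor (1 - m/N)², which tends to 1.
    have hlt : (N : ℝ) < ((N / m : ℕ) + 1) * m := by
      exact_mod_cast Nat.lt_mul_of_div_lt (Nat.lt_succ_self _) (Nat.succ_pos n)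
    rw [le_div_iff₀ (by positivity)]
    refine le_trans ?_ hk
    have h1 : (1 - (m : ℝ) / N) ^ 2 * (b m / (m : ℝ) ^ 2) * (N : ℝ) ^ 2 =
        ((N - m) / m) ^ 2 * b m := by
      field_simp
    rw [h1]
    refine mul_le_mul_of_nonneg_right ?_ (h0 m)
    refine pow_le_pow_left₀ (div_nonneg ?_ hm.le) ?_ 2
    · exact sub_nonneg.2 (by exact_mod_cast hmN)
    · rw [div_le_iff₀ hm]
      linarith
  · filter_upwards [eventually_ge_atTop 1] with N hN
    refine lt_of_le_of_lt ?_ ha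
    have := le_ciSup hbdd (N - 1)
    simpa [Nat.sub_add_cancel hN] using this

theorem exists_tendsto_log_genPartition {β : ℝ} (hβ : 0 < β) {g : ℤ → ℝ≥0∞} {K : ℝ≥0∞}
    (hK : K ≠ ∞) (hg : ∀ k, g k ≤ K) (hg0 : g 0 ≠ 0) :
    ∃ L, Tendsto (fun N : ℕ => (1 / (N : ℝ) ^ 2) * Real.log (genPartition β g (box N)).toReal)
      atTop (𝓝 L) := by
  have hg0' : g 0 ≠ ∞ := ne_top_of_le_ne_top hK (hg 0)
  have hc : 0 < (g 0).toReal := ENNReal.toReal_pos hg0 hg0'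
  set Z : ℕ → ℝ := fun N => (genPartition β g (box N)).toReal with hZ
  have htop : ∀ N, genPartition β g (box N) ≠ ∞ := fun N => genPartition_ne_top hβ hK hg _
  have hlow : ∀ N, (g 0).toReal ^ (N ^ 2) ≤ Z N := by
    intro N
    rw [hZ, ← ENNReal.toReal_pow, ← card_box N]
    exact ENNReal.toReal_mono (htop N) (pow_le_genPartition β g _)
  have hZpos : ∀ N, 0 < Z N := fun N => (pow_pos hc _).trans_le (hlow N)
  set M : ℝ := (K * ∑' k : ℤ, ENNReal.ofReal (Real.exp (-β * |(k : ℝ)|))).toReal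
  have hup : ∀ N, Z N ≤ M ^ (N ^ 2) := by
    intro N
    rw [hZ, ← ENNReal.toReal_pow, ← card_box N]
    exact ENNReal.toReal_mono
      (ENNReal.pow_ne_top (ENNReal.mul_ne_top hK (tsum_exp_abs_ne_top hβ)))
      (genPartition_le hβ hg _)
  -- Dividing each site weight by g 0 makes uncovered sites free, as the Fekete-type lemma requires,
  -- and makes the logarithms nonnegative.
  suffices hlim : ∃ L, Tendsto (fun N : ℕ =>
      (Real.log (Z N) - (N : ℝ) ^ 2 * Real.log (g 0).toReal) / (N : ℝ) ^ 2) atTop (𝓝 L) by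
    obtain ⟨L, hL⟩ := hlim
    refine ⟨L + Real.log (g 0).toReal, (hL.add_const _).congr' ?_⟩
    filter_upwards [eventually_ge_atTop 1] with N hN
    have : (0 : ℝ) < N := by exact_mod_cast hN
    field_simp
    rw [sub_add_cancel]
  refine exists_tendsto_div_sq (C := Real.log M - Real.log (g 0).toReal) ?_ ?_ ?_
  · intro N
    have := Real.log_le_log (pow_pos hc _) (hlow N)
    rw [Real.log_pow] at this
    push_cast at this
    linarith
  · intro N
    have := Real.log_le_log (hZpos N) (hup N)
    rw [Real.log_pow] at this
    push_cast at this
    linarith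
  · intro k m N h
    have h1 := ENNReal.toReal_mono (htop N) (genPartition_box_le hβ g h)
    rw [ENNReal.toReal_mul, ENNReal.toReal_pow, ENNReal.toReal_pow] at h1
    have h2 := Real.log_le_log (mul_pos (pow_pos (hZpos m) _) (pow_pos hc _)) h1
    rw [Real.log_mul (pow_pos (hZpos m) _).ne' (pow_pos hc _).ne', Real.log_pow, Real.log_pow,
      Nat.cast_sub (Nat.pow_le_pow_left h 2)] at h2
    push_cast at h2
    change (k : ℝ) ^ 2 * Real.log (Z m) + _ ≤ Real.log (Z N) at h2
    linarith

/-! The two models -/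

/-- The single-site weight of the wetting problem. -/
def wettingSite (h : ℝ) (k : ℤ) : ℝ≥0∞ :=
  if k < 0 then 0 else if k = 0 then ENNReal.ofReal (Real.exp h) else 1

theorem wettingSite_zero (h : ℝ) : wettingSite h 0 = ENNReal.ofReal (Real.exp h) := by
  simp [wettingSite]

theorem wettingSite_le (h : ℝ) (k : ℤ) : wettingSite h k ≤ ENNReal.ofReal (Real.exp h) + 1 := by
  unfold wettingSite
  split_ifs <;> simp

theorem wettingSite_mono {h h' : ℝ} (hh : h ≤ h') (k : ℤ) : wettingSite h k ≤ wettingSite h' k := by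
  unfold wettingSite
  split_ifs
  · exact le_rfl
  · exact ENNReal.ofReal_le_ofReal (Real.exp_le_exp.2 hh)
  · exact le_rfl

theorem ofReal_weight (β : ℝ) (Λ : Finset Site) (φ : Λ → ℤ) :
    ENNReal.ofReal (weight β Λ φ) = gibbs β (extend Λ φ) * ∏ x, (fun _ => 1 : ℤ → ℝ≥0∞) (φ x) := by
  simp [weight, gibbs, hamiltonian_eq_energy]

theorem ofReal_wettingWeight (β h : ℝ) (Λ : Finset Site) (φ : Λ → ℕ) :
    ENNReal.ofReal (wettingWeight β h Λ φ) =
      gibbs β (extend Λ fun x => (φ x : ℤ)) * ∏ x, wettingSite h (φ x) := by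
  have h1 : ∀ k : ℕ, wettingSite h k = if k = 0 then ENNReal.ofReal (Real.exp h) else 1 := by
    intro k
    simp [wettingSite]
  simp only [h1]
  rw [Finset.prod_ite, Finset.prod_const_one, mul_one, Finset.prod_const,
    ← ENNReal.ofReal_pow (Real.exp_pos _).le, ← Real.exp_nat_mul, gibbs,
    ← ENNReal.ofReal_mul (Real.exp_pos _).le, ← Real.exp_add, wettingWeight,
    hamiltonian_eq_energy, mul_comm h]

theorem tsum_ofReal_weight (β : ℝ) (Λ : Finset Site) :
    ∑' φ, ENNReal.ofReal (weight β Λ φ) = genPartition β (fun _ => 1) Λ :=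
  tsum_congr fun φ => ofReal_weight β Λ φ

/-- The site weight vanishes at negative heights, so the wall constraint is part of the weight and
both models are instances of `genPartition`. -/
theorem tsum_ofReal_wettingWeight (β h : ℝ) (Λ : Finset Site) :
    ∑' φ, ENNReal.ofReal (wettingWeight β h Λ φ) = genPartition β (wettingSite h) Λ := by
  have hinj : Function.Injective fun (φ : Λ → ℕ) (x : Λ) => (φ x : ℤ) := by
    intro φ φ' h
    funext x
    exact Int.ofNat_inj.1 (congrFun h x)
  unfold genPartition
  rw [← hinj.tsum_eq]
  · exact tsum_congr fun φ => ofReal_wettingWeight β h Λ φ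
  · intro φ hφ
    refine ⟨fun x => (φ x).toNat, funext fun x => Int.toNat_of_nonneg ?_⟩
    by_contra hneg
    refine hφ (mul_eq_zero_of_right _ (Finset.prod_eq_zero (Finset.mem_univ x) ?_))
    simp [wettingSite, not_le.1 hneg]

theorem weight_pos (β : ℝ) (Λ : Finset Site) (φ : Λ → ℤ) : 0 < weight β Λ φ := Real.exp_pos _

theorem wettingWeight_pos (β h : ℝ) (Λ : Finset Site) (φ : Λ → ℕ) : 0 < wettingWeight β h Λ φ :=
  Real.exp_pos _

theorem summable_of_tsum_ofReal {α : Type*} {f : α → ℝ} (hf : ∀ a, 0 ≤ f a)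
    (h : ∑' a, ENNReal.ofReal (f a) ≠ ∞) : Summable f := by
  have := ENNReal.summable_toReal h
  exact this.congr fun a => ENNReal.toReal_ofReal (hf a)

theorem genPartition_one_ne_top {β : ℝ} (hβ : 0 < β) (Λ : Finset Site) :
    genPartition β (fun _ => 1) Λ ≠ ∞ :=
  genPartition_ne_top hβ ENNReal.one_ne_top (fun _ => le_rfl) Λ

theorem genPartition_wettingSite_ne_top {β : ℝ} (hβ : 0 < β) (h : ℝ) (Λ : Finset Site) :
    genPartition β (wettingSite h) Λ ≠ ∞ :=
  genPartition_ne_top hβ (by simp) (wettingSite_le h) Λ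

theorem summable_weight {β : ℝ} (hβ : 0 < β) (Λ : Finset Site) : Summable (weight β Λ) :=
  summable_of_tsum_ofReal (fun φ => (weight_pos β Λ φ).le)
    (by rw [tsum_ofReal_weight]; exact genPartition_one_ne_top hβ Λ)

theorem summable_wettingWeight {β : ℝ} (hβ : 0 < β) (h : ℝ) (Λ : Finset Site) :
    Summable (wettingWeight β h Λ) :=
  summable_of_tsum_ofReal (fun φ => (wettingWeight_pos β h Λ φ).le)
    (by rw [tsum_ofReal_wettingWeight]; exact genPartition_wettingSite_ne_top hβ h Λ)

theorem partitionFn_eq {β : ℝ} (hβ : 0 < β) (Λ : Finset Site) :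
    partitionFn β Λ = (genPartition β (fun _ => 1) Λ).toReal := by
  rw [← tsum_ofReal_weight, ← ENNReal.ofReal_tsum_of_nonneg (fun φ => (weight_pos β Λ φ).le)
    (summable_weight hβ Λ), ENNReal.toReal_ofReal (tsum_nonneg fun φ => (weight_pos β Λ φ).le)]
  rfl

theorem wettingPartitionFn_eq {β : ℝ} (hβ : 0 < β) (h : ℝ) (Λ : Finset Site) :
    wettingPartitionFn β h Λ = (genPartition β (wettingSite h) Λ).toReal := by
  rw [← tsum_ofReal_wettingWeight,
    ← ENNReal.ofReal_tsum_of_nonneg (fun φ => (wettingWeight_pos β h Λ φ).le)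
      (summable_wettingWeight hβ h Λ),
    ENNReal.toReal_ofReal (tsum_nonneg fun φ => (wettingWeight_pos β h Λ φ).le)]
  rfl

theorem genPartition_one_ne_zero (β : ℝ) (Λ : Finset Site) :
    genPartition β (fun _ => 1) Λ ≠ 0 := by
  have := pow_le_genPartition β (fun _ => 1) Λ
  rw [one_pow] at this
  exact (zero_lt_one.trans_le this).ne'

theorem genPartition_wettingSite_ne_zero (β h : ℝ) (Λ : Finset Site) :
    genPartition β (wettingSite h) Λ ≠ 0 := by
  have := pow_le_genPartition β (wettingSite h) Λ
  rw [wettingSite_zero] at this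
  exact ((ENNReal.pow_pos (ENNReal.ofReal_pos.2 (Real.exp_pos h)) _).trans_le this).ne'

theorem partitionFn_pos {β : ℝ} (hβ : 0 < β) (Λ : Finset Site) : 0 < partitionFn β Λ := by
  rw [partitionFn_eq hβ]
  exact ENNReal.toReal_pos (genPartition_one_ne_zero β Λ) (genPartition_one_ne_top hβ Λ)

theorem wettingPartitionFn_pos {β : ℝ} (hβ : 0 < β) (h : ℝ) (Λ : Finset Site) :
    0 < wettingPartitionFn β h Λ := by
  rw [wettingPartitionFn_eq hβ]
  exact ENNReal.toReal_pos (genPartition_wettingSite_ne_zero β h Λ)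
    (genPartition_wettingSite_ne_top hβ h Λ)

theorem tendsto_freeEnergy {β : ℝ} (hβ : 0 < β) :
    Tendsto (fun N : ℕ => (1 / (N : ℝ) ^ 2) * Real.log (partitionFn β (box N)))
      atTop (𝓝 (freeEnergy β)) := by
  refine tendsto_nhds_limUnder ?_
  simp only [partitionFn_eq hβ]
  exact exists_tendsto_log_genPartition hβ ENNReal.one_ne_top (fun _ => le_rfl) one_ne_zero

theorem tendsto_wettingFreeEnergy {β : ℝ} (hβ : 0 < β) (h : ℝ) :
    Tendsto (fun N : ℕ => (1 / (N : ℝ) ^ 2) * Real.log (wettingPartitionFn β h (box N)))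
      atTop (𝓝 (wettingFreeEnergy β h)) := by
  refine tendsto_nhds_limUnder ?_
  simp only [wettingPartitionFn_eq hβ]
  refine exists_tendsto_log_genPartition hβ (by simp) (wettingSite_le h) ?_
  rw [wettingSite_zero]
  exact (ENNReal.ofReal_pos.2 (Real.exp_pos h)).ne'

theorem wettingFreeEnergy_mono {β : ℝ} (hβ : 0 < β) : Monotone (wettingFreeEnergy β) := by
  intro h h' hh
  refine le_of_tendsto_of_tendsto' (tendsto_wettingFreeEnergy hβ h)
    (tendsto_wettingFreeEnergy hβ h') fun N => ?_
  refine mul_le_mul_of_nonneg_left (Real.log_le_log (wettingPartitionFn_pos hβ h _) ?_)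
    (by positivity)
  rw [wettingPartitionFn_eq hβ, wettingPartitionFn_eq hβ]
  refine ENNReal.toReal_mono (genPartition_wettingSite_ne_top hβ h' _)
    (ENNReal.tsum_le_tsum fun φ => ?_)
  exact mul_le_mul' le_rfl (Finset.prod_le_prod' fun x _ => wettingSite_mono hh _)

/-! ### Removal of contours -/

/-- Take `D` around `x` with boundary darts among those of {φ ≥ 1}. Across each of them φ falls from
at least 1 to at most 0, so subtracting the indicator of `D` shortens that gradient by exactly 1 and
changes no other. -/
theorem exists_removal {N : ℕ} {φ : Site → ℤ} (hφ : ∀ p ∉ box N, φ p = 0) {x : Site}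
    (hx : 1 ≤ φ x) : ∃ D : Finset Site, x ∈ D ∧ D ⊆ box N ∧ Irreducible D ∧
      energy φ = energy (fun p => φ p - if p ∈ D then 1 else 0) + (darts D).card := by
  classical
  let A := (box N).filter fun p => 1 ≤ φ p
  have hxA : x ∈ A := by
    refine Finset.mem_filter.2 ⟨?_, hx⟩
    by_contra h
    have := hφ x h
    omega
  obtain ⟨D, hxD, hDA, hD⟩ := exists_irreducible hxA
  have hDbox := subset_box_of_darts_subset (Finset.filter_subset _ _) hDA
  refine ⟨D, hxD, hDbox, hD, ?_⟩
  rw [← energy_indicator]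
  have hcross : ∀ p q, Nbr p q → p ∈ D → q ∉ D → 1 ≤ φ p ∧ φ q ≤ 0 := by
    intro p q hn hp hq
    have h := mem_darts.1 (hDA (mem_darts.2 ⟨hn, hp, hq⟩ : (p, q) ∈ darts D))
    refine ⟨(Finset.mem_filter.1 h.2.1).2, ?_⟩
    by_contra hlt
    refine h.2.2 (Finset.mem_filter.2 ⟨?_, by simp only; omega⟩)
    by_contra hqb
    exact hlt (hφ q hqb).le
  refine energy_eq_add (Λ := box N) (fun p hp => ?_) (fun p hp => ?_) fun p q hn => ?_
  · simp [hφ p hp, mt (@hDbox p) hp]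
  · simp [mt (@hDbox p) hp]
  · by_cases h1 : p ∈ D <;> by_cases h2 : q ∈ D
    · simp [h1, h2]
    · obtain ⟨h3, h4⟩ := hcross p q hn h1 h2
      simp only [h1, h2, if_true, if_false]
      rw [abs_of_nonneg (by omega), abs_of_nonneg (by omega), abs_of_nonneg (by omega)]
      ring
    · obtain ⟨h3, h4⟩ := hcross q p hn.symm h2 h1
      simp only [h1, h2, if_true, if_false]
      rw [abs_of_nonpos (by omega), abs_of_nonpos (by omega), abs_of_nonpos (by omega)]
      ring
    · simp [h1, h2]

/-- A height function is a superposition of contours around `x` or `y` and of a height function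
that is not positive at `x` and `y`, and the energies add up. -/
theorem exists_decomposition {N : ℕ} {x y : Site} {F : Finset (Finset Site)}
    (hF : ∀ D, Irreducible D → D ⊆ box N → x ∈ D ∨ y ∈ D → D ∈ F) (φ : Site → ℤ)
    (hφ : ∀ p ∉ box N, φ p = 0) : ∃ (φ' : Site → ℤ) (m : F → ℕ),
      (∀ p, φ p = φ' p + ∑ D : F, (m D : ℤ) * if p ∈ (D : Finset Site) then 1 else 0) ∧
      (∀ p ∉ box N, φ' p = 0) ∧ φ' x ≤ 0 ∧ φ' y ≤ 0 ∧
      energy φ = energy φ' + ∑ D : F, (m D : ℝ) * ((darts D.1).card : ℝ) := by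
  classical
  induction hn : (φ x).toNat + (φ y).toNat using Nat.strong_induction_on generalizing φ with
  | _ n ih =>
    by_cases hxy : φ x ≤ 0 ∧ φ y ≤ 0
    · exact ⟨φ, fun _ => 0, by simp, hφ, hxy.1, hxy.2, by simp⟩
    · have hD : ∃ D : Finset Site, (x ∈ D ∧ 1 ≤ φ x ∨ y ∈ D ∧ 1 ≤ φ y) ∧ D ⊆ box N ∧
          Irreducible D ∧
          energy φ = energy (fun p => φ p - if p ∈ D then 1 else 0) + (darts D).card := by
        by_cases hx : φ x ≤ 0
        · have hy : 1 ≤ φ y := by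
            by_contra h
            exact hxy ⟨hx, by omega⟩
          obtain ⟨D, h1, h2⟩ := exists_removal hφ hy
          exact ⟨D, Or.inr ⟨h1, hy⟩, h2⟩
        · have hx : 1 ≤ φ x := by omega
          obtain ⟨D, h1, h2⟩ := exists_removal hφ hx
          exact ⟨D, Or.inl ⟨h1, hx⟩, h2⟩
      obtain ⟨D, hD1, hD2, hD3, hD4⟩ := hD
      have hDF : D ∈ F := hF D hD3 hD2 (hD1.imp And.left And.left)
      -- The removed set contains a site among `x`, `y` with positive height, so the sum of the
      -- positive parts there decreases.
      obtain ⟨φ', m, h1, h2, h3, h4, h5⟩ := ih _ (by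
        rw [← hn]
        rcases hD1 with ⟨h1, h2⟩ | ⟨h1, h2⟩
        · simp only [h1, if_true]
          split_ifs <;> omega
        · simp only [h1, if_true]
          split_ifs <;> omega) (fun p => φ p - if p ∈ D then 1 else 0)
        (fun p hp => by simp [hφ p hp, mt (@hD2 p) hp]) rfl
      refine ⟨φ', m + Pi.single ⟨D, hDF⟩ 1, fun p => ?_, h2, h3, h4, ?_⟩
      · have := h1 p
        simp only [Pi.add_apply, Nat.cast_add, add_mul, Finset.sum_add_distrib]
        rw [Finset.sum_eq_single (⟨D, hDF⟩ : F)
          (f := fun E : F => ((Pi.single (⟨D, hDF⟩ : F) 1 : F → ℕ) E : ℤ) *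
            if p ∈ (E : Finset Site) then 1 else 0)]
        · simp only [Pi.single_eq_same, Nat.cast_one, one_mul]
          omega
        · intro E _ hE
          simp [Pi.single_eq_of_ne hE]
        · simp
      · rw [hD4, h5]
        simp only [Pi.add_apply, Nat.cast_add, add_mul, Finset.sum_add_distrib]
        rw [Finset.sum_eq_single (⟨D, hDF⟩ : F)
          (f := fun E : F => ((Pi.single (⟨D, hDF⟩ : F) 1 : F → ℕ) E : ℝ) *
            ((darts E.1).card : ℝ))]
        · simp only [Pi.single_eq_same, Nat.cast_one, one_mul]
          ring
        · intro E _ hE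
          simp [Pi.single_eq_of_ne hE]
        · simp

/-! ### Tail estimates -/

/-- The unnormalized probability that the heights at `x` and `y` are at least `n`. -/
def tailWeight (β : ℝ) (N : ℕ) (x y : Site) (n : ℕ) : ℝ≥0∞ :=
  ∑' φ : box N → ℤ, if (n : ℤ) ≤ extend (box N) φ x ∧ (n : ℤ) ≤ extend (box N) φ y then
    gibbs β (extend (box N) φ) else 0

/-- Heights at least `n` at `x` and `y` require at least `n` removed contours around each. The bound
`f` may use this constraint; afterwards it is dropped and the multiplicities are summed
independently, while the residual height functions contribute at most the full partition function.
-/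
theorem tailWeight_le {β : ℝ} {N : ℕ} {x y : Site} {F : Finset (Finset Site)}
    (hF : ∀ D, Irreducible D → D ⊆ box N → x ∈ D ∨ y ∈ D → D ∈ F) (n : ℕ) (A : ℝ≥0∞)
    (f : Finset Site → ℕ → ℝ≥0∞)
    (hf : ∀ m : Finset Site → ℕ, n ≤ ∑ D ∈ F, m D * (if x ∈ D then 1 else 0) →
      n ≤ ∑ D ∈ F, m D * (if y ∈ D then 1 else 0) →
      ∏ D ∈ F, ENNReal.ofReal (Real.exp (-β * ((darts D).card : ℝ))) ^ m D ≤
        A * ∏ D ∈ F, f D (m D)) :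
    tailWeight β N x y n ≤
      genPartition β (fun _ => 1) (box N) * (A * ∏ D ∈ F, ∑' k, f D k) := by
  classical
  have hf' : ∀ m : F → ℕ, n ≤ ∑ D : F, m D * (if x ∈ (D : Finset Site) then 1 else 0) →
      n ≤ ∑ D : F, m D * (if y ∈ (D : Finset Site) then 1 else 0) →
      ∏ D : F, ENNReal.ofReal (Real.exp (-β * ((darts D.1).card : ℝ))) ^ m D ≤
        A * ∏ D : F, f D (m D) := by
    intro m hx hy
    obtain ⟨m', hm'⟩ : ∃ m' : Finset Site → ℕ, ∀ D : F, m D = m' D :=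
      ⟨fun D => if h : D ∈ F then m ⟨D, h⟩ else 0, fun D => by simp⟩
    simp only [hm'] at hx hy ⊢
    rw [Finset.sum_coe_sort F fun D => m' D * if x ∈ D then 1 else 0] at hx
    rw [Finset.sum_coe_sort F fun D => m' D * if y ∈ D then 1 else 0] at hy
    rw [Finset.prod_coe_sort F fun D =>
        ENNReal.ofReal (Real.exp (-β * ((darts D).card : ℝ))) ^ m' D,
      Finset.prod_coe_sort F fun D => f D (m' D)]
    exact hf m' hx hy
  choose ψ m h1 h2 h3 h4 h5 using fun φ : box N → ℤ =>
    exists_decomposition hF (extend (box N) φ) (extend_of_notMem φ)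
  -- The decomposition is chosen, not unique, but it determines φ; injectivity is all that is
  -- needed.
  let G : (box N → ℤ) → (box N → ℤ) × (F → ℕ) := fun φ => (fun x => ψ φ x, m φ)
  have hG : ∀ φ, extend (box N) (G φ).1 = ψ φ := fun φ => extend_restrict (h2 φ)
  have hinj : Function.Injective G := by
    intro φ φ' h
    have ha : ψ φ = ψ φ' := by rw [← hG, ← hG, h]
    have hb : m φ = m φ' := congrArg Prod.snd h
    funext z
    rw [← extend_coe φ, ← extend_coe φ', h1, h1, ha, hb]
  calc tailWeight β N x y n
      ≤ ∑' φ : box N → ℤ, gibbs β (extend (box N) (G φ).1) *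
          (A * ∏ D : F, f D ((G φ).2 D)) := by
        refine ENNReal.tsum_le_tsum fun φ => ?_
        split_ifs with hxy
        · have hcount : ∀ z, ψ φ z ≤ 0 → (n : ℤ) ≤ extend (box N) φ z →
              n ≤ ∑ D : F, m φ D * (if z ∈ (D : Finset Site) then 1 else 0) := by
            intro z hz hnz
            rw [h1 φ z] at hnz
            zify
            linarith
          refine le_trans (le_of_eq ?_) (mul_le_mul' le_rfl
            (hf' (m φ) (hcount x (h3 φ) hxy.1) (hcount y (h4 φ) hxy.2)))
          rw [hG, gibbs, h5 φ, mul_add, Real.exp_add, ENNReal.ofReal_mul (Real.exp_pos _).le,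
            gibbs, Finset.mul_sum, Real.exp_sum,
            ENNReal.ofReal_prod_of_nonneg fun _ _ => (Real.exp_pos _).le]
          congr 1
          refine Finset.prod_congr rfl fun D _ => ?_
          rw [← ENNReal.ofReal_pow (Real.exp_pos _).le, ← Real.exp_nat_mul]
          congr 2
          ring
        · exact zero_le
    _ ≤ ∑' q : (box N → ℤ) × (F → ℕ), gibbs β (extend (box N) q.1) * (A * ∏ D : F, f D (q.2 D)) :=
        ENNReal.tsum_comp_le_tsum_of_injective hinj fun q =>
          gibbs β (extend (box N) q.1) * (A * ∏ D : F, f D (q.2 D))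
    _ = genPartition β (fun _ => 1) (box N) * (A * ∏ D ∈ F, ∑' k, f D k) := by
        rw [ENNReal.tsum_prod']
        simp only [ENNReal.tsum_mul_left, genPartition, Finset.prod_const_one, mul_one]
        rw [ENNReal.tsum_mul_right, tsum_pi_prod F fun D : F => f D, ← Finset.prod_coe_sort F]

/-- Uses 1/(1 - τ) ≤ exp(τ/(1 - τ)) ≤ exp(τ/(1 - ρ)) to trade a product over arbitrarily many
contours for the exponential of a bounded sum. -/
theorem prod_geometric_le {α : Type*} (F : Finset α) (τ : α → ℝ) {ρ B : ℝ} (hρ : ρ < 1)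
    (h0 : ∀ D ∈ F, 0 ≤ τ D) (h1 : ∀ D ∈ F, τ D ≤ ρ) (hB : ∑ D ∈ F, τ D ≤ B) :
    ∏ D ∈ F, ∑' k : ℕ, ENNReal.ofReal (τ D) ^ k ≤ ENNReal.ofReal (Real.exp (B / (1 - ρ))) := by
  have h2 : ∀ D ∈ F, ∑' k : ℕ, ENNReal.ofReal (τ D) ^ k ≤
      ENNReal.ofReal (Real.exp (τ D / (1 - ρ))) := by
    intro D hD
    have hpos : 0 < 1 - τ D := by linarith [h1 D hD]
    rw [ENNReal.tsum_geometric, ← ENNReal.ofReal_one, ← ENNReal.ofReal_sub _ (h0 D hD),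
      ← ENNReal.ofReal_inv_of_pos hpos]
    refine ENNReal.ofReal_le_ofReal ?_
    have h3 : (1 - τ D)⁻¹ = τ D / (1 - τ D) + 1 := by
      field_simp
      ring
    rw [h3]
    refine (Real.add_one_le_exp _).trans (Real.exp_le_exp.2 ?_)
    exact div_le_div_of_nonneg_left (h0 D hD) (by linarith) (by linarith [h1 D hD])
  refine (Finset.prod_le_prod' h2).trans ?_
  rw [← ENNReal.ofReal_prod_of_nonneg fun _ _ => (Real.exp_pos _).le, ← Real.exp_sum,
    ← Finset.sum_div]
  exact ENNReal.ofReal_le_ofReal (Real.exp_le_exp.2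
    (div_le_div_of_nonneg_right hB (by linarith)))

/-- The number of sites among `x` and `y` that belong to `D`. -/
def hits (x y : Site) (D : Finset Site) : ℕ := (if x ∈ D then 1 else 0) + if y ∈ D then 1 else 0

theorem hits_le_two (x y : Site) (D : Finset Site) : hits x y D ≤ 2 := by
  unfold hits
  split_ifs <;> omega

/-- The irreducible subsets of the box that contain `x` or `y`. -/
def family (N : ℕ) (x y : Site) : Finset (Finset Site) :=
  open Classical in (box N).powerset.filter fun D => Irreducible D ∧ (x ∈ D ∨ y ∈ D)

theorem mem_family {N : ℕ} {x y : Site} {D : Finset Site} :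
    D ∈ family N x y ↔ D ⊆ box N ∧ Irreducible D ∧ (x ∈ D ∨ y ∈ D) := by
  simp [family]

theorem sum_family_le {β K : ℝ} (hK : ∀ (x : Site) (F : Finset (Finset Site)),
      (∀ D ∈ F, Irreducible D ∧ x ∈ D) → ∑ D ∈ F, Real.exp (-β * ((darts D).card : ℝ)) ≤ K)
    (N : ℕ) (x y : Site) :
    ∑ D ∈ family N x y, Real.exp (-β * ((darts D).card : ℝ)) ≤ 2 * K := by
  classical
  have hsub : family N x y ⊆ (family N x y).filter (fun D => x ∈ D) ∪
      (family N x y).filter (fun D => y ∈ D) := by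
    intro D hD
    rw [Finset.mem_union, Finset.mem_filter, Finset.mem_filter]
    exact (mem_family.1 hD).2.2.imp (fun h => ⟨hD, h⟩) fun h => ⟨hD, h⟩
  have h : ∀ z, ∑ D ∈ (family N x y).filter (fun D => z ∈ D),
      Real.exp (-β * ((darts D).card : ℝ)) ≤ K := by
    intro z
    refine hK z _ fun D hD => ?_
    rw [Finset.mem_filter] at hD
    exact ⟨(mem_family.1 hD.1).2.1, hD.2⟩
  calc ∑ D ∈ family N x y, Real.exp (-β * ((darts D).card : ℝ))
      ≤ ∑ D ∈ (family N x y).filter (fun D => x ∈ D) ∪ (family N x y).filter (fun D => y ∈ D),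
          Real.exp (-β * ((darts D).card : ℝ)) :=
        Finset.sum_le_sum_of_subset_of_nonneg hsub fun _ _ _ => (Real.exp_pos _).le
    _ ≤ ∑ D ∈ (family N x y).filter (fun D => x ∈ D), Real.exp (-β * ((darts D).card : ℝ)) +
          ∑ D ∈ (family N x y).filter (fun D => y ∈ D), Real.exp (-β * ((darts D).card : ℝ)) := by
        rw [← Finset.sum_union_inter]
        exact le_add_of_nonneg_right (Finset.sum_nonneg fun _ _ => (Real.exp_pos _).le)
    _ ≤ 2 * K := by linarith [h x, h y]

/-- The tilted weight of a contour. -/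
def tilted (β s : ℝ) (x y : Site) (D : Finset Site) : ℝ :=
  Real.exp (-β * ((darts D).card : ℝ) + s * hits x y D)

/-- The tilt costs at most e^{2s} per contour, so summability survives; the condition on the
exponents keeps every geometric ratio below e^{-β/2}. -/
theorem prod_tilted_le {β K s : ℝ} (hβ : 0 < β) (hs : 0 ≤ s)
    (hK : ∀ (x : Site) (F : Finset (Finset Site)),
      (∀ D ∈ F, Irreducible D ∧ x ∈ D) → ∑ D ∈ F, Real.exp (-β * ((darts D).card : ℝ)) ≤ K)
    {N : ℕ} {x y : Site} {F : Finset (Finset Site)} (hF : F ⊆ family N x y)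
    (h : ∀ D ∈ F, -β * ((darts D).card : ℝ) + s * hits x y D ≤ -β / 2) :
    ∏ D ∈ F, ∑' k : ℕ, ENNReal.ofReal (tilted β s x y D) ^ k ≤
      ENNReal.ofReal (Real.exp (Real.exp (2 * s) * (2 * K) / (1 - Real.exp (-β / 2)))) := by
  refine prod_geometric_le F _ (Real.exp_lt_one_iff.2 (by linarith))
    (fun D _ => (Real.exp_pos _).le) (fun D hD => Real.exp_le_exp.2 (h D hD)) ?_
  calc ∑ D ∈ F, tilted β s x y D
      ≤ ∑ D ∈ F, Real.exp (2 * s) * Real.exp (-β * ((darts D).card : ℝ)) := by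
        refine Finset.sum_le_sum fun D _ => ?_
        rw [tilted, ← Real.exp_add]
        refine Real.exp_le_exp.2 ?_
        have : (hits x y D : ℝ) ≤ 2 := by exact_mod_cast hits_le_two x y D
        nlinarith
    _ ≤ ∑ D ∈ family N x y, Real.exp (2 * s) * Real.exp (-β * ((darts D).card : ℝ)) :=
        Finset.sum_le_sum_of_subset_of_nonneg hF fun _ _ _ => by positivity
    _ ≤ Real.exp (2 * s) * (2 * K) := by
        rw [← Finset.mul_sum]
        exact mul_le_mul_of_nonneg_left (sum_family_le hK N x y) (Real.exp_pos _).le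

/-- An exponential Chebyshev identity: the tilt is inserted into each contour weight and compensated
by the total number of hits. -/
theorem prod_pow_eq {β s : ℝ} {x y : Site} {F : Finset (Finset Site)} (m : Finset Site → ℕ) :
    ∏ D ∈ F, ENNReal.ofReal (Real.exp (-β * ((darts D).card : ℝ))) ^ m D =
      ENNReal.ofReal (Real.exp (-s * (∑ D ∈ F, m D * hits x y D : ℕ))) *
        ∏ D ∈ F, ENNReal.ofReal (tilted β s x y D) ^ m D := by
  have h : ∀ (f : Finset Site → ℝ), ∏ D ∈ F, ENNReal.ofReal (Real.exp (f D)) ^ m D =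
      ENNReal.ofReal (Real.exp (∑ D ∈ F, m D * f D)) := by
    intro f
    rw [Real.exp_sum, ENNReal.ofReal_prod_of_nonneg fun _ _ => (Real.exp_pos _).le]
    refine Finset.prod_congr rfl fun D _ => ?_
    rw [← ENNReal.ofReal_pow (Real.exp_pos _).le, ← Real.exp_nat_mul]
  unfold tilted
  rw [h, h, ← ENNReal.ofReal_mul (Real.exp_pos _).le, ← Real.exp_add]
  congr 2
  push_cast
  rw [Finset.mul_sum, ← Finset.sum_add_distrib]
  exact Finset.sum_congr rfl fun D _ => by ring

/-- A crude rate is enough here, as it is used only to let n → ∞. With `y = x` each contour has two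
hits, so the tilt s = β/2 costs β against a length of at least 4 and yields e^{-βn}. -/
theorem exists_tailWeight_le {β : ℝ} (hβ : 0 < β) (hfin : ContourSummable β) :
    ∃ C : ℝ, 0 < C ∧ ∀ (N : ℕ) (x : Site) (n : ℕ), tailWeight β N x x n ≤
      genPartition β (fun _ => 1) (box N) * ENNReal.ofReal (C * Real.exp (-β * n)) := by
  classical
  obtain ⟨K, hK⟩ := hfin.exists_bound
  refine ⟨_, Real.exp_pos (Real.exp (2 * (β / 2)) * (2 * K) / (1 - Real.exp (-β / 2))),
    fun N x n => ?_⟩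
  have h := tailWeight_le (β := β) (N := N) (x := x) (y := x) (F := family N x x)
    (fun D h1 h2 h3 => mem_family.2 ⟨h2, h1, h3⟩) n (ENNReal.ofReal (Real.exp (-β * n)))
    (fun D k => ENNReal.ofReal (tilted β (β / 2) x x D) ^ k) ?_
  · refine h.trans (mul_le_mul' le_rfl ?_)
    rw [mul_comm (Real.exp _), ENNReal.ofReal_mul (Real.exp_pos _).le]
    refine mul_le_mul' le_rfl (prod_tilted_le hβ (by linarith) hK subset_rfl fun D hD => ?_)
    have hxD : x ∈ D := or_self_iff.1 (mem_family.1 hD).2.2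
    have h4 : (4 : ℝ) ≤ (darts D).card := by exact_mod_cast four_le_card_darts hxD
    have h2 : (hits x x D : ℝ) ≤ 2 := by exact_mod_cast hits_le_two x x D
    nlinarith
  · intro m hm _
    rw [prod_pow_eq (s := β / 2) (x := x) (y := x)]
    refine mul_le_mul' (ENNReal.ofReal_le_ofReal (Real.exp_le_exp.2 ?_)) le_rfl
    have h2 : 2 * n ≤ ∑ D ∈ family N x x, m D * hits x x D := by
      refine (Nat.mul_le_mul_left 2 hm).trans (le_of_eq ?_)
      rw [Finset.mul_sum]
      refine Finset.sum_congr rfl fun D _ => ?_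
      unfold hits
      ring
    have h3 : (2 : ℝ) * n ≤ (∑ D ∈ family N x x, m D * hits x x D : ℕ) := by exact_mod_cast h2
    nlinarith

/-- The factors that dominate the contour weights when `{x, y}` is singled out. -/
def pairFactor (β s : ℝ) (x y : Site) (n : ℕ) (D : Finset Site) (k : ℕ) : ℝ≥0∞ :=
  if D = {x, y} then ENNReal.ofReal (Real.exp (-β * |(((k : ℤ) - n : ℤ) : ℝ)|))
  else ENNReal.ofReal (tilted β s x y D) ^ k

/-- Let j be the multiplicity of {x, y} and Q the number of hits of the other contours, so 2j + Q ≥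
2n. If j ≤ n, the exponent -6βj - (7/2)βQ is at most -6βn - β(n - j); if j ≥ n, the first term alone
is at most -6βn - β(j - n). -/
theorem prod_le_prod_pairFactor {β s : ℝ} (hβ : 0 < β) (hs : s = 7 / 2 * β) {x y : Site}
    (hxy : x ≠ y) {n : ℕ} {F' : Finset (Finset Site)} (hD₀F' : {x, y} ∉ F')
    (m : Finset Site → ℕ)
    (hx : n ≤ ∑ D ∈ insert {x, y} F', m D * (if x ∈ D then 1 else 0))
    (hy : n ≤ ∑ D ∈ insert {x, y} F', m D * (if y ∈ D then 1 else 0)) :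
    ∏ D ∈ insert {x, y} F', ENNReal.ofReal (Real.exp (-β * ((darts D).card : ℝ))) ^ m D ≤
      ENNReal.ofReal (Real.exp (-6 * β * n)) *
        ∏ D ∈ insert {x, y} F', pairFactor β s x y n D (m D) := by
  rw [Finset.sum_insert hD₀F'] at hx hy
  rw [Finset.prod_insert hD₀F', Finset.prod_insert hD₀F',
    prod_pow_eq (s := s) (x := x) (y := y), pairFactor, if_pos rfl, ← mul_assoc, ← mul_assoc]
  have hrest : ∏ D ∈ F', pairFactor β s x y n D (m D) =
      ∏ D ∈ F', ENNReal.ofReal (tilted β s x y D) ^ m D :=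
    Finset.prod_congr rfl fun D hD => if_neg (ne_of_mem_of_not_mem hD hD₀F')
  rw [hrest]
  refine mul_le_mul' ?_ le_rfl
  rw [← ENNReal.ofReal_pow (Real.exp_pos _).le, ← Real.exp_nat_mul,
    ← ENNReal.ofReal_mul (Real.exp_pos _).le, ← ENNReal.ofReal_mul (Real.exp_pos _).le,
    ← Real.exp_add, ← Real.exp_add]
  refine ENNReal.ofReal_le_ofReal (Real.exp_le_exp.2 ?_)
  set D₀ : Finset Site := {x, y} with hD₀
  have h6 : (6 : ℝ) ≤ (darts D₀).card := by
    exact_mod_cast six_le_card_darts (x := x) (y := y) (by simp [hD₀]) (by simp [hD₀]) hxy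
  simp only [hD₀, Finset.mem_insert, Finset.mem_singleton, true_or, or_true, if_true,
    mul_one] at hx hy
  rw [← hD₀] at hx hy
  have hQ : 2 * n ≤ 2 * m D₀ + ∑ D ∈ F', m D * hits x y D := by
    have : ∑ D ∈ F', m D * hits x y D = ∑ D ∈ F', m D * (if x ∈ D then 1 else 0) +
        ∑ D ∈ F', m D * (if y ∈ D then 1 else 0) := by
      rw [← Finset.sum_add_distrib]
      refine Finset.sum_congr rfl fun D _ => ?_
      unfold hits
      ring
    omega
  generalize ∑ D ∈ F', m D * hits x y D = Q at hQ ⊢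
  generalize m D₀ = j at hQ ⊢
  have hQ' : (2 : ℝ) * n ≤ 2 * j + Q := by exact_mod_cast hQ
  have hQ0 : (0 : ℝ) ≤ Q := Nat.cast_nonneg Q
  have hj0 : (0 : ℝ) ≤ j := Nat.cast_nonneg j
  have hj6 : (j : ℝ) * (-β * (darts D₀).card) ≤ -6 * β * j := by
    have := mul_le_mul_of_nonneg_left h6 (mul_nonneg hj0 hβ.le)
    linarith
  push_cast
  rcases le_total (n : ℝ) j with hnj | hnj
  · rw [abs_of_nonneg (by linarith)]
    have h1 : 0 ≤ β * (j - n) := mul_nonneg hβ.le (by linarith)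
    have h2 : 0 ≤ β * Q := mul_nonneg hβ.le hQ0
    rw [hs]
    linarith
  · rw [abs_of_nonpos (by linarith)]
    have h2 : 0 ≤ β * (2 * j + Q - 2 * n) := mul_nonneg hβ.le (by linarith)
    rw [hs]
    linarith

/-- The set {x, y} can have length 6, which a tilt 2s = 7β exceeds, so it is treated apart, by the
summable factor e^{-β|j - n|}. The choice s = 7β/2 suits all other sets: -4β + s = -β/2 for one hit,
and -8β + 2s = -β for two hits. -/
theorem exists_tailWeight_pair_le {β : ℝ} (hβ : 0 < β) (hfin : ContourSummable β) :
    ∃ C : ℝ, 0 < C ∧ ∀ (N : ℕ) (x y : Site), x ≠ y → ∀ n : ℕ, tailWeight β N x y n ≤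
      genPartition β (fun _ => 1) (box N) * ENNReal.ofReal (C * Real.exp (-6 * β * n)) := by
  obtain ⟨K, hK⟩ := hfin.exists_bound
  set s := 7 / 2 * β with hs
  set B := Real.exp (Real.exp (2 * s) * (2 * K) / (1 - Real.exp (-β / 2)))
  set S := ∑' k : ℤ, Real.exp (-β * |(k : ℝ)|) with hS
  have hS0 : 0 < S := (summable_exp_abs hβ).tsum_pos (fun _ => (Real.exp_pos _).le) 0
    (Real.exp_pos _)
  have hB : 0 < B := Real.exp_pos _
  refine ⟨S * B, by positivity, fun N x y hxy n => ?_⟩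
  set D₀ : Finset Site := {x, y} with hD₀
  set F' := (family N x y).erase D₀ with hF'
  have hD₀F' : D₀ ∉ F' := Finset.notMem_erase _ _
  -- The pair is inserted even when it is not irreducible, so non-adjacent sites need no separate
  -- case.
  refine (tailWeight_le (F := insert D₀ F') (fun D h1 h2 h3 => ?_) n
    (ENNReal.ofReal (Real.exp (-6 * β * n))) (pairFactor β s x y n)
    fun m hx hy => prod_le_prod_pairFactor hβ hs hxy hD₀F' m hx hy).trans
    (mul_le_mul' le_rfl ?_)
  · rw [Finset.mem_insert, hF', Finset.mem_erase, mem_family]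
    exact (em (D = D₀)).imp id fun h => ⟨h, h2, h1, h3⟩
  · rw [mul_comm (S * B), ENNReal.ofReal_mul (Real.exp_pos _).le, ENNReal.ofReal_mul hS0.le]
    refine mul_le_mul' le_rfl ?_
    rw [Finset.prod_insert hD₀F']
    refine mul_le_mul' ?_ ?_
    · simp only [pairFactor, hD₀, if_true]
      rw [hS, ENNReal.ofReal_tsum_of_nonneg (fun _ => (Real.exp_pos _).le) (summable_exp_abs hβ)]
      refine ENNReal.tsum_comp_le_tsum_of_injective (f := fun k : ℕ => (k : ℤ) - n) ?_
        fun k : ℤ => ENNReal.ofReal (Real.exp (-β * |(k : ℝ)|))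
      intro a b hab
      simp only at hab
      omega
    · refine le_trans (le_of_eq (Finset.prod_congr rfl fun D hD => ?_))
        (prod_tilted_le hβ (by positivity) hK (F := F') (N := N) (Finset.erase_subset _ _)
          fun D hD => ?_)
      · exact tsum_congr fun k => if_neg (Finset.ne_of_mem_erase hD)
      · obtain ⟨hne, hD⟩ := Finset.mem_erase.1 hD
        obtain ⟨_, _, hor⟩ := mem_family.1 hD
        by_cases hboth : x ∈ D ∧ y ∈ D
        · have h8 : (8 : ℝ) ≤ (darts D).card := by
            exact_mod_cast eight_le_card_darts hboth.1 hboth.2 hxy hne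
          have : hits x y D = 2 := by simp [hits, hboth.1, hboth.2]
          rw [this, hs]
          push_cast
          nlinarith
        · have h4 : (4 : ℝ) ≤ (darts D).card := by
            rcases hor with h | h <;> exact_mod_cast four_le_card_darts h
          have : hits x y D = 1 := by
            rcases hor with h | h
            · have hy : y ∉ D := fun h' => hboth ⟨h, h'⟩
              simp [hits, h, hy]
            · have hx : x ∉ D := fun h' => hboth ⟨h', h⟩
              simp [hits, h, hx]
          rw [this, hs]
          push_cast
          nlinarith

/-! ### Replacing contacts by downward spikes -/

/-- The wetting point `log (e^{4β} / (e^{4β} - 1))`. -/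
def wettingPoint (β : ℝ) : ℝ := Real.log (Real.exp (4 * β) / (Real.exp (4 * β) - 1))

theorem exp_wettingPoint {β : ℝ} (hβ : 0 < β) :
    Real.exp (wettingPoint β) = (1 - Real.exp (-(4 * β)))⁻¹ := by
  have h : 1 < Real.exp (4 * β) := Real.one_lt_exp_iff.2 (by linarith)
  have h' : 0 < Real.exp (4 * β) - 1 := by linarith
  rw [wettingPoint, Real.exp_log (by positivity), Real.exp_neg]
  field_simp

/-- The weight of a spike at a single site: `e^{-4β}` for each unit of depth, and an additional
reward `u` for contacts. -/
def spike (β u : ℝ) (j : ℤ) : ℝ :=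
  -(4 * β) * ((max (-j) 0 : ℤ) : ℝ) + if j ≤ 0 then u else 0

/-- At k = 0 this is the geometric series Σ e^{-4βj} = e^{h*}, times e^u; a positive height has a
single preimage under j ↦ j⁺ and a negative one has none. -/
theorem wettingSite_eq_tsum {β : ℝ} (hβ : 0 < β) (u : ℝ) (k : ℤ) :
    wettingSite (wettingPoint β + u) k =
      ∑' j : ℤ, if max j 0 = k then ENNReal.ofReal (Real.exp (spike β u j)) else 0 := by
  rcases lt_trichotomy k 0 with hk | rfl | hk
  · rw [wettingSite, if_pos hk]
    symm
    refine ENNReal.tsum_eq_zero.2 fun j => if_neg ?_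
    have := le_max_right j 0
    omega
  · rw [wettingSite_zero]
    have hinj : Function.Injective fun i : ℕ => -(i : ℤ) := fun a b h => by
      simp only at h
      omega
    rw [← hinj.tsum_eq]
    · have h : ∀ i : ℕ, (if max (-(i : ℤ)) 0 = 0 then
          ENNReal.ofReal (Real.exp (spike β u (-(i : ℤ)))) else 0) =
          ENNReal.ofReal (Real.exp u) * ENNReal.ofReal (Real.exp (-(4 * β))) ^ i := by
        intro i
        rw [if_pos (by omega), ← ENNReal.ofReal_pow (Real.exp_pos _).le, ← Real.exp_nat_mul,
          ← ENNReal.ofReal_mul (Real.exp_pos _).le, ← Real.exp_add, spike,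
          if_pos (by omega), neg_neg, max_eq_left (by omega)]
        congr 2
        push_cast
        ring
      have hlt : 0 < 1 - Real.exp (-(4 * β)) := by
        have : Real.exp (-(4 * β)) < 1 := Real.exp_lt_one_iff.2 (by linarith)
        linarith
      rw [tsum_congr h, ENNReal.tsum_mul_left, ENNReal.tsum_geometric, Real.exp_add,
        exp_wettingPoint hβ, ← ENNReal.ofReal_one, ← ENNReal.ofReal_sub _ (Real.exp_pos _).le,
        ← ENNReal.ofReal_inv_of_pos hlt, ← ENNReal.ofReal_mul (Real.exp_pos _).le, mul_comm]
    · intro j hj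
      have hj' : max j 0 = 0 := by
        by_contra h
        exact hj (if_neg h)
      exact ⟨(-j).toNat, by simp only; omega⟩
  · rw [wettingSite, if_neg (by omega), if_neg (by omega), tsum_eq_single k]
    · rw [if_pos (by omega), spike, if_neg (by omega), max_eq_right (by omega)]
      simp
    · intro j hj
      exact if_neg (by omega)

/-- Expanding the product of the single-site sums turns the wall constraint into a sum over
unconstrained ζ with η = ζ⁺. -/
theorem tsum_mul_prod_wettingSite {β : ℝ} (hβ : 0 < β) (u : ℝ) (Λ : Finset Site)
    (F : (Λ → ℤ) → ℝ≥0∞) :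
    ∑' η, F η * ∏ x, wettingSite (wettingPoint β + u) (η x) =
      ∑' ζ : Λ → ℤ, F (fun x => max (ζ x) 0) *
        ENNReal.ofReal (Real.exp (∑ x, spike β u (ζ x))) := by
  classical
  have h : ∀ η : Λ → ℤ, ∏ x, wettingSite (wettingPoint β + u) (η x) =
      ∑' ζ : Λ → ℤ, if (fun x => max (ζ x) 0) = η then
        ENNReal.ofReal (Real.exp (∑ x, spike β u (ζ x))) else 0 := by
    intro η
    simp only [wettingSite_eq_tsum hβ]
    rw [← tsum_pi_prod Λ fun x j => if max j 0 = η x then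
      ENNReal.ofReal (Real.exp (spike β u j)) else 0]
    refine tsum_congr fun ζ => ?_
    split_ifs with hζ
    · rw [Real.exp_sum, ENNReal.ofReal_prod_of_nonneg fun _ _ => (Real.exp_pos _).le]
      exact Finset.prod_congr rfl fun x _ => if_pos (congrFun hζ x)
    · obtain ⟨x, hx⟩ := Function.ne_iff.1 hζ
      exact Finset.prod_eq_zero (Finset.mem_univ x) (if_neg hx)
  simp only [h, ← ENNReal.tsum_mul_left]
  rw [ENNReal.tsum_comm]
  refine tsum_congr fun ζ => ?_
  rw [tsum_eq_single fun x => max (ζ x) 0]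
  · rw [if_pos rfl]
  · intro η hη
    rw [if_neg hη.symm, mul_zero]

theorem sum_coe_extend (f : ℤ → ℝ) {Λ : Finset Site} (φ : Λ → ℤ) :
    ∑ x, f (φ x) = ∑ p ∈ Λ, f (extend Λ φ p) := by
  rw [← Finset.sum_coe_sort Λ]
  exact Finset.sum_congr rfl fun x _ => by rw [extend_coe]

theorem extend_comp (f : ℤ → ℤ) (hf : f 0 = 0) {Λ : Finset Site} (φ : Λ → ℤ) :
    extend Λ (fun x => f (φ x)) = fun p => f (extend Λ φ p) := by
  have := extend_restrict (Λ := Λ) (ψ := fun p => f (extend Λ φ p))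
    fun p hp => by rw [extend_of_notMem φ p hp, hf]
  rw [← this]
  simp only [extend_coe]

/-- At the wetting point, the wetting partition function is bounded by the one of the SOS model. -/
theorem genPartition_wettingPoint_le {β : ℝ} (hβ : 0 < β) (Λ : Finset Site) :
    genPartition β (wettingSite (wettingPoint β)) Λ ≤ genPartition β (fun _ => 1) Λ := by
  have h := tsum_mul_prod_wettingSite hβ 0 Λ fun η => gibbs β (extend Λ η)
  rw [add_zero] at h
  unfold genPartition
  rw [h]
  refine ENNReal.tsum_le_tsum fun ζ => ?_
  rw [Finset.prod_const_one, mul_one, gibbs, gibbs, ← ENNReal.ofReal_mul (Real.exp_pos _).le,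
    ← Real.exp_add, sum_coe_extend]
  refine ENNReal.ofReal_le_ofReal (Real.exp_le_exp.2 ?_)
  rw [extend_comp (fun k => max k 0) rfl]
  set ψ := extend Λ ζ with hψdef
  have hψ : ∀ p ∉ Λ, ψ p = 0 := extend_of_notMem ζ
  have hneg : ∀ p ∉ Λ, -max (-ψ p) 0 = 0 := fun p hp => by simp [hψ p hp]
  have h1 := energy_le_add (ψ := ψ) (ψ₁ := fun p => max (ψ p) 0) (ψ₂ := fun p => -max (-ψ p) 0)
    (Λ := Λ) (fun p hp => by simp [hψ p hp]) hneg fun p => by omega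
  have h2 := energy_le (Λ := Λ) (ψ := fun p => -max (-ψ p) 0) hneg
  have h3 : ∑ p ∈ Λ, |((-max (-ψ p) 0 : ℤ) : ℝ)| = ∑ p ∈ Λ, ((max (-ψ p) 0 : ℤ) : ℝ) := by
    refine Finset.sum_congr rfl fun p _ => ?_
    rw [Int.cast_neg, abs_neg, abs_of_nonneg]
    exact_mod_cast le_max_right _ _
  rw [h3] at h2
  simp only [spike, ite_self, add_zero]
  rw [← Finset.mul_sum]
  nlinarith

/-! ### Lower bound: reflection at height n -/

theorem energy_const_mul (n : ℕ) (ψ : Site → ℤ) :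
    energy (fun p => (n : ℤ) * ψ p) = n * energy ψ := by
  unfold energy
  have : grad (fun p => (n : ℤ) * ψ p) = fun e => (n : ℝ) * grad ψ e := by
    funext e
    unfold grad
    push_cast
    rw [← mul_sub, abs_mul, Nat.abs_cast]
    split_ifs <;> simp
  rw [this, tsum_mul_left]
  ring

/-- The number of sites of height at least `n`. -/
def highSites (N n : ℕ) (ψ : Site → ℤ) : ℝ :=
  ∑ x ∈ box N, if (n : ℤ) ≤ ψ x then 1 else 0

/-- The common excess above level `n` of neighbouring sites. -/
def commonExcess (N n : ℕ) (ψ : Site → ℤ) : ℝ :=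
  ∑ x ∈ box N, ∑ y ∈ box N,
    if Nbr x y then ((min (max (ψ x - n) 0) (max (ψ y - n) 0) : ℤ) : ℝ) else 0

/-- Lower bound for the wetting partition function by an exponential moment of the SOS model. -/
theorem le_genPartition_wettingSite {β : ℝ} (hβ : 0 < β) (u : ℝ) (N n : ℕ) :
    ENNReal.ofReal (Real.exp (-β * (n * (4 * N)))) *
      ∑' ξ : box N → ℤ, ENNReal.ofReal (weight β (box N) ξ *
        Real.exp (u * highSites N n (extend (box N) ξ) -
          β * commonExcess N n (extend (box N) ξ))) ≤
    genPartition β (wettingSite (wettingPoint β + u)) (box N) := by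
  classical
  unfold genPartition
  -- The substitution ζ = n - ξ turns the contacts into {ξ ≥ n} and the depth of the spikes into (ξ
  -- - n)⁺.
  rw [tsum_mul_prod_wettingSite hβ u (box N) fun η => gibbs β (extend (box N) η),
    ← (Equiv.subLeft (fun _ : box N => (n : ℤ))).tsum_eq fun ζ : box N → ℤ =>
      gibbs β (extend (box N) fun x => max (ζ x) 0) *
        ENNReal.ofReal (Real.exp (∑ x, spike β u (ζ x))), ← ENNReal.tsum_mul_left]
  refine ENNReal.tsum_le_tsum fun ξ => ?_
  simp only [Equiv.subLeft_apply, Pi.sub_apply]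
  set ψ := extend (box N) ξ with hψdef
  have hψ : ∀ p ∉ box N, ψ p = 0 := extend_of_notMem ξ
  -- (n - ξ)⁺ = n - min(ξ, n) on the box. The plateau costs only its perimeter, of order nN, and the
  -- energy of the capped field is computed by `energy_min_add`, where the spike terms cancel.
  have hext : extend (box N) (fun x => max ((n : ℤ) - ξ x) 0) = fun p =>
      (n : ℤ) * (if p ∈ box N then 1 else 0) + -min (ψ p) n := by
    funext p
    by_cases hp : p ∈ box N
    · have : ψ p = ξ ⟨p, hp⟩ := dif_pos hp
      rw [extend, dif_pos hp, if_pos hp, this]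
      omega
    · rw [extend, dif_neg hp, if_neg hp, hψ p hp]
      simp
  have h1 := energy_le_add (ψ := extend (box N) (fun x => max ((n : ℤ) - ξ x) 0))
    (ψ₁ := fun p => (n : ℤ) * (if p ∈ box N then 1 else 0)) (ψ₂ := fun p => -min (ψ p) n)
    (Λ := box N) (fun p hp => by simp [hp]) (fun p hp => by simp [hψ p hp])
    (fun p => congrFun hext p)
  rw [energy_const_mul n fun p => if p ∈ box N then 1 else 0, energy_indicator,
    energy_neg fun p => min (ψ p) n] at h1
  have h2 := energy_min_add hψ (Nat.cast_nonneg n : (0 : ℤ) ≤ n)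
  have h3 : (n : ℝ) * ((darts (box N)).card : ℝ) ≤ n * (4 * N) :=
    mul_le_mul_of_nonneg_left (by exact_mod_cast card_darts_box_le N) (Nat.cast_nonneg n)
  have h4 : ∑ x, spike β u ((n : ℤ) - ξ x) =
      -(4 * β) * ∑ p ∈ box N, ((max (ψ p - n) 0 : ℤ) : ℝ) + u * highSites N n ψ := by
    rw [sum_coe_extend (fun k => spike β u ((n : ℤ) - k)), ← hψdef, highSites, Finset.mul_sum,
      Finset.mul_sum, ← Finset.sum_add_distrib]
    refine Finset.sum_congr rfl fun p _ => ?_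
    rw [spike, neg_sub]
    simp
  rw [weight, hamiltonian_eq_energy, gibbs, h4, ← Real.exp_add,
    ← ENNReal.ofReal_mul (Real.exp_pos _).le, ← ENNReal.ofReal_mul (Real.exp_pos _).le,
    ← Real.exp_add, ← Real.exp_add]
  refine ENNReal.ofReal_le_ofReal (Real.exp_le_exp.2 ?_)
  change _ = _ + commonExcess N n ψ at h2
  have h5 : energy (extend (box N) fun x => max ((n : ℤ) - ξ x) 0) ≤
      n * (4 * N) + (energy ψ + commonExcess N n ψ) -
        4 * ∑ p ∈ box N, ((max (ψ p - n) 0 : ℤ) : ℝ) := by linarith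
  have h6 := mul_le_mul_of_nonneg_left h5 hβ.le
  linarith

/-! ### Probabilities in the SOS model -/

/-- By the symmetry φ ↦ -φ, the height at `x` is nonnegative with probability at least 1/2. -/
theorem genPartition_one_le_two_mul (β : ℝ) (N : ℕ) (x : Site) :
    genPartition β (fun _ => 1) (box N) ≤ 2 * tailWeight β N x x 0 := by
  have hneg : tailWeight β N x x 0 = ∑' φ : box N → ℤ,
      if extend (box N) φ x ≤ 0 then gibbs β (extend (box N) φ) else 0 := by
    unfold tailWeight
    rw [← (Equiv.neg (box N → ℤ)).tsum_eq]
    refine tsum_congr fun φ => ?_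
    have : extend (box N) (Equiv.neg (box N → ℤ) φ) = fun p => -extend (box N) φ p :=
      extend_comp (fun k => -k) rfl φ
    rw [this]
    simp only [gibbs, energy_neg, and_self, Nat.cast_zero, Left.nonneg_neg_iff]
  rw [two_mul]
  nth_rewrite 2 [hneg]
  unfold genPartition tailWeight
  rw [← ENNReal.tsum_add]
  refine ENNReal.tsum_le_tsum fun φ => ?_
  simp only [Finset.prod_const_one, mul_one, and_self, Nat.cast_zero]
  rcases le_total 0 (extend (box N) φ x) with h | h
  · rw [if_pos h]
    exact le_self_add
  · rw [if_pos h]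
    exact le_add_self

/-- Raising the single site `x` by n is injective and costs at most 4n in energy. -/
theorem tailWeight_zero_le {β : ℝ} (hβ : 0 < β) {N : ℕ} {x : Site} (hx : x ∈ box N) (n : ℕ) :
    tailWeight β N x x 0 ≤ ENNReal.ofReal (Real.exp (4 * β * n)) * tailWeight β N x x n := by
  classical
  unfold tailWeight
  rw [← ENNReal.tsum_mul_left]
  let s : box N → ℤ := Pi.single ⟨x, hx⟩ (n : ℤ)
  have hext : ∀ φ p, extend (box N) (φ + s) p =
      extend (box N) φ p + if p = x then (n : ℤ) else 0 := by
    intro φ p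
    by_cases hp : p ∈ box N
    · rw [extend, extend, dif_pos hp, dif_pos hp, Pi.add_apply]
      simp only [s, Pi.single_apply, Subtype.mk.injEq]
    · have : p ≠ x := fun h => hp (by rwa [h])
      rw [extend_of_notMem _ _ hp, extend_of_notMem _ _ hp, if_neg this, add_zero]
  refine le_trans (ENNReal.tsum_le_tsum fun φ => ?_)
    (ENNReal.tsum_comp_le_tsum_of_injective (add_left_injective s) fun φ =>
      ENNReal.ofReal (Real.exp (4 * β * n)) *
        if (n : ℤ) ≤ extend (box N) φ x ∧ (n : ℤ) ≤ extend (box N) φ x then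
          gibbs β (extend (box N) φ) else 0)
  simp only [and_self, Nat.cast_zero]
  split_ifs with h1 h2 h2
  · rw [gibbs, gibbs, ← ENNReal.ofReal_mul (Real.exp_pos _).le, ← Real.exp_add]
    refine ENNReal.ofReal_le_ofReal (Real.exp_le_exp.2 ?_)
    have hsupp : ∀ p ∉ box N, (if p = x then (n : ℤ) else 0) = 0 :=
      fun p hp => if_neg fun h => hp (by rwa [h])
    have h3 := energy_le_add (ψ := extend (box N) (φ + s)) (ψ₁ := extend (box N) φ)
      (ψ₂ := fun p => if p = x then (n : ℤ) else 0) (Λ := box N) (extend_of_notMem φ)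
      hsupp (hext φ)
    have h4 := energy_le (ψ := fun p => if p = x then (n : ℤ) else 0) (Λ := {x})
      fun p hp => if_neg (by simpa using hp)
    simp at h4
    nlinarith
  · exfalso
    rw [hext, if_pos rfl] at h2
    omega
  · exact zero_le
  · exact zero_le

theorem toReal_tailWeight_ge {β : ℝ} (hβ : 0 < β) {N : ℕ} {x : Site} (hx : x ∈ box N) (n : ℕ) :
    partitionFn β (box N) * (Real.exp (-(4 * β * n)) / 2) ≤ (tailWeight β N x x n).toReal := by
  have h := (genPartition_one_le_two_mul β N x).trans
    (mul_le_mul' le_rfl (tailWeight_zero_le hβ hx n))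
  have hle : tailWeight β N x x n ≤ genPartition β (fun _ => 1) (box N) := by
    refine ENNReal.tsum_le_tsum fun φ => ?_
    rw [Finset.prod_const_one, mul_one]
    split_ifs
    · exact le_rfl
    · exact zero_le
  have htop := ne_top_of_le_ne_top (genPartition_one_ne_top hβ (box N)) hle
  have h' := ENNReal.toReal_mono
    (ENNReal.mul_ne_top (by simp) (ENNReal.mul_ne_top ENNReal.ofReal_ne_top htop)) h
  rw [ENNReal.toReal_mul, ENNReal.toReal_mul, ENNReal.toReal_ofReal (Real.exp_pos _).le,
    ← partitionFn_eq hβ, ENNReal.toReal_ofNat] at h'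
  rw [Real.exp_neg]
  have := Real.exp_pos (4 * β * n)
  field_simp
  linarith

/-! ### Jensen's inequality and the first moments -/

theorem jensen_exp {α : Type*} {W X : α → ℝ} (hW0 : ∀ a, 0 ≤ W a) (hW : Summable W)
    (hX : Summable fun a => W a * X a) (hE : Summable fun a => W a * Real.exp (X a)) {M : ℝ}
    (hM : (∑' a, W a) * M ≤ ∑' a, W a * X a) :
    Real.exp M * ∑' a, W a ≤ ∑' a, W a * Real.exp (X a) := by
  -- The tangent line of the exponential at M; the measure need not be normalized.
  have h1 : ∀ a, Real.exp M * (W a * X a + (1 - M) * W a) ≤ W a * Real.exp (X a) := by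
    intro a
    have h := Real.add_one_le_exp (X a - M)
    rw [Real.exp_sub, le_div_iff₀ (Real.exp_pos M)] at h
    have := mul_le_mul_of_nonneg_left h (hW0 a)
    linarith
  have h2 := ((hX.add (hW.mul_left (1 - M))).mul_left (Real.exp M)).tsum_le_tsum h1 hE
  rw [tsum_mul_left, hX.tsum_add (hW.mul_left _), tsum_mul_left] at h2
  refine le_trans (mul_le_mul_of_nonneg_left ?_ (Real.exp_pos M).le) h2
  linarith

/-- The excess above level `n` that two sites have in common. -/
def pairExcess (n : ℕ) (ψ : Site → ℤ) (x y : Site) : ℝ :=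
  ((min (max (ψ x - n) 0) (max (ψ y - n) 0) : ℤ) : ℝ)

theorem pairExcess_nonneg (n : ℕ) (ψ : Site → ℤ) (x y : Site) : 0 ≤ pairExcess n ψ x y := by
  unfold pairExcess
  exact_mod_cast le_min (le_max_right _ _) (le_max_right _ _)

/-- Layer-cake formula: the common excess counts the levels above n that both sites reach. -/
theorem ofReal_mul_pairExcess (w : ℝ) (n : ℕ) (ψ : Site → ℤ) (x y : Site) :
    ENNReal.ofReal (w * pairExcess n ψ x y) = ∑' k : ℕ,
      if ((n + (k + 1) : ℕ) : ℤ) ≤ ψ x ∧ ((n + (k + 1) : ℕ) : ℤ) ≤ ψ y then ENNReal.ofReal w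
        else 0 := by
  set a : ℤ := min (max (ψ x - n) 0) (max (ψ y - n) 0) with ha
  have ha0 : 0 ≤ a := le_min (le_max_right _ _) (le_max_right _ _)
  have hiff : ∀ k : ℕ, (((n + (k + 1) : ℕ) : ℤ) ≤ ψ x ∧ ((n + (k + 1) : ℕ) : ℤ) ≤ ψ y) ↔
      k < a.toNat := by
    intro k
    push_cast
    omega
  simp only [hiff]
  rw [tsum_eq_sum (s := Finset.range a.toNat)
      fun k hk => if_neg (by simpa using hk),
    Finset.sum_congr rfl fun k hk => if_pos (Finset.mem_range.1 hk), Finset.sum_const,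
    Finset.card_range, nsmul_eq_mul, pairExcess, ← ha, mul_comm w,
    ENNReal.ofReal_mul (by exact_mod_cast ha0)]
  congr 1
  have : (a : ℝ) = ((a.toNat : ℕ) : ℝ) := by exact_mod_cast (Int.toNat_of_nonneg ha0).symm
  rw [this, ENNReal.ofReal_natCast]

theorem exists_pairExcess_le {β : ℝ} (hβ : 0 < β) (hfin : ContourSummable β) :
    ∃ C : ℝ, 0 < C ∧ ∀ (N n : ℕ) (x y : Site), x ≠ y →
      (Summable fun ξ => weight β (box N) ξ * pairExcess n (extend (box N) ξ) x y) ∧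
      ∑' ξ, weight β (box N) ξ * pairExcess n (extend (box N) ξ) x y ≤
        partitionFn β (box N) * (C * Real.exp (-6 * β * n)) := by
  obtain ⟨C, hC, h⟩ := exists_tailWeight_pair_le hβ hfin
  set S := ∑' k : ℤ, Real.exp (-(6 * β) * |(k : ℝ)|) with hS
  have hsum := summable_exp_abs (by linarith : 0 < 6 * β)
  have hS0 : 0 < S := hsum.tsum_pos (fun _ => (Real.exp_pos _).le) 0 (Real.exp_pos _)
  refine ⟨C * S, by positivity, fun N n x y hxy => ?_⟩
  have hpos : ∀ ξ, 0 ≤ weight β (box N) ξ * pairExcess n (extend (box N) ξ) x y :=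
    fun ξ => mul_nonneg (weight_pos _ _ _).le (pairExcess_nonneg _ _ _ _)
  have hb : ∑' ξ, ENNReal.ofReal (weight β (box N) ξ * pairExcess n (extend (box N) ξ) x y) ≤
      genPartition β (fun _ => 1) (box N) *
        ENNReal.ofReal (C * S * Real.exp (-6 * β * n)) := by
    calc ∑' ξ, ENNReal.ofReal (weight β (box N) ξ * pairExcess n (extend (box N) ξ) x y)
        = ∑' k : ℕ, tailWeight β N x y (n + (k + 1)) := by
          simp only [ofReal_mul_pairExcess]
          rw [ENNReal.tsum_comm]
          refine tsum_congr fun k => tsum_congr fun ξ => ?_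
          rw [ofReal_weight, Finset.prod_const_one, mul_one]
      _ ≤ ∑' k : ℕ, genPartition β (fun _ => 1) (box N) *
            ENNReal.ofReal (C * Real.exp (-6 * β * (n + (k + 1) : ℕ))) :=
          ENNReal.tsum_le_tsum fun k => h N x y hxy _
      _ = genPartition β (fun _ => 1) (box N) * (ENNReal.ofReal (C * Real.exp (-6 * β * n)) *
            ∑' k : ℕ, ENNReal.ofReal (Real.exp (-(6 * β) * |(((k : ℤ) + 1 : ℤ) : ℝ)|))) := by
          rw [ENNReal.tsum_mul_left]
          congr 1
          rw [← ENNReal.tsum_mul_left]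
          refine tsum_congr fun k => ?_
          rw [← ENNReal.ofReal_mul (by positivity), mul_assoc C, ← Real.exp_add]
          congr 3
          push_cast
          rw [abs_of_nonneg (by positivity)]
          ring
      _ ≤ genPartition β (fun _ => 1) (box N) * (ENNReal.ofReal (C * Real.exp (-6 * β * n)) *
            ENNReal.ofReal S) := by
          refine mul_le_mul' le_rfl (mul_le_mul' le_rfl ?_)
          rw [hS, ENNReal.ofReal_tsum_of_nonneg (fun _ => (Real.exp_pos _).le) hsum]
          refine ENNReal.tsum_comp_le_tsum_of_injective (f := fun k : ℕ => (k : ℤ) + 1) ?_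
            fun k : ℤ => ENNReal.ofReal (Real.exp (-(6 * β) * |(k : ℝ)|))
          intro a b hab
          simp only at hab
          omega
      _ = _ := by
          rw [← ENNReal.ofReal_mul (by positivity)]
          congr 2
          ring
  have htop : genPartition β (fun _ => 1) (box N) *
      ENNReal.ofReal (C * S * Real.exp (-6 * β * n)) ≠ ∞ :=
    ENNReal.mul_ne_top (genPartition_one_ne_top hβ _) ENNReal.ofReal_ne_top
  have hs := summable_of_tsum_ofReal hpos (ne_top_of_le_ne_top htop hb)
  refine ⟨hs, ?_⟩
  have h1 := ENNReal.toReal_mono htop hb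
  rw [← ENNReal.ofReal_tsum_of_nonneg hpos hs, ENNReal.toReal_ofReal (tsum_nonneg hpos),
    ENNReal.toReal_mul, ENNReal.toReal_ofReal (by positivity), ← partitionFn_eq hβ] at h1
  exact h1

theorem hasSum_highSites {β : ℝ} (hβ : 0 < β) (N n : ℕ) :
    HasSum (fun ξ => weight β (box N) ξ * highSites N n (extend (box N) ξ))
      (∑ x ∈ box N, (tailWeight β N x x n).toReal) := by
  have h : ∀ x, HasSum (fun ξ => weight β (box N) ξ *
      if (n : ℤ) ≤ extend (box N) ξ x then 1 else 0) (tailWeight β N x x n).toReal := by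
    intro x
    have hpos : ∀ ξ : box N → ℤ, 0 ≤ weight β (box N) ξ *
        if (n : ℤ) ≤ extend (box N) ξ x then 1 else 0 := by
      intro ξ
      have := (weight_pos β (box N) ξ).le
      split_ifs <;> simp [this]
    have hs : Summable (fun ξ => weight β (box N) ξ *
        if (n : ℤ) ≤ extend (box N) ξ x then 1 else 0) := by
      refine (summable_weight hβ (box N)).of_nonneg_of_le hpos fun ξ => ?_
      have := (weight_pos β (box N) ξ).le
      split_ifs <;> simp [this]
    have : tailWeight β N x x n = ∑' ξ, ENNReal.ofReal (weight β (box N) ξ *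
        if (n : ℤ) ≤ extend (box N) ξ x then 1 else 0) := by
      refine tsum_congr fun ξ => ?_
      simp only [and_self]
      split_ifs
      · rw [mul_one, ofReal_weight, Finset.prod_const_one, mul_one]
      · simp
    rw [this, ← ENNReal.ofReal_tsum_of_nonneg hpos hs, ENNReal.toReal_ofReal (tsum_nonneg hpos)]
    exact hs.hasSum
  have := hasSum_sum (s := box N) fun x _ => h x
  simpa only [highSites, Finset.mul_sum] using this

/-- Comparison of the free energies through the first two moments at level `n`. -/
theorem exists_freeEnergy_add_le {β : ℝ} (hβ : 0 < β) (hfin : ContourSummable β) :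
    ∃ C : ℝ, 0 < C ∧ ∀ (u p : ℝ) (n : ℕ),
      (∀ (N : ℕ), ∀ x ∈ box N,
        partitionFn β (box N) * p ≤ u * (tailWeight β N x x n).toReal) →
      freeEnergy β + (p - C * Real.exp (-6 * β * n)) ≤
        wettingFreeEnergy β (wettingPoint β + u) := by
  obtain ⟨C, hC, hpair⟩ := exists_pairExcess_le hβ hfin
  -- Each site has at most four neighbours, and each ordered pair contributes at most βC e^{-6βn} to
  -- the mean. The bound p on u times the tail probability keeps both signs of u available.
  refine ⟨β * (4 * C), by positivity, fun u p n hp => ?_⟩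
  set δ := C * Real.exp (-6 * β * n) with hδ
  have hδ0 : 0 ≤ δ := by positivity
  have hmain : ∀ N : ℕ, -β * (n * (4 * N)) + (N : ℝ) ^ 2 * (p - β * (4 * δ)) +
      Real.log (partitionFn β (box N)) ≤
        Real.log (wettingPartitionFn β (wettingPoint β + u) (box N)) := by
    intro N
    set Z := partitionFn β (box N) with hZ
    have hZ0 : 0 < Z := partitionFn_pos hβ _
    have hone := hasSum_highSites hβ N n
    have hQ : ∀ x y, HasSum (fun ξ => if Nbr x y then
          weight β (box N) ξ * pairExcess n (extend (box N) ξ) x y else 0)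
        (if Nbr x y then
          ∑' ξ, weight β (box N) ξ * pairExcess n (extend (box N) ξ) x y else 0) := by
      intro x y
      split_ifs with hxy
      · exact (hpair N n x y hxy.ne).1.hasSum
      · exact hasSum_zero
    have htwo := hasSum_sum (s := box N) fun x _ => hasSum_sum (s := box N) fun y _ => hQ x y
    have hX := (hone.mul_left u).sub (htwo.mul_left β)
    have hXeq : (fun ξ => u * (weight β (box N) ξ * highSites N n (extend (box N) ξ)) -
        β * ∑ x ∈ box N, ∑ y ∈ box N, if Nbr x y then
          weight β (box N) ξ * pairExcess n (extend (box N) ξ) x y else 0) =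
        fun ξ => weight β (box N) ξ * (u * highSites N n (extend (box N) ξ) -
          β * commonExcess N n (extend (box N) ξ)) := by
      funext ξ
      have : ∑ x ∈ box N, ∑ y ∈ box N, (if Nbr x y then
          weight β (box N) ξ * pairExcess n (extend (box N) ξ) x y else 0) =
          weight β (box N) ξ * commonExcess N n (extend (box N) ξ) := by
        simp only [commonExcess, Finset.mul_sum]
        refine Finset.sum_congr rfl fun x _ => Finset.sum_congr rfl fun y _ => ?_
        rw [mul_ite, mul_zero]
        rfl
      rw [this]
      ring
    rw [hXeq] at hX
    have hlow := le_genPartition_wettingSite hβ u N n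
    have hEpos : ∀ ξ : box N → ℤ, 0 ≤ weight β (box N) ξ *
        Real.exp (u * highSites N n (extend (box N) ξ) -
          β * commonExcess N n (extend (box N) ξ)) := fun ξ =>
      mul_nonneg (weight_pos _ _ _).le (Real.exp_pos _).le
    have hWtop := genPartition_wettingSite_ne_top hβ (wettingPoint β + u) (box N)
    -- The exponential moment is finite because it is dominated by the finite wetting partition
    -- function.
    have hE := summable_of_tsum_ofReal hEpos fun htop => by
      rw [htop, ENNReal.mul_top (ENNReal.ofReal_pos.2 (Real.exp_pos _)).ne'] at hlow
      exact hWtop (top_le_iff.1 hlow)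
    have hM : Z * ((N : ℝ) ^ 2 * (p - β * (4 * δ))) ≤
        ∑' ξ, weight β (box N) ξ * (u * highSites N n (extend (box N) ξ) -
          β * commonExcess N n (extend (box N) ξ)) := by
      rw [hX.tsum_eq]
      have h1 : (N : ℝ) ^ 2 * (Z * p) ≤
          u * ∑ x ∈ box N, (tailWeight β N x x n).toReal := by
        rw [Finset.mul_sum]
        have := Finset.card_nsmul_le_sum (box N) _ _ (hp N)
        rw [card_box, nsmul_eq_mul] at this
        exact_mod_cast this
      have h2 : ∑ x ∈ box N, ∑ y ∈ box N, (if Nbr x y then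
          ∑' ξ, weight β (box N) ξ * pairExcess n (extend (box N) ξ) x y else 0) ≤
          (N : ℝ) ^ 2 * (4 * (Z * δ)) := by
        have h3 : ∀ x ∈ box N, ∑ y ∈ box N, (if Nbr x y then
            ∑' ξ, weight β (box N) ξ * pairExcess n (extend (box N) ξ) x y else 0) ≤
            4 * (Z * δ) := by
          intro x _
          refine le_trans (Finset.sum_le_sum fun y _ => ?_)
            (sum_ite_nbr_le (S := box N) (x := x) (c := Z * δ) (by positivity))
          split_ifs with hxy
          · exact (hpair N n x y hxy.ne).2
          · exact le_rfl
        refine (Finset.sum_le_card_nsmul _ _ _ h3).trans (le_of_eq ?_)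
        rw [card_box, nsmul_eq_mul]
        push_cast
        ring
      have h4 := mul_le_mul_of_nonneg_left h2 hβ.le
      linarith
    have hJ := jensen_exp (fun ξ => (weight_pos β (box N) ξ).le) (summable_weight hβ _)
      hX.summable hE hM
    have hfinal := ENNReal.toReal_mono hWtop hlow
    rw [← ENNReal.ofReal_tsum_of_nonneg hEpos hE, ENNReal.toReal_mul,
      ENNReal.toReal_ofReal (Real.exp_pos _).le, ENNReal.toReal_ofReal (tsum_nonneg hEpos),
      ← wettingPartitionFn_eq hβ] at hfinal
    have h5 := (mul_le_mul_of_nonneg_left hJ (Real.exp_pos (-β * (n * (4 * N)))).le).trans hfinal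
    change _ * (_ * Z) ≤ _ at h5
    have h6 := Real.log_le_log (by positivity) h5
    rw [← mul_assoc, ← Real.exp_add, Real.log_mul (Real.exp_pos _).ne' hZ0.ne', Real.log_exp] at h6
    exact h6
  -- The plateau's perimeter cost vanishes per unit area, since n is fixed while N → ∞.
  have hlim : Tendsto (fun N : ℕ => -β * (4 * n) / (N : ℝ) + (p - β * (4 * δ)) +
      (1 / (N : ℝ) ^ 2) * Real.log (partitionFn β (box N))) atTop
      (𝓝 (0 + (p - β * (4 * δ)) + freeEnergy β)) :=
    ((tendsto_const_div_atTop_nhds_zero_nat _).add_const _).add (tendsto_freeEnergy hβ)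
  have h := le_of_tendsto_of_tendsto hlim (tendsto_wettingFreeEnergy hβ (wettingPoint β + u)) ?_
  · rw [hδ] at h
    linarith
  · filter_upwards [eventually_ge_atTop 1] with N hN
    have hN0 : (0 : ℝ) < N := by exact_mod_cast hN
    have h1 := mul_le_mul_of_nonneg_left (hmain N) (by positivity : 0 ≤ 1 / (N : ℝ) ^ 2)
    refine le_trans (le_of_eq ?_) h1
    field_simp

/-! ### The wetting transition -/

theorem wettingFreeEnergy_wettingPoint_le {β : ℝ} (hβ : 0 < β) :
    wettingFreeEnergy β (wettingPoint β) ≤ freeEnergy β := by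
  refine le_of_tendsto_of_tendsto' (tendsto_wettingFreeEnergy hβ _) (tendsto_freeEnergy hβ)
    fun N => ?_
  refine mul_le_mul_of_nonneg_left (Real.log_le_log (wettingPartitionFn_pos hβ _ _) ?_)
    (by positivity)
  rw [wettingPartitionFn_eq hβ, partitionFn_eq hβ]
  exact ENNReal.toReal_mono (genPartition_one_ne_top hβ _) (genPartition_wettingPoint_le hβ _)

theorem tendsto_exp_neg_mul_nat {c : ℝ} (hc : 0 < c) :
    Tendsto (fun n : ℕ => Real.exp (-c * n)) atTop (𝓝 0) := by
  refine Real.tendsto_exp_atBot.comp ?_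
  exact tendsto_natCast_atTop_atTop.const_mul_atTop_of_neg (by linarith)

theorem freeEnergy_le_wettingFreeEnergy {β : ℝ} (hβ : 0 < β) (hfin : ContourSummable β) (h : ℝ) :
    freeEnergy β ≤ wettingFreeEnergy β h := by
  obtain ⟨C, hC, hlow⟩ := exists_freeEnergy_add_le hβ hfin
  obtain ⟨C₁, hC₁, htail⟩ := exists_tailWeight_le hβ hfin
  -- By monotonicity in h only u ≤ 0 matters; the loss u P(ξ(x) ≥ n) then tends to 0 as n → ∞.
  set u := min (h - wettingPoint β) 0 with hu
  have hu0 : u ≤ 0 := min_le_right _ _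
  have hle : wettingFreeEnergy β (wettingPoint β + u) ≤ wettingFreeEnergy β h := by
    refine wettingFreeEnergy_mono hβ ?_
    have := min_le_left (h - wettingPoint β) 0
    linarith
  refine le_trans ?_ hle
  have h6 : Tendsto (fun n : ℕ => Real.exp (-6 * β * n)) atTop (𝓝 0) := by
    simpa using tendsto_exp_neg_mul_nat (by linarith : 0 < 6 * β)
  have hlim : Tendsto (fun n : ℕ => freeEnergy β + (u * (C₁ * Real.exp (-β * n)) -
      C * Real.exp (-6 * β * n))) atTop (𝓝 (freeEnergy β + (u * (C₁ * 0) - C * 0))) :=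
    ((((tendsto_exp_neg_mul_nat hβ).const_mul C₁).const_mul u).sub
      (h6.const_mul C)).const_add _
  simp only [mul_zero, sub_zero, add_zero] at hlim
  refine le_of_tendsto' hlim fun n => ?_
  refine hlow u (u * (C₁ * Real.exp (-β * n))) n fun N x _ => ?_
  · have h1 := ENNReal.toReal_mono
      (ENNReal.mul_ne_top (genPartition_one_ne_top hβ _) ENNReal.ofReal_ne_top) (htail N x n)
    rw [ENNReal.toReal_mul, ENNReal.toReal_ofReal (by positivity), ← partitionFn_eq hβ] at h1
    have := mul_le_mul_of_nonpos_left h1 hu0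
    linarith

/-- With t = e^{-2βn} the gain is u t²/2 and the loss C t³; taking t comparable to u but at most
u/(4C) leaves u t²/4, of order u³. -/
theorem exists_cubic_lower_bound {β : ℝ} (hβ : 0 < β) (hfin : ContourSummable β) :
    ∃ c : ℝ, 0 < c ∧ ∀ u : ℝ, 0 < u → u ≤ 1 →
      freeEnergy β + c * u ^ 3 ≤ wettingFreeEnergy β (wettingPoint β + u) := by
  obtain ⟨C, hC, hlow⟩ := exists_freeEnergy_add_le hβ hfin
  set a := Real.exp (-(2 * β)) with ha
  have ha0 : 0 < a := Real.exp_pos _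
  -- The denominator ensures Ct ≤ u/4 and, as u ≤ 1, a target value at most 1, so that n = 0 is
  -- harmless. The factor a = e^{-2β} is the loss from rounding n to an integer.
  set b := a / (4 * C + 1) with hb
  have hb0 : 0 < b := by positivity
  refine ⟨b ^ 2 / 4, by positivity, fun u hu hu1 => ?_⟩
  have hv0 : 0 < u / (4 * C + 1) := by positivity
  have hv1 : u / (4 * C + 1) ≤ 1 := by
    rw [div_le_one (by positivity)]
    linarith
  obtain ⟨n, hn1, hn2⟩ : ∃ n : ℕ, Real.exp (-(2 * β) * n) ≤ u / (4 * C + 1) ∧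
      b * u ≤ Real.exp (-(2 * β) * n) := by
    have hex : ∃ n : ℕ, Real.exp (-(2 * β) * n) ≤ u / (4 * C + 1) :=
      ((tendsto_exp_neg_mul_nat (by linarith : 0 < 2 * β)).eventually
        (ge_mem_nhds hv0)).exists
    classical
    -- The least admissible n overshoots the target by at most one factor a.
    refine ⟨Nat.find hex, Nat.find_spec hex, ?_⟩
    have hbu : b * u = a * (u / (4 * C + 1)) := by
      rw [hb]
      ring
    rcases Nat.eq_zero_or_pos (Nat.find hex) with h0 | h0
    · rw [h0, hbu]
      simp only [Nat.cast_zero, mul_zero, Real.exp_zero]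
      have : a ≤ 1 := Real.exp_le_one_iff.2 (by linarith)
      nlinarith
    · obtain ⟨k, hk⟩ : ∃ k, Nat.find hex = k + 1 := ⟨Nat.find hex - 1, by omega⟩
      have hlt := not_le.1 (Nat.find_min hex (by omega : k < Nat.find hex))
      rw [hk, hbu]
      have : Real.exp (-(2 * β) * (k + 1 : ℕ)) = a * Real.exp (-(2 * β) * k) := by
        rw [ha, ← Real.exp_add]
        congr 1
        push_cast
        ring
      rw [this]
      exact mul_le_mul_of_nonneg_left hlt.le ha0.le
  have h := hlow u (u * (Real.exp (-(4 * β * n)) / 2)) n fun N x hx => by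
    have := mul_le_mul_of_nonneg_left (toReal_tailWeight_ge hβ hx n) hu.le
    linarith
  set t := Real.exp (-(2 * β) * n) with ht
  have ht0 : 0 < t := Real.exp_pos _
  have h4 : Real.exp (-(4 * β * n)) = t ^ 2 := by
    rw [ht, ← Real.exp_nat_mul]
    congr 1
    push_cast
    ring
  have h6 : Real.exp (-6 * β * n) = t ^ 3 := by
    rw [ht, ← Real.exp_nat_mul]
    congr 1
    push_cast
    ring
  rw [h4, h6] at h
  refine le_trans ?_ h
  have hCt : C * t ≤ u / 4 := by
    rw [le_div_iff₀ (by positivity)] at hn1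
    nlinarith
  have h7 : (b * u) ^ 2 ≤ t ^ 2 := pow_le_pow_left₀ (by positivity) hn2 2
  have h8 : C * t ^ 3 ≤ u / 4 * t ^ 2 := by
    have := mul_le_mul_of_nonneg_right hCt (sq_nonneg t)
    linarith
  have h9 : u / 4 * (b * u) ^ 2 ≤ u / 4 * t ^ 2 := mul_le_mul_of_nonneg_left h7 (by positivity)
  linarith

/-- Below the wetting point, monotonicity and the two comparisons force equality; above it, the
cubic gain makes the inequality strict. -/
theorem wettingFreeEnergy_eq_iff {β : ℝ} (hβ : 0 < β) (hfin : ContourSummable β) (h : ℝ) :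
    wettingFreeEnergy β h = freeEnergy β ↔ h ≤ wettingPoint β := by
  constructor
  · intro heq
    by_contra hlt
    obtain ⟨c, hc, hcub⟩ := exists_cubic_lower_bound hβ hfin
    set u := min (h - wettingPoint β) 1 with hu
    have hu0 : 0 < u := lt_min (by linarith) one_pos
    have h1 := hcub u hu0 (min_le_right _ _)
    have h2 : wettingFreeEnergy β (wettingPoint β + u) ≤ wettingFreeEnergy β h :=
      wettingFreeEnergy_mono hβ (by linarith [min_le_left (h - wettingPoint β) 1])
    have h3 : 0 < c * u ^ 3 := by positivity
    linarith
  · intro hle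
    exact le_antisymm ((wettingFreeEnergy_mono hβ hle).trans (wettingFreeEnergy_wettingPoint_le hβ))
      (freeEnergy_le_wettingFreeEnergy hβ hfin h)

theorem criticalPoint_eq {β : ℝ} (hβ : 0 < β) (hfin : ContourSummable β) :
    criticalPoint β = wettingPoint β := by
  have : {h : ℝ | wettingFreeEnergy β h = freeEnergy β} = Set.Iic (wettingPoint β) :=
    Set.ext fun h => wettingFreeEnergy_eq_iff hβ hfin h
  rw [criticalPoint, this, csSup_Iic]

end SOS

end

theorem proposition5p1 (β : ℝ) (hβ : 0 < β) (hfin : SOS.ContourSummable β) :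
    -- the partition functions and the free energies are well defined
    (∀ N : ℕ, Summable (SOS.weight β (SOS.box N))) ∧
    (∀ (h : ℝ) (N : ℕ), Summable (SOS.wettingWeight β h (SOS.box N))) ∧
    Tendsto (fun N : ℕ => (1 / (N : ℝ) ^ 2) * Real.log (SOS.partitionFn β (SOS.box N)))
      atTop (𝓝 (SOS.freeEnergy β)) ∧
    (∀ h : ℝ, Tendsto
      (fun N : ℕ => (1 / (N : ℝ) ^ 2) * Real.log (SOS.wettingPartitionFn β h (SOS.box N)))
      atTop (𝓝 (SOS.wettingFreeEnergy β h))) ∧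
    -- the critical point is a true supremum, and separates the two phases
    IsLUB {h : ℝ | SOS.wettingFreeEnergy β h = SOS.freeEnergy β} (SOS.criticalPoint β) ∧
    IsGLB {h : ℝ | SOS.freeEnergy β < SOS.wettingFreeEnergy β h} (SOS.criticalPoint β) ∧
    -- its value, and the cubic lower bound
    SOS.criticalPoint β = Real.log (Real.exp (4 * β) / (Real.exp (4 * β) - 1)) ∧
    ∃ c : ℝ, 0 < c ∧ ∀ u : ℝ, 0 < u → u ≤ 1 → c * u ^ 3 ≤ SOS.excessFreeEnergy β u := by
  have hset : {h : ℝ | SOS.wettingFreeEnergy β h = SOS.freeEnergy β} =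
      Set.Iic (SOS.wettingPoint β) :=
    Set.ext fun h => SOS.wettingFreeEnergy_eq_iff hβ hfin h
  have hset' : {h : ℝ | SOS.freeEnergy β < SOS.wettingFreeEnergy β h} =
      Set.Ioi (SOS.wettingPoint β) := by
    ext h
    rw [Set.mem_ofPred_eq, Set.mem_Ioi, ← not_le (a := h), ← SOS.wettingFreeEnergy_eq_iff hβ hfin h]
    exact ⟨fun h1 h2 => h1.ne' h2, fun h1 =>
      (SOS.freeEnergy_le_wettingFreeEnergy hβ hfin h).lt_of_ne (Ne.symm h1)⟩
  refine ⟨fun N => SOS.summable_weight hβ _, fun h N => SOS.summable_wettingWeight hβ h _,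
    SOS.tendsto_freeEnergy hβ, SOS.tendsto_wettingFreeEnergy hβ, ?_, ?_,
    SOS.criticalPoint_eq hβ hfin, ?_⟩
  · rw [hset, SOS.criticalPoint_eq hβ hfin]
    exact isLUB_Iic
  · rw [hset', SOS.criticalPoint_eq hβ hfin]
    exact isGLB_Ioi
  · obtain ⟨c, hc, h⟩ := SOS.exists_cubic_lower_bound hβ hfin
    exact ⟨c, hc, fun u hu hu1 => le_sub_iff_add_le'.2 (h u hu hu1)⟩
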